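/- **Setting.** Let $a>0$, $\mathcal L_0=\mathbb Z(a,0)\oplus\mathbb Z(0,1/a)$, $\mathbb T^2=\mathbb R^2/2\pi\mathcal L_0$ with Lebesgue measure $\mu$ (total mass $4\pi^2$), and let $\mathcal L=\mathbb Z(1/a,0)\oplus\mathbb Z(0,a)$ be the dual lattice. Let $\mathcal Q=\{|\xi|^2:\xi\in\mathcal L\}=\{0=n_0<n_1<n_2<\cdots\}$ be the set of eigenvalues of $-\Delta$ on $\mathbb T^2$, without multiplicity. Let $\theta\ge 1/4$ be an exponent for which the circle law $\#\{\xi\in\mathcal L:|\xi|^2\le T\}=\pi T+O_\varepsilon(T^{\theta+\varepsilon})$ $(T\ge1)$ holds for every $\varepsilon>0$. For a set $\mathcal Q'\subset\mathcal Q$ put $\Sigma=\bigcup_{n_k\in\mathcal Q'}(n_k,n_{k+1})$; $\mathcal Q'$ has full density if $\#(\mathcal Q'\cap(-\infty,X])/\#(\mathcal Q\cap(-\infty,X])\to1$ as $X\to\infty$. Points $\bar\omega_1,\dots,\bar\omega_N\in\mathbb T^2$ satisfy the weak-disorder condition with constant $K$ if $$\#\{j:\bar\omega_j\in B(x_0,R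 N^{-1/2})\}\le K\max(1,R^2)\qquad\text{for all }x_0\in\mathbb T^2,\ 0<R\le N^{1/2}.$$ **Corollary 1.3 (random displacement models).** There is a set $\mathcal Q'\subset\mathcal Q$ of full density, depending only on $a$ and $\theta$, such that for all $K$ and all $\eta>0$ there are constants $C(\varepsilon,f)$, depending only on $\varepsilon$ and $f$ (and on $a,\theta,K,\eta$), with the following property. Let $r_1,r_2>0$ with $r_1+r_2\ge\eta$. Let $V\in L^2(\mathbb R^2,\mathbb R)$ vanish outside $B(0,r_2)$ (if this ball embeds in $\mathbb T^2$, this is the same as $V\in L^2(\mathbb T^2,\mathbb R)$ vanishing outside $B(0,r_2)\subset\mathbb T^2$), with $V=0$ or $\|V\|_2\ge\eta$. Let $P$ be a probability density on $\mathbb R^2$ vanishing outside $B(0,r_1)$, and let $\xi_1,\xi_2,\dots$ be i.i.d. with density $P$, with joint law $\mathbb P_\infty=\bigotimes_{j\ge1}P$. For every $N\ge1$ let $\bar\omega^{N}_1,\dots,\bar\omega^{N}_N\in\mathbb T^2$ be fixed points that satisfy the weak-disorder condition with constant $K$, put $\omega_j=\bar\omega^{N}_j+N^{-1/2}\xi_j$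 and $$H_N=-\Delta+\sum_{j=1}^N V\big(N^{1/2}(x-\omega_j)\big)\quad\text{on }L^2(\mathbb T^2)\text{ with domain }H^2(\mathbb T^2),$$ each summand being read as a function on $\mathbb T^2$ by summing over the translates of $x$ by $2\pi\mathcal L_0$. Then $\mathbb P_\infty$-almost surely the following holds: for every $N\ge1$, every $E>0$, every orthonormal basis $(\psi_k)_{k\ge0}$ of $L^2(\mathbb T^2)$ with $H_N\psi_k=\lambda_k\psi_k$, every $\varepsilon>0$, every $f\in C^\infty(\mathbb T^2)$ and every $k$ with $\lambda_k\in\Sigma\cap[E,2E]$, $$\Big|\int_{\mathbb T^2}f|\psi_k|^2\,d\mu-\frac1{4\pi^2}\int_{\mathbb T^2}f\,d\mu\Big|\le C(\varepsilon,f)\,(r_1+r_2)^2\,\|V\|_{2}\,E^{-(1-3\theta)/2+\varepsilon}.$$ -/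

import Mathlib

open MeasureTheory Filter Topology
open scoped ContDiff

namespace ToralRDM

/-- The Euclidean plane. -/
abbrev Plane : Type := EuclideanSpace ℝ (Fin 2)

/-- The points of the period lattice `2π𝓛₀`, where `𝓛₀ = ℤ(a,0) ⊕ ℤ(0,1/a)`; the torus is
`𝕋² = ℝ² / 2π𝓛₀`. -/
noncomputable def period (a : ℝ) (m : ℤ × ℤ) : Plane :=
  !₂[2 * Real.pi * a * (m.1 : ℝ), 2 * Real.pi / a * (m.2 : ℝ)]

/-- The points of the lattice `𝓛 = ℤ(1/a,0) ⊕ ℤ(0,a)` dual to `𝓛₀`. -/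
noncomputable def freq (a : ℝ) (m : ℤ × ℤ) : Plane :=
  !₂[(m.1 : ℝ) / a, a * (m.2 : ℝ)]

/-- The fundamental rectangle `[0, 2πa) × [0, 2π/a)` of the torus. -/
def cell (a : ℝ) : Set Plane :=
  {x | x 0 ∈ Set.Ico 0 (2 * Real.pi * a) ∧ x 1 ∈ Set.Ico 0 (2 * Real.pi / a)}

/-- Lebesgue measure of the torus (total mass `4π²`), carried by the fundamental rectangle. -/
noncomputable def torusMeasure (a : ℝ) : Measure Plane :=
  volume.restrict (cell a)

/-- The Hilbert space `L²(𝕋², ℂ)`. -/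
abbrev L2Torus (a : ℝ) : Type := Lp ℂ 2 (torusMeasure a)

/-- Smooth complex functions on the torus, as smooth doubly periodic functions on the plane. -/
def IsTestFunction (a : ℝ) (f : Plane → ℂ) : Prop :=
  ContDiff ℝ ∞ f ∧ ∀ (m : ℤ × ℤ) (x : Plane), f (x + period a m) = f x

/-- The exponential `e_ξ(x) = (2π)⁻¹ exp(i⟨ξ, x⟩)`, `ξ ∈ 𝓛`. -/
noncomputable def expo (a : ℝ) (m : ℤ × ℤ) (x : Plane) : ℂ :=
  (1 / (2 * Real.pi) : ℝ) * Complex.exp (Complex.I * ((inner ℝ (freq a m) x : ℝ) : ℂ))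

/-- The Fourier coefficient `ψ̂(ξ) = ⟨ψ, e_ξ⟩` on the torus. -/
noncomputable def coeff (a : ℝ) (ψ : Plane → ℂ) (m : ℤ × ℤ) : ℂ :=
  ∫ x, ψ x * (starRingEnd ℂ) (expo a m x) ∂(torusMeasure a)

/-- `ψ ∈ H²(𝕋²)` and `g = Δψ ∈ L²(𝕋²)`: the distributional Laplacian of `ψ` is `g`, that is,
`ĝ(ξ) = -|ξ|² ψ̂(ξ)` for every `ξ ∈ 𝓛`. -/
def IsLaplacian (a : ℝ) (ψ g : L2Torus a) : Prop :=
  ∀ m : ℤ × ℤ, coeff a g m = -((‖freq a m‖ ^ 2 : ℝ) : ℂ) * coeff a ψ m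

/-- `ψ` lies in the domain `H²(𝕋²)` of `-Δ + W` and satisfies `(-Δ + W) ψ = lam ψ`. -/
def SolvesEigenEq (a : ℝ) (W : Plane → ℝ) (lam : ℝ) (ψ : L2Torus a) : Prop :=
  ∃ g : L2Torus a, IsLaplacian a ψ g ∧
    ∀ᵐ x ∂(torusMeasure a), -g x + (W x : ℂ) * ψ x = (lam : ℂ) * ψ x

/-- The set `𝒬` of eigenvalues of `-Δ` on the torus, without multiplicity. -/
def laplaceSpectrum (a : ℝ) : Set ℝ :=
  Set.range fun m : ℤ × ℤ => ‖freq a m‖ ^ 2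

/-- `Q'` is a subset of `𝒬` of relative density one. -/
def IsFullDensity (a : ℝ) (Q' : Set ℝ) : Prop :=
  Q' ⊆ laplaceSpectrum a ∧
    Tendsto (fun X : ℝ => ((Q' ∩ Set.Iic X).ncard : ℝ) / ((laplaceSpectrum a ∩ Set.Iic X).ncard : ℝ))
      atTop (𝓝 1)

/-- `Σ`, the union of the open intervals `(n, n⁺)` over `n ∈ Q'`, where `n⁺` is the successor of
`n` in `𝒬`. -/
def sigmaSet (a : ℝ) (Q' : Set ℝ) : Set ℝ :=
  {lam | ∃ n ∈ Q', n < lam ∧ ∀ n' ∈ laplaceSpectrum a, n < n' → lam < n'}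

/-- The circle law with exponent `θ`: `#{ξ ∈ 𝓛 : |ξ|² ≤ T} = πT + O_ε(T^(θ+ε))`. -/
def CircleLaw (a θ : ℝ) : Prop :=
  ∀ ε : ℝ, 0 < ε → ∃ C : ℝ, ∀ T : ℝ, 1 ≤ T →
    |({m : ℤ × ℤ | ‖freq a m‖ ^ 2 ≤ T}.ncard : ℝ) - Real.pi * T| ≤ C * T ^ (θ + ε)

/-- The weak disorder condition with constant `K` for `N` points of the torus, given by
representatives in the plane: every ball `B(x₀, R N^(-1/2))` of the torus with `0 < R ≤ N^(1/2)`
contains at most `K max(1, R²)` of them. -/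
def WeakDisorder (a K : ℝ) (N : ℕ) (w : Fin N → Plane) : Prop :=
  ∀ (x₀ : Plane) (R : ℝ), 0 < R → R ≤ √(N : ℝ) →
    ({j : Fin N | ∃ m : ℤ × ℤ, dist (w j) (x₀ + period a m) < R / √(N : ℝ)}.ncard : ℝ)
      ≤ K * max 1 (R ^ 2)

/-- The potential `V_N(x) = ∑ⱼ V(N^(1/2)(x - wⱼ))` on the torus, as a periodic function on the
plane. For compactly supported `V` the inner sum has only finitely many nonzero terms. -/
noncomputable def scattererPotential (a : ℝ) (V : Plane → ℝ) (N : ℕ) (w : Fin N → Plane)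
    (x : Plane) : ℝ :=
  ∑ j : Fin N, ∑' m : ℤ × ℤ, V (√(N : ℝ) • (x - w j - period a m))

/-- The displaced positions `ωⱼ = ω̄ⱼ + N^(-1/2) ξⱼ`. -/
noncomputable def displaced (N : ℕ) (w : Fin N → Plane) (ξ : ℕ → Plane) (j : Fin N) : Plane :=
  w j + (√(N : ℝ))⁻¹ • ξ j

/-- The `L²` norm of a real function on the plane. -/
noncomputable def l2norm (V : Plane → ℝ) : ℝ :=
  (eLpNorm V 2 volume).toReal

end ToralRDM

open ToralRDM

/-!
The potential enters only through a bound on the Fourier coefficients of an eigenfunction. If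
`-Δψ + Wψ = λψ` with `‖ψ‖ = 1`, then `|ψ̂(ξ)| · ||ξ|² - λ|` is the absolute value of a Fourier
coefficient of `Wψ`, hence at most `‖W‖₂`. By weak disorder at most `O(max 1 (r₁ + r₂)²)` scatterers
overlap at a point, so that `‖W‖₂ ≪ max 1 (r₁ + r₂) ‖V‖₂`, uniformly in the number of scatterers
(`exists_norm_coeff_mul_le`). Randomness plays no role beyond `|ξ_j| < r₁`, which holds almost surely
for all `j` at once.

For most `n` in the Laplace spectrum and `λ` between `n` and the next eigenvalue, the following
holds with `l = 1 - 3θ - ε` (`exists_powerSparse_exceptional_set`).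

* The gap after `n` is at most `n ^ l`, because at most `X / G` gaps below `X` are longer than `G`.
* The sum of `(|ξ|² - λ)⁻²` over the lattice points `ξ` outside the annulus `||ξ|² - n| ≤ 2 n ^ l` is
  at most about `n ^ (-l)`, because this is its mean over `n`. The mean is computed from the count of
  pairs of lattice points with nearby norms (`exists_ncard_near_pairs_le`): these are solutions of
  `|u v / a² + a² s t| ≤ D`, and the divisor bound applies.
* No two lattice points of the annulus have a short nonzero difference `z`, because such a pair lies
  in a thin strip orthogonal to `z`; there are `O(√X · X ^ l)` such points for each `z`, and by the
  circle law each of them is near to `O(X ^ (θ + δ))` points of the spectrum.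

So `ψ̂` is concentrated on a set without short differences, up to an `ℓ²` error `O(‖W‖₂ n ^ (-l / 2))`.
The autocorrelation of `ψ̂` at a short nonzero frequency `z`, which is the Fourier coefficient of
`|ψ|²` at `z`, is then bounded by this error (`norm_autocorrelation_le`), and the long frequencies are
negligible because the Fourier coefficients of a smooth `f` decay rapidly. This gives the
equidistribution of `|ψ|²` against `f` (`exists_equidistribution_bound`).

The exceptional `n` are power sparse: there are `O(X ^ (1 - σ))` of them up to `X`. The spectrum has
at least `X ^ (1 - δ)` points up to `X`, by Cauchy–Schwarz from the same count of pairs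
(`exists_le_ncard_laplaceSpectrum`), so power sparse sets have relative density zero. The exceptional
sets for the losses `ε = 1 / (j + 1)` are absorbed, up to finitely many points each, into a single
set of density zero (`exists_absorbing_density_zero`). Finitely many eigenvalues, and exponents
`-(1 - 3θ) / 2 + ε ≥ 0`, are covered by the trivial bound for a function of unit norm. Since
`r₁ + r₂` and `‖V‖₂` are bounded below by `η`, additive constants are absorbed into
`(r₁ + r₂)² ‖V‖₂`.
-/

open scoped ENNReal ComplexConjugate

/-! ### Divisors and lattice points in ellipses -/

/-- The divisor bound. The local factors `(e + 1) / p ^ (e δ)` are bounded by a constant for the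
finitely many `p < 2 ^ (1 / δ)`, and by `1` for the other primes. -/
theorem exists_card_divisors_le_rpow {δ : ℝ} (hδ : 0 < δ) :
    ∃ C : ℝ, 1 ≤ C ∧ ∀ n : ℕ, n ≠ 0 → (n.divisors.card : ℝ) ≤ C * (n : ℝ) ^ δ := by
  classical
  have hlog : 0 < Real.log 2 := Real.log_pos (by norm_num)
  set A : ℝ := 1 + 1 / (δ * Real.log 2) with hA
  have hA1 : 1 ≤ A := by
    have : 0 ≤ 1 / (δ * Real.log 2) := by positivity
    linarith
  set P : ℕ := ⌈(2 : ℝ) ^ (1 / δ)⌉₊ with hP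
  refine ⟨A ^ P, one_le_pow₀ hA1, fun n hn => ?_⟩
  have hloc : ∀ p ∈ n.primeFactors,
      ((n.factorization p + 1 : ℕ) : ℝ)
        ≤ (if p < P then A else 1) * (((p ^ n.factorization p : ℕ) : ℝ)) ^ δ := by
    intro p hp
    have hp2 : (2 : ℝ) ≤ p := by exact_mod_cast (Nat.prime_of_mem_primeFactors hp).two_le
    set e := n.factorization p
    have hpe : (((p ^ e : ℕ) : ℝ)) ^ δ = ((p : ℝ) ^ δ) ^ e := by
      push_cast
      rw [← Real.rpow_natCast, ← Real.rpow_natCast, ← Real.rpow_mul (by positivity),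
        ← Real.rpow_mul (by positivity), mul_comm]
    rw [hpe]
    split_ifs with h
    · have h1 : ((2 : ℝ) ^ δ) ^ e ≤ ((p : ℝ) ^ δ) ^ e := by gcongr
      have h2 : 1 + e * (δ * Real.log 2) ≤ ((2 : ℝ) ^ δ) ^ e := by
        rw [Real.rpow_def_of_pos (by norm_num), ← Real.exp_nat_mul]
        have := Real.add_one_le_exp (e * (Real.log 2 * δ))
        nlinarith
      have h3 : ((e + 1 : ℕ) : ℝ) ≤ A * (1 + e * (δ * Real.log 2)) := by
        have h0 : 0 < δ * Real.log 2 := by positivity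
        have : A * (1 + e * (δ * Real.log 2))
            = 1 + e * (δ * Real.log 2) + 1 / (δ * Real.log 2) + e := by
          rw [hA]; field_simp; ring
        rw [this]; push_cast
        have : 0 ≤ e * (δ * Real.log 2) + 1 / (δ * Real.log 2) := by positivity
        linarith
      calc ((e + 1 : ℕ) : ℝ) ≤ A * (1 + e * (δ * Real.log 2)) := h3
        _ ≤ A * ((p : ℝ) ^ δ) ^ e := by gcongr; exact h2.trans h1
    · have hPp : (2 : ℝ) ^ (1 / δ) ≤ p := (Nat.le_ceil _).trans (by exact_mod_cast not_lt.mp h)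
      have h2 : (2 : ℝ) ≤ (p : ℝ) ^ δ := by
        calc (2 : ℝ) = ((2 : ℝ) ^ (1 / δ)) ^ δ := by
              rw [← Real.rpow_mul (by norm_num), one_div_mul_cancel hδ.ne', Real.rpow_one]
          _ ≤ _ := by gcongr
      rw [one_mul]
      calc ((e + 1 : ℕ) : ℝ) ≤ ((2 ^ e : ℕ) : ℝ) := by exact_mod_cast Nat.lt_two_pow_self
        _ = (2 : ℝ) ^ e := by push_cast; rfl
        _ ≤ _ := by gcongr
  rw [Nat.card_divisors hn]
  calc ((∏ p ∈ n.primeFactors, (n.factorization p + 1) : ℕ) : ℝ)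
      = ∏ p ∈ n.primeFactors, ((n.factorization p + 1 : ℕ) : ℝ) := by push_cast; rfl
    _ ≤ ∏ p ∈ n.primeFactors,
        ((if p < P then A else 1) * (((p ^ n.factorization p : ℕ) : ℝ)) ^ δ) :=
        Finset.prod_le_prod (fun _ _ => by positivity) hloc
    _ = (∏ p ∈ n.primeFactors, if p < P then A else 1) * (n : ℝ) ^ δ := by
        rw [Finset.prod_mul_distrib]
        congr 1
        rw [Real.finsetProd_rpow _ _ (fun _ _ => by positivity), ← Nat.cast_prod]
        congr 2
        exact Nat.prod_factorization_pow_eq_self hn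
    _ ≤ A ^ P * (n : ℝ) ^ δ := by
        gcongr
        rw [Finset.prod_ite, Finset.prod_const, Finset.prod_const_one, mul_one]
        refine pow_le_pow_right₀ hA1 ?_
        calc _ ≤ (Finset.range P).card := Finset.card_le_card (by
              intro p hp; simpa using (Finset.mem_filter.mp hp).2)
          _ = P := Finset.card_range P

/-- A set fibred over a finite set, with fibres of at most `M` elements. -/
theorem ncard_le_ncard_mul_of_fibers {α β : Type*} {S : Set α} {A : Set β} (f : α → β)
    (hA : A.Finite) (hf : Set.MapsTo f S A) {M : ℝ}
    (hM : ∀ b ∈ A, {x ∈ S | f x = b}.Finite ∧ ({x ∈ S | f x = b}.ncard : ℝ) ≤ M) :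
    S.Finite ∧ (S.ncard : ℝ) ≤ A.ncard * M := by
  classical
  have hS : S.Finite := by
    refine (Set.Finite.biUnion hA fun b hb => (hM b hb).1).subset fun x hx => ?_
    simp only [Set.mem_iUnion]
    exact ⟨f x, hf hx, hx, rfl⟩
  refine ⟨hS, ?_⟩
  lift S to Finset α using hS
  lift A to Finset β using hA
  rw [Set.ncard_coe_finset, Set.ncard_coe_finset]
  rw [Finset.card_eq_sum_card_fiberwise (f := f) (t := A) hf]
  push_cast
  rw [← nsmul_eq_mul]
  refine Finset.sum_le_card_nsmul _ _ _ fun b hb => ?_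
  have := (hM b (by simpa using hb)).2
  have e : ((S.filter (f · = b) : Finset α) : Set α) = {x ∈ (S : Set α) | f x = b} := by
    ext; simp
  rw [← e, Set.ncard_coe_finset] at this
  exact this

theorem finite_ncard_int_abs_le {c : ℝ} (hc : c ≠ 0) (y : ℝ) {D : ℝ} (hD : 0 ≤ D) :
    {k : ℤ | |c * k + y| ≤ D}.Finite ∧
      ({k : ℤ | |c * k + y| ≤ D}.ncard : ℝ) ≤ 2 * D / |c| + 1 := by
  have hc' : 0 < |c| := abs_pos.mpr hc
  have hsub : {k : ℤ | |c * k + y| ≤ D} ⊆ Set.Icc ⌈-y / c - D / |c|⌉ ⌊-y / c + D / |c|⌋ := by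
    intro k hk
    have h1 : |(k : ℝ) - (-y / c)| ≤ D / |c| := by
      rw [le_div_iff₀ hc', ← abs_mul]
      have : ((k : ℝ) - (-y / c)) * c = c * k + y := by field_simp; ring
      rw [this]; exact hk
    rw [abs_le] at h1
    exact ⟨Int.ceil_le.mpr (by linarith [h1.1]), Int.le_floor.mpr (by linarith [h1.2])⟩
  have hfin := Set.finite_Icc ⌈-y / c - D / |c|⌉ ⌊-y / c + D / |c|⌋
  refine ⟨hfin.subset hsub, ?_⟩
  have h0 : 0 ≤ D / |c| := by positivity
  have h2 : ((Set.Icc ⌈-y / c - D / |c|⌉ ⌊-y / c + D / |c|⌋).ncard : ℝ) ≤ 2 * D / |c| + 1 := by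
    rw [← Finset.coe_Icc, Set.ncard_coe_finset, Int.card_Icc]
    have h3 := Int.floor_le (-y / c + D / |c|)
    have h4 := Int.le_ceil (-y / c - D / |c|)
    have h5 : 2 * D / |c| = D / |c| + D / |c| := by ring
    have h6 : ((⌊-y / c + D / |c|⌋ + 1 - ⌈-y / c - D / |c|⌉ : ℤ) : ℝ) ≤ 2 * D / |c| + 1 := by
      push_cast; linarith
    have h7 : (((⌊-y / c + D / |c|⌋ + 1 - ⌈-y / c - D / |c|⌉).toNat : ℤ) : ℝ)
        = max ((⌊-y / c + D / |c|⌋ + 1 - ⌈-y / c - D / |c|⌉ : ℤ) : ℝ) 0 := by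
      rw [Int.toNat_eq_max]; push_cast; rfl
    rw [show (((⌊-y / c + D / |c|⌋ + 1 - ⌈-y / c - D / |c|⌉).toNat : ℕ) : ℝ)
      = (((⌊-y / c + D / |c|⌋ + 1 - ⌈-y / c - D / |c|⌉).toNat : ℤ) : ℝ) by norm_cast, h7]
    exact max_le h6 (by linarith)
  refine le_trans ?_ h2
  exact_mod_cast Set.ncard_le_ncard hsub hfin

/-- The quadratic form `|ξ|²` of the dual lattice in the coordinates `m ∈ ℤ²` of `ξ`. -/
noncomputable def quadForm (a : ℝ) (m : ℤ × ℤ) : ℝ := (m.1 : ℝ) ^ 2 / a ^ 2 + a ^ 2 * (m.2 : ℝ) ^ 2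

theorem norm_freq_sq (a : ℝ) (m : ℤ × ℤ) : ‖freq a m‖ ^ 2 = quadForm a m := by
  rw [EuclideanSpace.norm_sq_eq]
  simp [freq, quadForm, Fin.sum_univ_two, div_pow, mul_pow]

theorem quadForm_nonneg (a : ℝ) (m : ℤ × ℤ) : 0 ≤ quadForm a m := by
  unfold quadForm; positivity

theorem finite_ncard_abs_le {M : ℝ} (hM : 0 ≤ M) :
    {k : ℤ | |(k : ℝ)| ≤ M}.Finite ∧ ({k : ℤ | |(k : ℝ)| ≤ M}.ncard : ℝ) ≤ 2 * M + 1 := by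
  simpa using finite_ncard_int_abs_le one_ne_zero 0 hM

theorem finite_ncard_box_le {M₁ M₂ : ℝ} (h₁ : 0 ≤ M₁) (h₂ : 0 ≤ M₂) :
    {m : ℤ × ℤ | |(m.1 : ℝ)| ≤ M₁ ∧ |(m.2 : ℝ)| ≤ M₂}.Finite ∧
      ({m : ℤ × ℤ | |(m.1 : ℝ)| ≤ M₁ ∧ |(m.2 : ℝ)| ≤ M₂}.ncard : ℝ)
        ≤ (2 * M₁ + 1) * (2 * M₂ + 1) := by
  have e : {m : ℤ × ℤ | |(m.1 : ℝ)| ≤ M₁ ∧ |(m.2 : ℝ)| ≤ M₂}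
      = {k : ℤ | |(k : ℝ)| ≤ M₁} ×ˢ {k : ℤ | |(k : ℝ)| ≤ M₂} := by ext; simp
  obtain ⟨f1, c1⟩ := finite_ncard_abs_le h₁
  obtain ⟨f2, c2⟩ := finite_ncard_abs_le h₂
  rw [e]
  refine ⟨f1.prod f2, ?_⟩
  rw [Set.ncard_prod]
  push_cast
  gcongr

theorem abs_fst_le_of_quadForm_le {a T : ℝ} (ha : 0 < a) {m : ℤ × ℤ} (h : quadForm a m ≤ T) :
    |(m.1 : ℝ)| ≤ a * √T := by
  have : (m.1 : ℝ) ^ 2 ≤ a ^ 2 * T := by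
    have h1 : (m.1 : ℝ) ^ 2 / a ^ 2 ≤ T := by
      unfold quadForm at h
      have : 0 ≤ a ^ 2 * (m.2 : ℝ) ^ 2 := by positivity
      linarith
    rwa [div_le_iff₀ (by positivity), mul_comm] at h1
  have := Real.abs_le_sqrt this
  rwa [Real.sqrt_mul (by positivity), Real.sqrt_sq ha.le] at this

theorem abs_snd_le_of_quadForm_le {a T : ℝ} (ha : 0 < a) {m : ℤ × ℤ} (h : quadForm a m ≤ T) :
    |(m.2 : ℝ)| ≤ a⁻¹ * √T := by
  have : (m.2 : ℝ) ^ 2 ≤ (a⁻¹) ^ 2 * T := by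
    have h1 : a ^ 2 * (m.2 : ℝ) ^ 2 ≤ T := by
      unfold quadForm at h
      have : 0 ≤ (m.1 : ℝ) ^ 2 / a ^ 2 := by positivity
      linarith
    rw [inv_pow, inv_mul_eq_div, le_div_iff₀ (by positivity), mul_comm]; exact h1
  have := Real.abs_le_sqrt this
  rwa [Real.sqrt_mul (by positivity), Real.sqrt_sq (by positivity)] at this

theorem finite_quadForm_le {a : ℝ} (ha : 0 < a) (T : ℝ) : {m : ℤ × ℤ | quadForm a m ≤ T}.Finite := by
  refine ((finite_ncard_box_le (M₁ := a * √T) (M₂ := a⁻¹ * √T) (by positivity)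
    (by positivity)).1).subset fun m hm => ?_
  exact ⟨abs_fst_le_of_quadForm_le ha hm, abs_snd_le_of_quadForm_le ha hm⟩

theorem exists_ncard_quadForm_le {a : ℝ} (ha : 0 < a) :
    ∃ C : ℝ, 1 ≤ C ∧ ∀ T : ℝ, 1 ≤ T → ({m : ℤ × ℤ | quadForm a m ≤ T}.ncard : ℝ) ≤ C * T := by
  refine ⟨(2 * a + 1) * (2 * a⁻¹ + 1), ?_, fun T hT => ?_⟩
  · have : 0 < a⁻¹ := by positivity
    nlinarith [mul_pos ha this]
  have hb := finite_ncard_box_le (M₁ := a * √T) (M₂ := a⁻¹ * √T) (by positivity) (by positivity)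
  have hs : 1 ≤ √T := Real.one_le_sqrt.mpr hT
  calc ({m : ℤ × ℤ | quadForm a m ≤ T}.ncard : ℝ) ≤ ({m : ℤ × ℤ | |(m.1 : ℝ)| ≤ a * √T ∧ |(m.2 : ℝ)| ≤ a⁻¹ * √T}.ncard : ℝ) := by
        have hsub : {m : ℤ × ℤ | quadForm a m ≤ T}
            ⊆ {m : ℤ × ℤ | |(m.1 : ℝ)| ≤ a * √T ∧ |(m.2 : ℝ)| ≤ a⁻¹ * √T} := fun m hm =>
          ⟨abs_fst_le_of_quadForm_le ha hm, abs_snd_le_of_quadForm_le ha hm⟩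
        exact_mod_cast Set.ncard_le_ncard hsub hb.1
    _ ≤ _ := hb.2
    _ ≤ ((2 * a + 1) * √T) * ((2 * a⁻¹ + 1) * √T) := by gcongr <;> nlinarith
    _ = (2 * a + 1) * (2 * a⁻¹ + 1) * (√T * √T) := by ring
    _ = _ := by rw [Real.mul_self_sqrt (by linarith)]

/-- The ellipse `|ξ|² ≤ T` contains the box `|m₁| ≤ a √(T / 2)`, `|m₂| ≤ a⁻¹ √(T / 2)`. -/
theorem half_le_ncard_quadForm_le {a : ℝ} (ha : 0 < a) {T : ℝ} (hT : 0 ≤ T) :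
    T / 2 ≤ ({m : ℤ × ℤ | quadForm a m ≤ T}.ncard : ℝ) := by
  have key : ∀ x : ℝ, 0 ≤ x → x ≤ ((Set.Icc (-⌊x⌋) ⌊x⌋).ncard : ℝ) := by
    intro x hx
    rw [← Finset.coe_Icc, Set.ncard_coe_finset, Int.card_Icc]
    have h1 := Int.lt_floor_add_one x
    have h0 : 0 ≤ ⌊x⌋ := Int.floor_nonneg.mpr hx
    have h2 : ((⌊x⌋ + 1 - -⌊x⌋).toNat : ℤ) = ⌊x⌋ + 1 - -⌊x⌋ := Int.toNat_of_nonneg (by omega)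
    have h3 : (((⌊x⌋ + 1 - -⌊x⌋).toNat : ℕ) : ℝ) = ⌊x⌋ + 1 - -⌊x⌋ := by exact_mod_cast h2
    have h4 : (0 : ℝ) ≤ ⌊x⌋ := by exact_mod_cast h0
    rw [h3]; linarith
  set s := √(T / 2)
  have hs : 0 ≤ s := Real.sqrt_nonneg _
  have hss : s ^ 2 = T / 2 := Real.sq_sqrt (by linarith)
  have hmem : ∀ x : ℝ, ∀ k : ℤ, k ∈ Set.Icc (-⌊x⌋) ⌊x⌋ → (k : ℝ) ^ 2 ≤ x ^ 2 := by
    intro x k hk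
    have h1 : (k : ℝ) ≤ x := Int.le_floor.mp hk.2
    have h2 : -x ≤ (k : ℝ) := by
      have : ((-k : ℤ) : ℝ) ≤ x := Int.le_floor.mp (by have := hk.1; omega)
      push_cast at this; linarith
    exact sq_le_sq' h2 h1
  have hsub : Set.Icc (-⌊a * s⌋) ⌊a * s⌋ ×ˢ Set.Icc (-⌊a⁻¹ * s⌋) ⌊a⁻¹ * s⌋
      ⊆ {m : ℤ × ℤ | quadForm a m ≤ T} := by
    rintro ⟨k, l⟩ ⟨hk, hl⟩
    have h1 := hmem _ _ hk
    have h2 := hmem _ _ hl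
    simp only [Set.mem_ofPred_eq, quadForm]
    have h3 : (k : ℝ) ^ 2 / a ^ 2 ≤ s ^ 2 := by
      rw [div_le_iff₀ (by positivity)]
      simp only at h1; nlinarith
    have h4 : a ^ 2 * (l : ℝ) ^ 2 ≤ s ^ 2 := by
      calc a ^ 2 * (l : ℝ) ^ 2 ≤ a ^ 2 * (a⁻¹ * s) ^ 2 := by gcongr
        _ = s ^ 2 := by field_simp
    linarith
  calc T / 2 = (a * s) * (a⁻¹ * s) := by rw [← hss]; field_simp
    _ ≤ _ * _ := mul_le_mul (key _ (by positivity)) (key _ (by positivity)) (by positivity)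
        (by positivity)
    _ = ((Set.Icc (-⌊a * s⌋) ⌊a * s⌋ ×ˢ Set.Icc (-⌊a⁻¹ * s⌋) ⌊a⁻¹ * s⌋).ncard : ℝ) := by
        rw [Set.ncard_prod]; push_cast; rfl
    _ ≤ _ := by exact_mod_cast Set.ncard_le_ncard hsub (finite_quadForm_le ha T)

/-! ### Pairs of lattice points with nearby norms -/

theorem exists_ncard_mul_eq_le {δ : ℝ} (hδ : 0 < δ) :
    ∃ C : ℝ, 1 ≤ C ∧ ∀ k : ℤ, k ≠ 0 → {p : ℤ × ℤ | p.1 * p.2 = k}.Finite ∧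
      ({p : ℤ × ℤ | p.1 * p.2 = k}.ncard : ℝ) ≤ C * |(k : ℝ)| ^ δ := by
  obtain ⟨C, hC1, hC⟩ := exists_card_divisors_le_rpow hδ
  refine ⟨2 * C, by linarith, fun k hk => ?_⟩
  have h := ncard_le_ncard_mul_of_fibers (S := {p : ℤ × ℤ | p.1 * p.2 = k})
    (A := (k.natAbs.divisors : Set ℕ)) (fun p => p.1.natAbs) (Finset.finite_toSet _)
    (M := 2) (by
      intro p hp
      simp only [Finset.mem_coe, Nat.mem_divisors]
      refine ⟨Int.natAbs_dvd_natAbs.mpr ⟨p.2, ?_⟩, Int.natAbs_ne_zero.mpr hk⟩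
      exact (show p.1 * p.2 = k from hp).symm) (by
      intro d _
      have hsub : {x ∈ {p : ℤ × ℤ | p.1 * p.2 = k} | x.1.natAbs = d}
          ⊆ {((d : ℤ), k / d), (-(d : ℤ), k / -(d : ℤ))} := by
        rintro ⟨s, t⟩ ⟨hst, hd⟩
        simp only at hd
        have hst' : s * t = k := hst
        have hs : s ≠ 0 := by rintro rfl; simp at hst'; exact hk hst'.symm
        have ht : t = k / s := by rw [← hst', Int.mul_ediv_cancel_left _ hs]
        rcases Int.natAbs_eq s with h | h
        · left; rw [hd] at h; rw [← h, ← ht]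
        · right; rw [hd] at h; rw [Set.mem_singleton_iff, ← h, ← ht]
      have hfin : ({((d : ℤ), k / d), (-(d : ℤ), k / -(d : ℤ))} : Set (ℤ × ℤ)).Finite :=
        Set.toFinite _
      refine ⟨hfin.subset hsub, ?_⟩
      have h2 := Set.ncard_insert_le ((d : ℤ), k / d) {(-(d : ℤ), k / -(d : ℤ))}
      rw [Set.ncard_singleton] at h2
      exact_mod_cast (Set.ncard_le_ncard hsub hfin).trans h2)
  refine ⟨h.1, h.2.trans ?_⟩
  have := hC k.natAbs (Int.natAbs_ne_zero.mpr hk)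
  rw [Set.ncard_coe_finset]
  rw [Nat.cast_natAbs, Int.cast_abs] at this
  linarith

/-- The number of solutions `(u, v), (s, t)` of `|u v / a² + a² s t| ≤ D` in a box. Given `u, v` there
are `O(D)` possible values of `s t`, and by the divisor bound few factorizations of each value,
unless it is zero. The difference of two values of the quadratic form is of this shape. -/
theorem exists_ncard_near_products_le {a : ℝ} (ha : 0 < a) {δ : ℝ} (hδ : 0 < δ) :
    ∃ C : ℝ, 0 ≤ C ∧ ∀ M D : ℝ, 1 ≤ M → 1 ≤ D →
      {p : (ℤ × ℤ) × (ℤ × ℤ) | (|(p.1.1 : ℝ)| ≤ M ∧ |(p.1.2 : ℝ)| ≤ M) ∧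
        (|(p.2.1 : ℝ)| ≤ M ∧ |(p.2.2 : ℝ)| ≤ M) ∧
        |(p.1.1 * p.1.2 : ℝ) / a ^ 2 + a ^ 2 * (p.2.1 * p.2.2 : ℝ)| ≤ D}.Finite ∧
      ({p : (ℤ × ℤ) × (ℤ × ℤ) | (|(p.1.1 : ℝ)| ≤ M ∧ |(p.1.2 : ℝ)| ≤ M) ∧
        (|(p.2.1 : ℝ)| ≤ M ∧ |(p.2.2 : ℝ)| ≤ M) ∧
        |(p.1.1 * p.1.2 : ℝ) / a ^ 2 + a ^ 2 * (p.2.1 * p.2.2 : ℝ)| ≤ D}.ncard : ℝ)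
        ≤ C * M ^ (2 + 2 * δ) * D := by
  obtain ⟨C₀, hC1, hC⟩ := exists_ncard_mul_eq_le hδ
  set c₁ : ℝ := 2 / a ^ 2 + 1
  set c₂ : ℝ := 2 * a ^ 2 + 1
  have hc1 : 0 ≤ c₁ := by positivity
  have hc2 : 0 ≤ c₂ := by positivity
  refine ⟨9 * c₁ * C₀ + 6 * c₂ * C₀ + 36, by positivity, fun M D hM hD => ?_⟩
  have hM0 : 0 ≤ M := by linarith
  set S := {p : (ℤ × ℤ) × (ℤ × ℤ) | (|(p.1.1 : ℝ)| ≤ M ∧ |(p.1.2 : ℝ)| ≤ M) ∧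
        (|(p.2.1 : ℝ)| ≤ M ∧ |(p.2.2 : ℝ)| ≤ M) ∧
        |(p.1.1 * p.1.2 : ℝ) / a ^ 2 + a ^ 2 * (p.2.1 * p.2.2 : ℝ)| ≤ D} with hS
  obtain ⟨boxfin, boxcard⟩ := finite_ncard_box_le hM0 hM0
  set box := {m : ℤ × ℤ | |(m.1 : ℝ)| ≤ M ∧ |(m.2 : ℝ)| ≤ M} with hbox
  have hSfin : S.Finite := (boxfin.prod boxfin).subset fun p hp => ⟨hp.1, hp.2.1⟩
  refine ⟨hSfin, ?_⟩
  have hbox9 : (box.ncard : ℝ) ≤ 9 * M ^ 2 := boxcard.trans (by nlinarith)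
  -- products of two numbers of the box, in absolute value at most `M ^ 2`
  have habs : ∀ m ∈ box, |((m.1 * m.2 : ℤ) : ℝ)| ≤ M ^ 2 := by
    intro m hm
    push_cast
    rw [abs_mul, sq]
    exact mul_le_mul hm.1 hm.2 (abs_nonneg _) hM0
  have hfib : ∀ k : ℤ, k ≠ 0 → |(k : ℝ)| ≤ M ^ 2 →
      ({p : ℤ × ℤ | p.1 * p.2 = k}.ncard : ℝ) ≤ C₀ * M ^ (2 * δ) := by
    intro k hk hkM
    refine (hC k hk).2.trans ?_
    have : M ^ (2 * δ) = (M ^ 2) ^ δ := by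
      rw [← Real.rpow_natCast M 2, ← Real.rpow_mul hM0]; norm_num
    rw [this]
    gcongr
  have hMδ : 1 ≤ M ^ (2 * δ) := Real.one_le_rpow hM (by positivity)
  have hMsplit : M ^ (2 + 2 * δ) = M ^ 2 * M ^ (2 * δ) := by
    rw [Real.rpow_add (by linarith)]; norm_num
  -- the pairs of the box with product zero
  have hzfin : {m ∈ box | m.1 * m.2 = 0}.Finite := boxfin.subset (fun _ h => h.1)
  have hzero : ({m ∈ box | m.1 * m.2 = 0}.ncard : ℝ) ≤ 6 * M := by
    obtain ⟨f1, n1⟩ := finite_ncard_abs_le hM0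
    have hsub : {m ∈ box | m.1 * m.2 = 0} ⊆
        (fun k : ℤ => ((0 : ℤ), k)) '' {k : ℤ | |(k : ℝ)| ≤ M} ∪
        (fun k : ℤ => (k, (0 : ℤ))) '' {k : ℤ | |(k : ℝ)| ≤ M} := by
      rintro ⟨s, t⟩ ⟨hb, h0⟩
      rcases mul_eq_zero.mp h0 with h | h
      · left; exact ⟨t, hb.2, by simp only at h; rw [h]⟩
      · right; exact ⟨s, hb.1, by simp only at h; rw [h]⟩
    have h1 := Set.ncard_le_ncard hsub ((f1.image _).union (f1.image _))
    have h2 := h1.trans (Set.ncard_union_le _ _)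
    have h3 := Set.ncard_image_le (f := fun k : ℤ => ((0 : ℤ), k)) f1
    have h4 := Set.ncard_image_le (f := fun k : ℤ => (k, (0 : ℤ))) f1
    have h5 : ({m ∈ box | m.1 * m.2 = 0}.ncard : ℝ) ≤
      ({k : ℤ | |(k : ℝ)| ≤ M}.ncard : ℝ) + ({k : ℤ | |(k : ℝ)| ≤ M}.ncard : ℝ) := by
      exact_mod_cast h2.trans (add_le_add h3 h4)
    linarith
  -- the part with `s t ≠ 0`: map to `(u, v)` and the value of `s t`
  have part1 : ({p ∈ S | p.2.1 * p.2.2 ≠ 0}.ncard : ℝ)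
      ≤ 9 * M ^ 2 * (c₁ * D) * (C₀ * M ^ (2 * δ)) := by
    set A := {b : (ℤ × ℤ) × ℤ | b.1 ∈ box ∧ b.2 ≠ 0 ∧ |(b.2 : ℝ)| ≤ M ^ 2 ∧
      |(b.1.1 * b.1.2 : ℝ) / a ^ 2 + a ^ 2 * (b.2 : ℝ)| ≤ D} with hA
    have hAc := ncard_le_ncard_mul_of_fibers (S := A) (A := box) Prod.fst boxfin (M := c₁ * D)
      (fun b hb => hb.1) (by
        intro m _
        obtain ⟨f, n⟩ := finite_ncard_int_abs_le (c := a ^ 2) (by positivity)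
          ((m.1 * m.2 : ℝ) / a ^ 2) (D := D) (by linarith)
        have hsub : {x ∈ A | x.1 = m} ⊆ (fun k : ℤ => (m, k)) ''
            {k : ℤ | |a ^ 2 * k + (m.1 * m.2 : ℝ) / a ^ 2| ≤ D} := by
          rintro ⟨b, k⟩ ⟨hb, rfl⟩
          refine ⟨k, ?_, rfl⟩
          have := hb.2.2.2
          simp only [Set.mem_ofPred_eq]
          rwa [add_comm]
        refine ⟨(f.image _).subset hsub, ?_⟩
        have h1 := (Set.ncard_le_ncard hsub (f.image _)).trans (Set.ncard_image_le f)
        have h2 : (({x ∈ A | x.1 = m}.ncard : ℕ) : ℝ) ≤ _ := (Nat.cast_le.mpr h1).trans n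
        refine h2.trans ?_
        rw [abs_of_pos (by positivity)]
        calc 2 * D / a ^ 2 + 1 ≤ 2 * D / a ^ 2 + D := by linarith
          _ = c₁ * D := by simp only [c₁]; ring)
    have := ncard_le_ncard_mul_of_fibers (S := {p ∈ S | p.2.1 * p.2.2 ≠ 0}) (A := A)
      (fun p => (p.1, p.2.1 * p.2.2)) hAc.1 (M := C₀ * M ^ (2 * δ))
      (fun p hp => ⟨hp.1.1, hp.2, habs _ hp.1.2.1, by
        have := hp.1.2.2; push_cast; exact this⟩) (by
        rintro ⟨m, k⟩ hmk
        have hsub : {x ∈ {p ∈ S | p.2.1 * p.2.2 ≠ 0} | (x.1, x.2.1 * x.2.2) = (m, k)}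
            ⊆ (fun q : ℤ × ℤ => (m, q)) '' {q : ℤ × ℤ | q.1 * q.2 = k} := by
          rintro ⟨b, q⟩ ⟨_, hb⟩
          simp only [Prod.mk.injEq] at hb
          exact ⟨q, hb.2, by rw [hb.1]⟩
        have f := (hC k hmk.2.1).1
        refine ⟨(f.image _).subset hsub, ?_⟩
        have h1 := (Set.ncard_le_ncard hsub (f.image _)).trans (Set.ncard_image_le f)
        exact (Nat.cast_le.mpr h1).trans (hfib k hmk.2.1 hmk.2.2.1))
    calc _ ≤ _ := this.2
      _ ≤ (9 * M ^ 2 * (c₁ * D)) * (C₀ * M ^ (2 * δ)) := by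
        gcongr
        exact hAc.2.trans (by gcongr)
  -- the part with `s t = 0` and `u v ≠ 0`: map to the value of `u v`, which is `O(D)`, and `(s, t)`
  have part2 : ({p ∈ S | p.2.1 * p.2.2 = 0 ∧ p.1.1 * p.1.2 ≠ 0}.ncard : ℝ)
      ≤ c₂ * D * (6 * M) * (C₀ * M ^ (2 * δ)) := by
    obtain ⟨f0, n0⟩ := finite_ncard_int_abs_le (c := (1 / a ^ 2 : ℝ)) (by positivity)
          0 (D := D) (by linarith)
    set A := {k : ℤ | |(1 / a ^ 2 : ℝ) * k + 0| ≤ D} ×ˢ {m ∈ box | m.1 * m.2 = 0} with hA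
    set A' := {b ∈ A | b.1 ≠ 0 ∧ |(b.1 : ℝ)| ≤ M ^ 2} with hA'
    have hAf : A.Finite := f0.prod hzfin
    have hAf' : A'.Finite := hAf.subset fun _ h => h.1
    have hAc : (A'.ncard : ℝ) ≤ (c₂ * D) * (6 * M) := by
      have : (A'.ncard : ℝ) ≤ A.ncard := by
        have hsub : A' ⊆ A := fun _ h => h.1
        exact_mod_cast Set.ncard_le_ncard hsub hAf
      refine this.trans ?_
      rw [hA, Set.ncard_prod]
      push_cast
      refine mul_le_mul (n0.trans ?_) hzero (by positivity) (by positivity)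
      rw [abs_of_pos (by positivity)]
      calc 2 * D / (1 / a ^ 2) + 1 ≤ 2 * D / (1 / a ^ 2) + D := by linarith
          _ = c₂ * D := by simp only [c₂]; field_simp
    have := ncard_le_ncard_mul_of_fibers (S := {p ∈ S | p.2.1 * p.2.2 = 0 ∧ p.1.1 * p.1.2 ≠ 0})
      (A := A') (fun p => (p.1.1 * p.1.2, p.2)) hAf' (M := C₀ * M ^ (2 * δ))
      (by
        rintro ⟨⟨u, v⟩, ⟨s, t⟩⟩ ⟨hp, h0, h1⟩
        refine ⟨⟨?_, hp.2.1, h0⟩, h1, habs _ hp.1⟩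
        have h2 := hp.2.2
        simp only at h0 h2
        have h0' : (s * t : ℝ) = 0 := by exact_mod_cast h0
        rw [h0'] at h2
        simp only [Set.mem_ofPred_eq]
        push_cast
        rw [mul_zero] at h2
        rwa [one_div_mul_eq_div]) (by
        rintro ⟨k, m⟩ hmk
        have hsub : {x ∈ {p ∈ S | p.2.1 * p.2.2 = 0 ∧ p.1.1 * p.1.2 ≠ 0} |
              (x.1.1 * x.1.2, x.2) = (k, m)}
            ⊆ (fun q : ℤ × ℤ => (q, m)) '' {q : ℤ × ℤ | q.1 * q.2 = k} := by
          rintro ⟨b, q⟩ ⟨_, hb⟩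
          simp only [Prod.mk.injEq] at hb
          exact ⟨b, hb.1, by rw [hb.2]⟩
        have f := (hC k hmk.2.1).1
        refine ⟨(f.image _).subset hsub, ?_⟩
        have h1 := (Set.ncard_le_ncard hsub (f.image _)).trans (Set.ncard_image_le f)
        exact (Nat.cast_le.mpr h1).trans (hfib k hmk.2.1 hmk.2.2))
    calc _ ≤ _ := this.2
      _ ≤ (c₂ * D * (6 * M)) * (C₀ * M ^ (2 * δ)) := by gcongr
  -- the part with both products zero
  have part3 : ({p ∈ S | p.2.1 * p.2.2 = 0 ∧ p.1.1 * p.1.2 = 0}.ncard : ℝ) ≤ (6 * M) * (6 * M) := by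
    have hsub : {p ∈ S | p.2.1 * p.2.2 = 0 ∧ p.1.1 * p.1.2 = 0} ⊆
        {m ∈ box | m.1 * m.2 = 0} ×ˢ {m ∈ box | m.1 * m.2 = 0} :=
      fun p hp => ⟨⟨hp.1.1, hp.2.2⟩, hp.1.2.1, hp.2.1⟩
    have h1 := Set.ncard_le_ncard hsub (hzfin.prod hzfin)
    rw [Set.ncard_prod] at h1
    refine (Nat.cast_le.mpr h1).trans ?_
    push_cast
    gcongr
  have hcover : S ⊆ {p ∈ S | p.2.1 * p.2.2 ≠ 0} ∪
      ({p ∈ S | p.2.1 * p.2.2 = 0 ∧ p.1.1 * p.1.2 ≠ 0} ∪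
        {p ∈ S | p.2.1 * p.2.2 = 0 ∧ p.1.1 * p.1.2 = 0}) := by
    intro p hp
    by_cases h1 : p.2.1 * p.2.2 = 0
    · by_cases h2 : p.1.1 * p.1.2 = 0
      · exact Or.inr (Or.inr ⟨hp, h1, h2⟩)
      · exact Or.inr (Or.inl ⟨hp, h1, h2⟩)
    · exact Or.inl ⟨hp, h1⟩
  have hc : S.ncard ≤ _ := (Set.ncard_le_ncard hcover ((hSfin.subset fun _ h => h.1).union
    ((hSfin.subset fun _ h => h.1).union (hSfin.subset fun _ h => h.1)))).trans
    ((Set.ncard_union_le _ _).trans (Nat.add_le_add_left (Set.ncard_union_le _ _) _))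
  have hc' := (Nat.cast_le (α := ℝ)).mpr hc
  push_cast at hc'
  rw [hMsplit]
  have hT : 0 ≤ M ^ (2 * δ) := by positivity
  have hMM : M ≤ M ^ 2 := by nlinarith
  calc (S.ncard : ℝ) ≤ 9 * M ^ 2 * (c₁ * D) * (C₀ * M ^ (2 * δ))
        + (c₂ * D * (6 * M) * (C₀ * M ^ (2 * δ)) + (6 * M) * (6 * M)) := by linarith
    _ ≤ 9 * M ^ 2 * (c₁ * D) * (C₀ * M ^ (2 * δ))
        + (c₂ * D * (6 * M ^ 2) * (C₀ * M ^ (2 * δ)) + 36 * (M ^ 2 * M ^ (2 * δ)) * D) := by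
        have h1 : 36 * (M ^ 2 * 1) * 1 ≤ 36 * (M ^ 2 * M ^ (2 * δ)) * D := by gcongr
        have h2 : c₂ * D * (6 * M) * (C₀ * M ^ (2 * δ))
          ≤ c₂ * D * (6 * M ^ 2) * (C₀ * M ^ (2 * δ)) := by gcongr
        linarith
    _ = _ := by ring

/-- Pairs of lattice points whose norms squared are at distance at most `D` are, up to `X ^ δ`, as
few as if the norms were equidistributed. -/
theorem exists_ncard_near_pairs_le {a : ℝ} (ha : 0 < a) {δ : ℝ} (hδ : 0 < δ) :
    ∃ C : ℝ, 0 ≤ C ∧ ∀ X D : ℝ, 1 ≤ X → 1 ≤ D →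
      {p : (ℤ × ℤ) × (ℤ × ℤ) | quadForm a p.1 ≤ X ∧
        |quadForm a p.2 - quadForm a p.1| ≤ D}.Finite ∧
      ({p : (ℤ × ℤ) × (ℤ × ℤ) | quadForm a p.1 ≤ X ∧
        |quadForm a p.2 - quadForm a p.1| ≤ D}.ncard : ℝ) ≤ C * X ^ (1 + δ) * D := by
  obtain ⟨C₁, hC1, hC⟩ := exists_ncard_near_products_le ha hδ
  obtain ⟨C₂, hC2, hL⟩ := exists_ncard_quadForm_le ha
  set b : ℝ := 1 + 4 * (a + a⁻¹) with hb
  have hb1 : 1 ≤ b := by have : 0 < a + a⁻¹ := by positivity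
                         linarith
  refine ⟨C₁ * b ^ (2 + 2 * δ) + C₂ * (2 * C₂), by positivity, fun X D hX hD => ?_⟩
  set S := {p : (ℤ × ℤ) × (ℤ × ℤ) | quadForm a p.1 ≤ X ∧
        |quadForm a p.2 - quadForm a p.1| ≤ D} with hS
  have hXD : S ⊆ {m : ℤ × ℤ | quadForm a m ≤ X} ×ˢ {m : ℤ × ℤ | quadForm a m ≤ X + D} := by
    rintro ⟨m, k⟩ ⟨h1, h2⟩
    refine ⟨h1, ?_⟩
    have := (abs_le.mp h2).2
    simp only [Set.mem_ofPred_eq] at h1 ⊢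
    linarith
  have hfin2 := (finite_quadForm_le ha X).prod (finite_quadForm_le ha (X + D))
  refine ⟨hfin2.subset hXD, ?_⟩
  have hXδ : X ≤ X ^ (1 + δ) := by
    nth_rw 1 [← Real.rpow_one X]
    exact Real.rpow_le_rpow_of_exponent_le hX (by linarith)
  rcases le_total D X with hDX | hDX
  · set M := b * √X with hM
    have hs1 : 1 ≤ √X := Real.one_le_sqrt.mpr hX
    have hM1 : 1 ≤ M := by nlinarith
    obtain ⟨pf, pn⟩ := hC M D hM1 hD
    set Q := {p : (ℤ × ℤ) × (ℤ × ℤ) | (|(p.1.1 : ℝ)| ≤ M ∧ |(p.1.2 : ℝ)| ≤ M) ∧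
        (|(p.2.1 : ℝ)| ≤ M ∧ |(p.2.2 : ℝ)| ≤ M) ∧
        |(p.1.1 * p.1.2 : ℝ) / a ^ 2 + a ^ 2 * (p.2.1 * p.2.2 : ℝ)| ≤ D} with hQ
    -- `k² - m² = (k - m) (k + m)` in each coordinate
    have hcard : S.ncard ≤ Q.ncard := by
      refine Set.ncard_le_ncard_of_injOn (fun p => ((p.2.1 - p.1.1, p.2.1 + p.1.1),
        (p.2.2 - p.1.2, p.2.2 + p.1.2))) ?_ ?_ pf
      · rintro ⟨m, k⟩ ⟨h1, h2⟩
        have hk : quadForm a k ≤ 4 * X := by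
          have := (abs_le.mp h2).2
          simp only at h1 this
          linarith
        have hm : quadForm a m ≤ 4 * X := by simp only at h1; linarith
        have hsq : √(4 * X) = 2 * √X := by
          rw [Real.sqrt_mul (by norm_num), show (4 : ℝ) = 2 ^ 2 by norm_num,
            Real.sqrt_sq (by norm_num)]
        have e1 := abs_fst_le_of_quadForm_le ha hk
        have e2 := abs_fst_le_of_quadForm_le ha hm
        have e3 := abs_snd_le_of_quadForm_le ha hk
        have e4 := abs_snd_le_of_quadForm_le ha hm
        rw [hsq] at e1 e2 e3 e4
        have ha' : 0 < a⁻¹ := by positivity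
        have g1 : a * (2 * √X) + a * (2 * √X) ≤ M := by
          rw [hM, hb]; nlinarith [mul_pos ha' (by linarith : 0 < √X)]
        have g2 : a⁻¹ * (2 * √X) + a⁻¹ * (2 * √X) ≤ M := by
          rw [hM, hb]; nlinarith [mul_pos ha (by linarith : 0 < √X)]
        refine ⟨⟨?_, ?_⟩, ⟨?_, ?_⟩, ?_⟩
        · push_cast; exact (abs_sub _ _).trans (by linarith)
        · push_cast; exact (abs_add_le _ _).trans (by linarith)
        · push_cast; exact (abs_sub _ _).trans (by linarith)
        · push_cast; exact (abs_add_le _ _).trans (by linarith)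
        · push_cast
          convert h2 using 2
          simp only [quadForm]; ring
      -- difference and sum of two integers determine them
      · rintro ⟨⟨m1, m2⟩, ⟨k1, k2⟩⟩ _ ⟨⟨m1', m2'⟩, ⟨k1', k2'⟩⟩ _ h
        simp only [Prod.mk.injEq] at h ⊢
        omega
    have hpow : M ^ (2 + 2 * δ) = b ^ (2 + 2 * δ) * X ^ (1 + δ) := by
      rw [hM, Real.mul_rpow (by linarith) (by positivity), Real.sqrt_eq_rpow,
        ← Real.rpow_mul (by linarith)]
      congr 2; ring
    calc (S.ncard : ℝ) ≤ Q.ncard := by exact_mod_cast hcard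
      _ ≤ C₁ * M ^ (2 + 2 * δ) * D := pn
      _ = (C₁ * b ^ (2 + 2 * δ)) * X ^ (1 + δ) * D := by rw [hpow]; ring
      _ ≤ _ := by
        gcongr
        have : 0 ≤ C₂ * (2 * C₂) := by positivity
        linarith
  -- for `D ≥ X` there are only `O(X D)` pairs at all
  · have h1 := Set.ncard_le_ncard hXD hfin2
    rw [Set.ncard_prod] at h1
    calc (S.ncard : ℝ) ≤ ({m : ℤ × ℤ | quadForm a m ≤ X}.ncard : ℝ)
          * ({m : ℤ × ℤ | quadForm a m ≤ X + D}.ncard : ℝ) := by exact_mod_cast h1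
      _ ≤ (C₂ * X ^ (1 + δ)) * (C₂ * (2 * D)) := by
        gcongr
        · exact (hL X hX).trans (by gcongr)
        · exact (hL _ (by linarith)).trans (by gcongr; linarith)
      _ = C₂ * (2 * C₂) * X ^ (1 + δ) * D := by ring
      _ ≤ _ := by
        gcongr
        have : 0 ≤ C₁ * b ^ (2 + 2 * δ) := by positivity
        linarith

/-! ### The Laplace spectrum and sets of density zero -/

theorem mem_laplaceSpectrum {a n : ℝ} : n ∈ laplaceSpectrum a ↔ ∃ m, quadForm a m = n := by
  simp [laplaceSpectrum, norm_freq_sq]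

theorem laplaceSpectrum_inter_Iic (a X : ℝ) :
    laplaceSpectrum a ∩ Set.Iic X = quadForm a '' {m | quadForm a m ≤ X} := by
  ext n
  simp only [Set.mem_inter_iff, mem_laplaceSpectrum, Set.mem_Iic, Set.mem_image,
    Set.mem_ofPred_eq]
  constructor
  · rintro ⟨⟨m, rfl⟩, h⟩; exact ⟨m, h, rfl⟩
  · rintro ⟨m, h, rfl⟩; exact ⟨⟨m, rfl⟩, h⟩

theorem finite_laplaceSpectrum_inter_Iic {a : ℝ} (ha : 0 < a) (X : ℝ) :
    (laplaceSpectrum a ∩ Set.Iic X).Finite := by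
  rw [laplaceSpectrum_inter_Iic]; exact (finite_quadForm_le ha X).image _

theorem exists_ncard_laplaceSpectrum_le {a : ℝ} (ha : 0 < a) :
    ∃ C : ℝ, 1 ≤ C ∧ ∀ X : ℝ, 1 ≤ X → ((laplaceSpectrum a ∩ Set.Iic X).ncard : ℝ) ≤ C * X := by
  obtain ⟨C, h1, hC⟩ := exists_ncard_quadForm_le ha
  refine ⟨C, h1, fun X hX => le_trans ?_ (hC X hX)⟩
  rw [laplaceSpectrum_inter_Iic]
  exact_mod_cast Set.ncard_image_le (finite_quadForm_le ha X)

/-- The Laplace spectrum has almost linearly many points, since by Cauchy–Schwarz few coincidences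
`|ξ| = |ξ'|` force many values. -/
theorem exists_le_ncard_laplaceSpectrum {a : ℝ} (ha : 0 < a) {δ : ℝ} (hδ : 0 < δ) :
    ∃ c : ℝ, 0 < c ∧ ∀ X : ℝ, 1 ≤ X →
      c * X ^ (1 - δ) ≤ ((laplaceSpectrum a ∩ Set.Iic X).ncard : ℝ) := by
  classical
  obtain ⟨C, hC0, hC⟩ := exists_ncard_near_pairs_le ha hδ
  refine ⟨1 / (4 * (C + 1)), by positivity, fun X hX => ?_⟩
  obtain ⟨pf, pn⟩ := hC X 1 hX le_rfl
  set F := (finite_quadForm_le ha X).toFinset with hF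
  have hF' : (X / 2 : ℝ) ≤ F.card := by
    rw [← Set.ncard_eq_toFinset_card _ (finite_quadForm_le ha X)]
    exact half_le_ncard_quadForm_le ha (by linarith)
  set Q := F.image (quadForm a) with hQ
  have hQ' : (laplaceSpectrum a ∩ Set.Iic X).ncard = Q.card := by
    rw [laplaceSpectrum_inter_Iic, ← Set.ncard_coe_finset, hQ, Finset.coe_image]
    congr 2
    simp [hF]
  -- the pairs of lattice points on a common circle, `∑ r(n) ^ 2` in number
  set P := (F ×ˢ F).filter (fun p => quadForm a p.1 = quadForm a p.2) with hP
  have hPc : (P.card : ℝ) ≤ C * X ^ (1 + δ) := by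
    refine le_trans ?_ (pn.trans (le_of_eq (mul_one _)))
    rw [← Set.ncard_coe_finset]
    have hsub : (P : Set ((ℤ × ℤ) × (ℤ × ℤ))) ⊆
      {p : (ℤ × ℤ) × (ℤ × ℤ) | quadForm a p.1 ≤ X ∧ |quadForm a p.2 - quadForm a p.1| ≤ 1} := by
      intro p hp
      simp only [hP, hF, Finset.coe_filter, Finset.mem_product, Set.Finite.mem_toFinset,
        Set.mem_ofPred_eq] at hp
      refine ⟨hp.1.1, ?_⟩
      rw [hp.2]; simp
    exact_mod_cast Set.ncard_le_ncard hsub pf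
  have h1 : F.card = ∑ n ∈ Q, (F.filter (fun m => quadForm a m = n)).card :=
    Finset.card_eq_sum_card_fiberwise (fun m hm => Finset.mem_coe.mpr (Finset.mem_image_of_mem _ hm))
  have h2 : P.card = ∑ n ∈ Q, (F.filter (fun m => quadForm a m = n)).card ^ 2 := by
    rw [Finset.card_eq_sum_card_fiberwise (f := fun p => quadForm a p.1) (t := Q)
      (fun p hp => Finset.mem_coe.mpr (Finset.mem_image_of_mem _
        (Finset.mem_product.mp (Finset.mem_filter.mp hp).1).1))]
    refine Finset.sum_congr rfl fun n _ => ?_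
    rw [sq, ← Finset.card_product]
    congr 1
    ext ⟨m, k⟩
    simp only [Finset.mem_filter, Finset.mem_product]
    constructor
    · rintro ⟨⟨⟨h1, h2⟩, h3⟩, h4⟩; exact ⟨⟨h1, h4⟩, h2, h3 ▸ h4⟩
    · rintro ⟨⟨h1, h4⟩, h2, h3⟩; exact ⟨⟨⟨h1, h2⟩, h4.trans h3.symm⟩, h4⟩
  have h3 : (F.card : ℝ) ^ 2 ≤ Q.card * P.card := by
    rw [h1, h2]
    push_cast
    exact sq_sum_le_card_mul_sum_sq
  rw [hQ']
  have h4 : (X / 2) ^ 2 ≤ Q.card * (C * X ^ (1 + δ)) := by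
    calc (X / 2) ^ 2 ≤ (F.card : ℝ) ^ 2 := by gcongr
      _ ≤ _ := h3
      _ ≤ _ := by gcongr
  have h5 : X ^ (1 - δ) * X ^ (1 + δ) = X ^ 2 := by
    rw [← Real.rpow_add (by linarith)]
    norm_num
  have hp : 0 < X ^ (1 + δ) := by positivity
  have h6 : X ^ (1 - δ) * X ^ (1 + δ) ≤ (4 * (C + 1) * Q.card) * X ^ (1 + δ) := by
    rw [h5]
    have : (Q.card : ℝ) * (C * X ^ (1 + δ)) ≤ Q.card * ((C + 1) * X ^ (1 + δ)) := by
      gcongr; linarith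
    nlinarith
  have h7 := le_of_mul_le_mul_right h6 hp
  rw [one_div_mul_eq_div, div_le_iff₀ (by positivity)]
  linarith

/-- A set of reals is power sparse if its counting function saves a power over the trivial linear
bound. -/
def IsPowerSparse (S : Set ℝ) : Prop :=
  ∃ σ : ℝ, 0 < σ ∧ ∃ C : ℝ, 0 ≤ C ∧ ∀ X : ℝ, 1 ≤ X → ((S ∩ Set.Iic X).ncard : ℝ) ≤ C * X ^ (1 - σ)

theorem IsPowerSparse.union {S T : Set ℝ} (hS : IsPowerSparse S) (hT : IsPowerSparse T) :
    IsPowerSparse (S ∪ T) := by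
  obtain ⟨σ, hσ, C, hC, h⟩ := hS
  obtain ⟨τ, hτ, D, hD, k⟩ := hT
  refine ⟨min σ τ, lt_min hσ hτ, C + D, by positivity, fun X hX => ?_⟩
  rw [Set.union_inter_distrib_right]
  calc (((S ∩ Set.Iic X) ∪ (T ∩ Set.Iic X)).ncard : ℝ)
      ≤ ((S ∩ Set.Iic X).ncard : ℝ) + ((T ∩ Set.Iic X).ncard : ℝ) := by
        exact_mod_cast Set.ncard_union_le _ _
    _ ≤ C * X ^ (1 - σ) + D * X ^ (1 - τ) := add_le_add (h X hX) (k X hX)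
    _ ≤ C * X ^ (1 - min σ τ) + D * X ^ (1 - min σ τ) := by
        gcongr
        · exact min_le_left _ _
        · exact min_le_right _ _
    _ = _ := by ring

/-- For power sparsity it suffices to count in `[X ^ (1 - δ), X]`, since there are few eigenvalues
below `X ^ (1 - δ)`. -/
theorem isPowerSparse_of_ncard_Icc_le {a : ℝ} (ha : 0 < a) {S : Set ℝ} (hS : S ⊆ laplaceSpectrum a)
    {δ C : ℝ} (hδ : 0 < δ) (hδ1 : δ ≤ 1) (hC : 0 ≤ C)
    (h : ∀ X : ℝ, 1 ≤ X → ((S ∩ Set.Icc (X ^ (1 - δ)) X).ncard : ℝ) ≤ C * X ^ (1 - δ)) :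
    IsPowerSparse S := by
  obtain ⟨D, hD, k⟩ := exists_ncard_laplaceSpectrum_le ha
  refine ⟨δ, hδ, D + C, by linarith, fun X hX => ?_⟩
  have hY : 1 ≤ X ^ (1 - δ) := Real.one_le_rpow hX (by linarith)
  have hsub : S ∩ Set.Iic X ⊆ (laplaceSpectrum a ∩ Set.Iic (X ^ (1 - δ))) ∪
      (S ∩ Set.Icc (X ^ (1 - δ)) X) := by
    rintro n ⟨hn, hnX⟩
    rcases le_total n (X ^ (1 - δ)) with h | h
    · exact Or.inl ⟨hS hn, h⟩
    · exact Or.inr ⟨hn, h, hnX⟩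
  have hfin : (S ∩ Set.Icc (X ^ (1 - δ)) X).Finite :=
    (finite_laplaceSpectrum_inter_Iic ha X).subset fun n hn => ⟨hS hn.1, hn.2.2⟩
  calc ((S ∩ Set.Iic X).ncard : ℝ) ≤ ((laplaceSpectrum a ∩ Set.Iic (X ^ (1 - δ))).ncard : ℝ) +
        ((S ∩ Set.Icc (X ^ (1 - δ)) X).ncard : ℝ) := by
        exact_mod_cast (Set.ncard_le_ncard hsub
          ((finite_laplaceSpectrum_inter_Iic ha _).union hfin)).trans (Set.ncard_union_le _ _)
    _ ≤ D * X ^ (1 - δ) + C * X ^ (1 - δ) := add_le_add (k _ hY) (h X hX)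
    _ = _ := by ring

/-- The number of points of `S` up to `X` relative to the number of eigenvalues up to `X`. -/
noncomputable def relCount (a : ℝ) (S : Set ℝ) (X : ℝ) : ℝ :=
  ((S ∩ Set.Iic X).ncard : ℝ) / ((laplaceSpectrum a ∩ Set.Iic X).ncard : ℝ)

theorem relCount_nonneg (a : ℝ) (S : Set ℝ) (X : ℝ) : 0 ≤ relCount a S X := by
  unfold relCount; positivity

theorem relCount_union_le (a : ℝ) (S T : Set ℝ) (X : ℝ) :
    relCount a (S ∪ T) X ≤ relCount a S X + relCount a T X := by
  unfold relCount
  rw [← add_div, Set.union_inter_distrib_right]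
  gcongr
  exact_mod_cast Set.ncard_union_le _ _

theorem relCount_mono {a : ℝ} (ha : 0 < a) {S T : Set ℝ} {X : ℝ} (hT : T ⊆ laplaceSpectrum a)
    (h : S ∩ Set.Iic X ⊆ T) : relCount a S X ≤ relCount a T X := by
  unfold relCount
  refine div_le_div_of_nonneg_right ?_ (by positivity)
  have hsub : S ∩ Set.Iic X ⊆ T ∩ Set.Iic X := fun n hn => ⟨h hn, hn.2⟩
  exact_mod_cast Set.ncard_le_ncard hsub ((finite_laplaceSpectrum_inter_Iic ha X).subset
    (Set.inter_subset_inter_left _ hT))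

theorem IsPowerSparse.tendsto_relCount {a : ℝ} (ha : 0 < a) {S : Set ℝ} (h : IsPowerSparse S) :
    Tendsto (relCount a S) atTop (𝓝 0) := by
  obtain ⟨σ, hσ, C, hC, h⟩ := h
  obtain ⟨c, hc, k⟩ := exists_le_ncard_laplaceSpectrum ha (δ := σ / 2) (by positivity)
  have hlim : Tendsto (fun X : ℝ => C / c * X ^ (-(σ / 2))) atTop (𝓝 0) := by
    simpa using (tendsto_rpow_neg_atTop (y := σ / 2) (by positivity)).const_mul (C / c)
  refine squeeze_zero' (Eventually.of_forall fun X => relCount_nonneg a S X) ?_ hlim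
  filter_upwards [eventually_ge_atTop 1] with X hX
  have hp : 0 < X ^ (1 - σ / 2) := by positivity
  unfold relCount
  calc _ ≤ (C * X ^ (1 - σ)) / (c * X ^ (1 - σ / 2)) := by
        gcongr
        · exact h X hX
        · exact k X hX
    _ = _ := by
        rw [mul_div_mul_comm, ← Real.rpow_sub (by linarith)]
        congr 2; ring

/-- Countably many sets of relative density zero can be absorbed, up to bounded parts, into a single
set of relative density zero. -/
theorem exists_absorbing_density_zero {a : ℝ} (ha : 0 < a) (S : ℕ → Set ℝ)
    (hS : ∀ j, S j ⊆ laplaceSpectrum a) (h : ∀ j, Tendsto (relCount a (S j)) atTop (𝓝 0)) :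
    ∃ B : Set ℝ, B ⊆ laplaceSpectrum a ∧ Tendsto (relCount a B) atTop (𝓝 0) ∧
      ∀ j, ∃ Y : ℝ, ∀ n ∈ S j, Y ≤ n → n ∈ B := by
  -- the increasing union of the first sets, each still of density zero
  set U : ℕ → Set ℝ := fun j => ⋃ i ∈ Set.Iic j, S i with hU
  have hUsub : ∀ j, U j ⊆ laplaceSpectrum a := fun j => Set.iUnion₂_subset fun i _ => hS i
  have hUmono : Monotone U := fun i j hij =>
    Set.biUnion_subset_biUnion_left (Set.Iic_subset_Iic.mpr hij)
  have hU0 : ∀ j, Tendsto (relCount a (U j)) atTop (𝓝 0) := by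
    intro j
    induction j with
    | zero =>
      have : U 0 = S 0 := by ext; simp [hU]
      rw [this]; exact h 0
    | succ j ih =>
      have : U (j + 1) = U j ∪ S (j + 1) := by
        ext n; simp only [hU, Set.mem_iUnion, Set.mem_Iic, Set.mem_union]
        constructor
        · rintro ⟨i, hi, hn⟩
          rcases Nat.le_succ_iff.mp hi with h | h
          · exact Or.inl ⟨i, h, hn⟩
          · subst h; exact Or.inr hn
        · rintro (⟨i, hi, hn⟩ | hn)
          · exact ⟨i, by omega, hn⟩
          · exact ⟨j + 1, le_rfl, hn⟩
      rw [this]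
      have hs := ih.add (h (j + 1))
      rw [add_zero] at hs
      exact squeeze_zero (fun X => relCount_nonneg _ _ _) (fun X => relCount_union_le _ _ _ _) hs
  have hev : ∀ j, ∃ Y : ℝ, ∀ X, Y ≤ X → relCount a (U j) X ≤ 1 / ((j : ℝ) + 1) := fun j =>
    eventually_atTop.mp ((hU0 j).eventually (eventually_le_nhds (by positivity)))
  choose Y hY using hev
  -- thresholds, increasing and unbounded
  set Z : ℕ → ℝ := fun j => j + ∑ i ∈ Finset.range (j + 1), |Y i| with hZ
  have hZY : ∀ j, Y j ≤ Z j := by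
    intro j
    have h1 : |Y j| ≤ ∑ i ∈ Finset.range (j + 1), |Y i| :=
      Finset.single_le_sum (f := fun i => |Y i|) (fun _ _ => abs_nonneg _) (by simp)
    have h2 : (0 : ℝ) ≤ j := by positivity
    simp only [hZ]
    linarith [le_abs_self (Y j)]
  have hZmono : Monotone Z := by
    refine monotone_nat_of_le_succ fun j => ?_
    simp only [hZ]
    rw [Finset.sum_range_succ _ (j + 1)]
    push_cast
    linarith [abs_nonneg (Y (j + 1))]
  have hZj : ∀ j : ℕ, (j : ℝ) ≤ Z j := by
    intro j
    have : 0 ≤ ∑ i ∈ Finset.range (j + 1), |Y i| := Finset.sum_nonneg fun _ _ => abs_nonneg _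
    simp only [hZ]; linarith
  -- the `j`-th set is added from its threshold on
  refine ⟨{n | ∃ j, n ∈ S j ∧ Z j ≤ n}, ?_, ?_, fun j => ⟨Z j, fun n hn hZn => ⟨j, hn, hZn⟩⟩⟩
  · rintro n ⟨j, hn, _⟩; exact hS j hn
  · rw [Metric.tendsto_atTop]
    intro e he
    obtain ⟨J, hJ⟩ := exists_nat_one_div_lt he
    refine ⟨Z J, fun X hX => ?_⟩
    rw [Real.dist_0_eq_abs, abs_of_nonneg (relCount_nonneg _ _ _)]
    -- the largest `j` whose threshold is below `X`
    obtain ⟨j, hj⟩ : ∃ j, J ≤ j ∧ Z j ≤ X ∧ ∀ i, Z i ≤ X → i ≤ j := by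
      classical
      have hb : ∀ i, Z i ≤ X → i ≤ ⌊X⌋₊ := fun i hi => Nat.le_floor ((hZj i).trans hi)
      refine ⟨Nat.findGreatest (fun i => Z i ≤ X) ⌊X⌋₊, Nat.le_findGreatest (hb J hX) hX,
        Nat.findGreatest_spec (P := fun i => Z i ≤ X) (hb J hX) hX, fun i hi =>
        Nat.le_findGreatest (hb i hi) hi⟩
    obtain ⟨hJj, hjX, hmax⟩ := hj
    calc relCount a _ X ≤ relCount a (U j) X := by
          refine relCount_mono ha (hUsub j) ?_
          rintro n ⟨⟨i, hn, hZi⟩, hnX⟩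
          exact Set.mem_biUnion (hmax i (hZi.trans hnX)) hn
      _ ≤ 1 / ((j : ℝ) + 1) := hY j X ((hZY j).trans hjX)
      _ ≤ 1 / ((J : ℝ) + 1) := by gcongr
      _ < e := hJ

/-! ### Large gaps -/

/-- The points of the Laplace spectrum followed by a gap longer than `n ^ g`. -/
def largeGapSet (a g : ℝ) : Set ℝ :=
  {n | n ∈ laplaceSpectrum a ∧ 1 ≤ n ∧ ∀ n' ∈ laplaceSpectrum a, n < n' → n + n ^ g < n'}

theorem isPowerSparse_largeGapSet {a g : ℝ} (ha : 0 < a) (hg : 0 < g) (hg1 : g ≤ 1) :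
    IsPowerSparse (largeGapSet a g) := by
  refine isPowerSparse_of_ncard_Icc_le ha (fun n hn => hn.1) (δ := g / 2) (C := 2)
    (by positivity) (by linarith) (by norm_num) fun X hX => ?_
  set Y := X ^ (1 - g / 2) with hY
  have hY1 : 1 ≤ Y := Real.one_le_rpow hX (by linarith)
  set G := Y ^ g with hG
  have hG1 : 1 ≤ G := Real.one_le_rpow hY1 hg.le
  have hfin : (largeGapSet a g ∩ Set.Icc Y X).Finite :=
    (finite_laplaceSpectrum_inter_Iic ha X).subset fun n hn => ⟨hn.1.1, hn.2.2⟩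
  have hgap : ∀ n ∈ largeGapSet a g ∩ Set.Icc Y X, ∀ n' ∈ largeGapSet a g ∩ Set.Icc Y X,
      n < n' → n + G < n' := by
    intro n hn n' hn' hlt
    have h1 := hn.1.2.2 n' hn'.1.1 hlt
    have h2 : G ≤ n ^ g := Real.rpow_le_rpow (by linarith) hn.2.1 hg.le
    linarith
  have hfl : ∀ n n' : ℝ, n + G < n' → ⌊n / G⌋ < ⌊n' / G⌋ := by
    intro n n' h
    rw [Int.floor_lt]
    have h1 : n / G + 1 < n' / G := by
      rw [← div_self (by linarith : G ≠ 0), ← add_div]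
      gcongr
    have h2 := Int.lt_floor_add_one (n' / G)
    linarith
  -- the points are `G`-separated, so they lie in different intervals `[k G, (k + 1) G)`
  have hinj : Set.InjOn (fun n : ℝ => ⌊n / G⌋) (largeGapSet a g ∩ Set.Icc Y X) := by
    intro n hn n' hn' heq
    rcases lt_trichotomy n n' with h | h | h
    · exact absurd heq (hfl _ _ (hgap n hn n' hn' h)).ne
    · exact h
    · exact absurd heq (hfl _ _ (hgap n' hn' n hn h)).ne'
  have hcard := Set.ncard_le_ncard_of_injOn (t := Set.Icc 0 ⌊X / G⌋) _ (by
    intro n hn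
    have h0 : 0 ≤ n := by linarith [hn.1.2.1]
    exact ⟨Int.floor_nonneg.mpr (by positivity),
      Int.floor_le_floor (by have := hn.2.2; gcongr)⟩) hinj (Set.finite_Icc _ _)
  have hIcc : ((Set.Icc 0 ⌊X / G⌋).ncard : ℝ) ≤ X / G + 1 := by
    rw [← Finset.coe_Icc, Set.ncard_coe_finset, Int.card_Icc]
    have h0 : 0 ≤ ⌊X / G⌋ := Int.floor_nonneg.mpr (by positivity)
    have h2 : ((⌊X / G⌋ + 1 - 0).toNat : ℤ) = ⌊X / G⌋ + 1 - 0 := Int.toNat_of_nonneg (by omega)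
    have h3 : (((⌊X / G⌋ + 1 - 0).toNat : ℕ) : ℝ) = ⌊X / G⌋ + 1 := by
      have : (((⌊X / G⌋ + 1 - 0).toNat : ℕ) : ℝ) = ((⌊X / G⌋ + 1 - 0 : ℤ) : ℝ) := by
        exact_mod_cast h2
      rw [this]; push_cast; ring
    rw [h3]
    linarith [Int.floor_le (X / G)]
  have hXG : X / G ≤ Y := by
    rw [div_le_iff₀ (by linarith), hG, hY, ← Real.rpow_mul (by linarith),
      ← Real.rpow_add (by linarith)]
    calc X = X ^ (1 : ℝ) := (Real.rpow_one X).symm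
      _ ≤ _ := Real.rpow_le_rpow_of_exponent_le hX (by nlinarith)
  have : ((largeGapSet a g ∩ Set.Icc Y X).ncard : ℝ) ≤ ((Set.Icc 0 ⌊X / G⌋).ncard : ℝ) := by
    exact_mod_cast hcard
  linarith

/-! ### Long tails -/

open Classical in
/-- The sum of `(|ξ|² - n)⁻²` over the lattice points `ξ` with `||ξ|² - n| > L`. -/
noncomputable def tailSum (a n L : ℝ) : ℝ≥0∞ :=
  ∑' m : ℤ × ℤ, if L < |quadForm a m - n| then ENNReal.ofReal (1 / (quadForm a m - n) ^ 2) else 0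

theorem tailSum_anti (a n : ℝ) {L L' : ℝ} (h : L ≤ L') : tailSum a n L' ≤ tailSum a n L := by
  classical
  refine ENNReal.tsum_le_tsum fun m => ?_
  split_ifs with h1 h2 h2
  · exact le_rfl
  · exact absurd (h.trans_lt h1) h2
  · exact zero_le
  · exact le_rfl

theorem finite_near {a : ℝ} (ha : 0 < a) (n D : ℝ) : {m : ℤ × ℤ | |quadForm a m - n| ≤ D}.Finite :=
  (finite_quadForm_le ha (n + D)).subset fun m hm => by
    have hm' : |quadForm a m - n| ≤ D := hm
    have := (abs_le.mp hm').2
    simp only [Set.mem_ofPred_eq]; linarith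

theorem tailSum_le_dyadic {a : ℝ} (ha : 0 < a) (n : ℝ) {L : ℝ} (hL : 0 < L) :
    tailSum a n L ≤ ∑' j : ℕ, ENNReal.ofReal (1 / (L * 2 ^ j) ^ 2) *
      ({m : ℤ × ℤ | |quadForm a m - n| ≤ L * 2 ^ (j + 1)}.ncard : ℝ≥0∞) := by
  classical
  have h1 : ∀ j : ℕ, ENNReal.ofReal (1 / (L * 2 ^ j) ^ 2) *
      ({m : ℤ × ℤ | |quadForm a m - n| ≤ L * 2 ^ (j + 1)}.ncard : ℝ≥0∞)
      = ∑' m : ℤ × ℤ, if |quadForm a m - n| ≤ L * 2 ^ (j + 1) then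
          ENNReal.ofReal (1 / (L * 2 ^ j) ^ 2) else 0 := by
    intro j
    have hf := finite_near ha n (L * 2 ^ (j + 1))
    rw [tsum_eq_sum (s := hf.toFinset) (by
        intro m hm; rw [if_neg]; exact fun h => hm (hf.mem_toFinset.mpr h)),
      Finset.sum_congr rfl (g := fun _ => ENNReal.ofReal (1 / (L * 2 ^ j) ^ 2))
        (by intro m hm; rw [if_pos (by simpa using hm)]), Finset.sum_const, nsmul_eq_mul, mul_comm,
      Set.ncard_eq_toFinset_card _ hf]
  simp_rw [h1]
  rw [ENNReal.tsum_comm]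
  refine ENNReal.tsum_le_tsum fun m => ?_
  split_ifs with h
  · set t := |quadForm a m - n| with ht
    -- the dyadic block containing `t`
    obtain ⟨j, hj1, hj2⟩ := exists_nat_pow_near (x := t / L) (y := (2 : ℝ))
      (by rw [le_div_iff₀ hL]; linarith) (by norm_num)
    rw [le_div_iff₀ hL] at hj1
    rw [div_lt_iff₀ hL] at hj2
    refine le_trans ?_ (ENNReal.le_tsum j)
    rw [if_pos (by linarith)]
    refine ENNReal.ofReal_le_ofReal ?_
    rw [← sq_abs (quadForm a m - n), ← ht]
    have : L * 2 ^ j ≤ t := by linarith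
    gcongr
  · exact zero_le

/-- Choosing a lattice point on each circle `|ξ|² = n`, the sum over `n` is bounded by a number of
pairs of lattice points. -/
theorem exists_sum_ncard_near_le {a : ℝ} (ha : 0 < a) {δ : ℝ} (hδ : 0 < δ) :
    ∃ C : ℝ, 0 ≤ C ∧ ∀ X D : ℝ, 1 ≤ X → 1 ≤ D → ∀ N : Finset ℝ,
      (N : Set ℝ) ⊆ laplaceSpectrum a ∩ Set.Iic X →
      ((∑ n ∈ N, {m : ℤ × ℤ | |quadForm a m - n| ≤ D}.ncard : ℕ) : ℝ) ≤ C * X ^ (1 + δ) * D := by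
  classical
  obtain ⟨C, hC, h⟩ := exists_ncard_near_pairs_le ha hδ
  refine ⟨C, hC, fun X D hX hD N hN => ?_⟩
  obtain ⟨pf, pn⟩ := h X D hX hD
  refine le_trans ?_ pn
  have hrep : ∀ n ∈ N, ∃ m, quadForm a m = n := fun n hn => mem_laplaceSpectrum.mp (hN hn).1
  choose! r hr using hrep
  have e : ∑ n ∈ N, {m : ℤ × ℤ | |quadForm a m - n| ≤ D}.ncard
      = (N.sigma fun n => (finite_near ha n D).toFinset).card := by
    rw [Finset.card_sigma]
    exact Finset.sum_congr rfl fun n _ => Set.ncard_eq_toFinset_card _ (finite_near ha n D)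
  rw [e, Set.ncard_eq_toFinset_card _ pf, Nat.cast_le]
  refine Finset.card_le_card_of_injOn (fun p => (r p.1, p.2)) ?_ ?_
  · rintro ⟨n, m⟩ hp
    simp only [Finset.coe_sigma, Set.mem_sigma_iff, Finset.mem_coe, Set.Finite.mem_toFinset,
      Set.mem_ofPred_eq] at hp ⊢
    rw [hr n hp.1]
    exact ⟨(hN hp.1).2, hp.2⟩
  · rintro ⟨n, m⟩ hp ⟨n', m'⟩ hp' heq
    simp only [Finset.coe_sigma, Set.mem_sigma_iff, Finset.mem_coe] at hp hp'
    simp only [Prod.mk.injEq] at heq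
    have : n = n' := by rw [← hr n hp.1, ← hr n' hp'.1, heq.1]
    subst this
    rw [heq.2]

/-- The mean of the tail sums over the spectrum, summed over the dyadic blocks of `||ξ|² - n|`. -/
theorem exists_sum_tailSum_le {a : ℝ} (ha : 0 < a) {δ : ℝ} (hδ : 0 < δ) :
    ∃ C : ℝ, 0 ≤ C ∧ ∀ X L : ℝ, 1 ≤ X → 1 ≤ L → ∀ N : Finset ℝ,
      (N : Set ℝ) ⊆ laplaceSpectrum a ∩ Set.Iic X →
      ∑ n ∈ N, tailSum a n L ≤ ENNReal.ofReal (C * X ^ (1 + δ) / L) := by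
  obtain ⟨C, hC, h⟩ := exists_sum_ncard_near_le ha hδ
  refine ⟨4 * C, by positivity, fun X L hX hL N hN => ?_⟩
  have hX0 : 0 < X := by linarith
  have hL0 : 0 < L := by linarith
  calc ∑ n ∈ N, tailSum a n L ≤ ∑ n ∈ N, ∑' j : ℕ, ENNReal.ofReal (1 / (L * 2 ^ j) ^ 2) *
      ({m : ℤ × ℤ | |quadForm a m - n| ≤ L * 2 ^ (j + 1)}.ncard : ℝ≥0∞) :=
        Finset.sum_le_sum fun n _ => tailSum_le_dyadic ha n hL0
    _ = ∑' j : ℕ, ENNReal.ofReal (1 / (L * 2 ^ j) ^ 2) *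
      ∑ n ∈ N, ({m : ℤ × ℤ | |quadForm a m - n| ≤ L * 2 ^ (j + 1)}.ncard : ℝ≥0∞) := by
        rw [← Summable.tsum_finsetSum (fun _ _ => ENNReal.summable)]
        simp_rw [Finset.mul_sum]
    _ ≤ ∑' j : ℕ, ENNReal.ofReal (2 * C * X ^ (1 + δ) / L * (1 / 2) ^ j) := by
        refine ENNReal.tsum_le_tsum fun j => ?_
        have hD : 1 ≤ L * 2 ^ (j + 1) := one_le_mul_of_one_le_of_one_le hL (one_le_pow₀ (by norm_num))
        have h1 := h X (L * 2 ^ (j + 1)) hX hD N hN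
        have h2 : ∑ n ∈ N, ({m : ℤ × ℤ | |quadForm a m - n| ≤ L * 2 ^ (j + 1)}.ncard : ℝ≥0∞)
            ≤ ENNReal.ofReal (C * X ^ (1 + δ) * (L * 2 ^ (j + 1))) := by
          rw [← Nat.cast_sum, ← ENNReal.ofReal_natCast]
          exact ENNReal.ofReal_le_ofReal h1
        calc _ ≤ ENNReal.ofReal (1 / (L * 2 ^ j) ^ 2) *
              ENNReal.ofReal (C * X ^ (1 + δ) * (L * 2 ^ (j + 1))) := by gcongr
          _ = _ := by
            rw [← ENNReal.ofReal_mul (by positivity)]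
            congr 1
            rw [one_div_pow]
            field_simp
            ring
    _ = ENNReal.ofReal (∑' j : ℕ, 2 * C * X ^ (1 + δ) / L * (1 / 2) ^ j) :=
        (ENNReal.ofReal_tsum_of_nonneg (fun j => by positivity)
          (summable_geometric_two.mul_left _)).symm
    _ = _ := by
        rw [tsum_mul_left, tsum_geometric_two]
        congr 1; ring

/-- The points of the Laplace spectrum whose tail at distance `2 n ^ l` exceeds its mean size
`n ^ (-l)` by more than the factor `n ^ c`. -/
def longTailSet (a l c : ℝ) : Set ℝ :=
  {n | n ∈ laplaceSpectrum a ∧ 1 ≤ n ∧ ENNReal.ofReal (n ^ (c - l)) < tailSum a n (2 * n ^ l)}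

/-- Markov's inequality, from the mean `exists_sum_tailSum_le`. -/
theorem isPowerSparse_longTailSet {a l c : ℝ} (ha : 0 < a) (hl : 0 < l) (hl1 : l ≤ 1) (hc : 0 < c)
    (hcl : c ≤ l) : IsPowerSparse (longTailSet a l c) := by
  obtain ⟨C, hC, h⟩ := exists_sum_tailSum_le ha (δ := c / 4) (by positivity)
  refine isPowerSparse_of_ncard_Icc_le ha (fun n hn => hn.1) (δ := c / 4) (C := C)
    (by positivity) (by linarith) hC fun X hX => ?_
  have hX0 : 0 < X := by linarith
  set Y := X ^ (1 - c / 4) with hY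
  have hY1 : 1 ≤ Y := Real.one_le_rpow hX (by linarith)
  have hfin : (longTailSet a l c ∩ Set.Icc Y X).Finite :=
    (finite_laplaceSpectrum_inter_Iic ha X).subset fun n hn => ⟨hn.1.1, hn.2.2⟩
  have hYl : 1 ≤ Y ^ l := Real.one_le_rpow hY1 hl.le
  have h1 := h X (Y ^ l) hX hYl hfin.toFinset (by
    intro n hn
    simp only [Set.Finite.coe_toFinset] at hn
    exact ⟨hn.1.1, hn.2.2⟩)
  have h2 : hfin.toFinset.card • ENNReal.ofReal (X ^ (c - l)) ≤
      ∑ n ∈ hfin.toFinset, tailSum a n (Y ^ l) := by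
    refine Finset.card_nsmul_le_sum _ _ _ fun n hn => ?_
    rw [Set.Finite.mem_toFinset] at hn
    have hn0 : 0 < n := by linarith [hn.1.2.1]
    calc ENNReal.ofReal (X ^ (c - l)) ≤ ENNReal.ofReal (n ^ (c - l)) :=
          ENNReal.ofReal_le_ofReal
            (Real.rpow_le_rpow_of_nonpos hn0 hn.2.2 (by linarith))
      _ ≤ tailSum a n (2 * n ^ l) := hn.1.2.2.le
      _ ≤ tailSum a n (Y ^ l) := by
        refine tailSum_anti a n ?_
        have : Y ^ l ≤ n ^ l := Real.rpow_le_rpow (by linarith) hn.2.1 hl.le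
        have : 0 ≤ n ^ l := by positivity
        linarith
  have h3 := h2.trans h1
  rw [nsmul_eq_mul, ← ENNReal.ofReal_natCast, ← ENNReal.ofReal_mul (by positivity),
    ENNReal.ofReal_le_ofReal_iff (by positivity)] at h3
  rw [Set.ncard_eq_toFinset_card _ hfin]
  have h4 : C * X ^ (1 + c / 4) / Y ^ l ≤ C * X ^ (1 - c / 4) * X ^ (c - l) := by
    rw [hY, ← Real.rpow_mul hX0.le, mul_div_assoc, ← Real.rpow_sub hX0, mul_assoc,
      ← Real.rpow_add hX0]
    gcongr
    nlinarith
  exact le_of_mul_le_mul_right (h3.trans h4) (by positivity)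

/-! ### Near pairs -/

theorem quadForm_add_sub (a : ℝ) (m z : ℤ × ℤ) :
    quadForm a (m + z) - quadForm a m
      = 2 * z.1 / a ^ 2 * m.1 + (2 * a ^ 2 * z.2 * m.2 + quadForm a z) := by
  simp only [quadForm, Prod.fst_add, Prod.snd_add]
  push_cast
  ring

/-- The lattice points of a disc at nearly equal distances from `0` and `-z` lie in a thin strip. -/
theorem exists_ncard_strip_le {a : ℝ} (ha : 0 < a) :
    ∃ C : ℝ, 0 ≤ C ∧ ∀ X H : ℝ, 1 ≤ X → 1 ≤ H → ∀ z : ℤ × ℤ, z ≠ 0 →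
      {m : ℤ × ℤ | quadForm a m ≤ X ∧ |quadForm a (m + z) - quadForm a m| ≤ H}.Finite ∧
      ({m : ℤ × ℤ | quadForm a m ≤ X ∧ |quadForm a (m + z) - quadForm a m| ≤ H}.ncard : ℝ)
        ≤ C * (√X * H) := by
  have ha' : 0 < a⁻¹ := by positivity
  set C₁ := (2 * a⁻¹ + 1) * (a ^ 2 + 1)
  set C₂ := (2 * a + 1) * ((a ^ 2)⁻¹ + 1)
  have hC1 : 0 ≤ C₁ := by positivity
  have hC2 : 0 ≤ C₂ := by positivity
  refine ⟨C₁ + C₂, by positivity, fun X H hX hH z hz => ?_⟩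
  set S := {m : ℤ × ℤ | quadForm a m ≤ X ∧ |quadForm a (m + z) - quadForm a m| ≤ H} with hS
  have hfin : S.Finite := (finite_quadForm_le ha X).subset fun m hm => hm.1
  refine ⟨hfin, ?_⟩
  have hs : 1 ≤ √X := Real.one_le_sqrt.mpr hX
  have hz' : z.1 ≠ 0 ∨ z.2 ≠ 0 := by
    by_contra hcon
    push Not at hcon
    exact hz (Prod.ext hcon.1 hcon.2)
  have hint : ∀ k : ℤ, k ≠ 0 → (1 : ℝ) ≤ |(k : ℝ)| := fun k hk => by
    exact_mod_cast Int.one_le_abs hk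
  rcases hz' with h1 | h2
  · obtain ⟨f, n⟩ := finite_ncard_abs_le (M := a⁻¹ * √X) (by positivity)
    have := ncard_le_ncard_mul_of_fibers (S := S) (A := {k : ℤ | |(k : ℝ)| ≤ a⁻¹ * √X}) Prod.snd f
      (M := (a ^ 2 + 1) * H)
      (fun m hm => abs_snd_le_of_quadForm_le ha hm.1) (by
        intro k _
        have hc : (2 * z.1 / a ^ 2 : ℝ) ≠ 0 := by positivity
        obtain ⟨f', n'⟩ := finite_ncard_int_abs_le hc (2 * a ^ 2 * z.2 * k + quadForm a z)
          (D := H) (by linarith)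
        have hsub : {x ∈ S | x.2 = k} ⊆ (fun i : ℤ => (i, k)) '' {i : ℤ | |(2 * z.1 / a ^ 2 : ℝ) * i +
            (2 * a ^ 2 * z.2 * k + quadForm a z)| ≤ H} := by
          rintro ⟨i, j⟩ ⟨hm, rfl⟩
          refine ⟨i, ?_, rfl⟩
          have := hm.2
          rw [quadForm_add_sub] at this
          exact this
        refine ⟨(f'.image _).subset hsub, ?_⟩
        have h1' := (Set.ncard_le_ncard hsub (f'.image _)).trans (Set.ncard_image_le f')
        refine ((Nat.cast_le.mpr h1').trans n').trans ?_
        have h3 : 2 * H / |(2 * z.1 / a ^ 2 : ℝ)| ≤ a ^ 2 * H := by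
          rw [div_le_iff₀ (by positivity), abs_div, abs_mul, abs_of_pos (by positivity : 0 < a ^ 2),
            abs_two]
          have := hint _ h1
          calc 2 * H = 2 * H * 1 := by ring
            _ ≤ 2 * H * |(z.1 : ℝ)| := by gcongr
            _ = _ := by field_simp
        linarith)
    calc (S.ncard : ℝ) ≤ _ := this.2
      _ ≤ ((2 * a⁻¹ + 1) * √X) * ((a ^ 2 + 1) * H) := by
        gcongr
        exact n.trans (by nlinarith)
      _ = C₁ * (√X * H) := by simp only [C₁]; ring
      _ ≤ _ := by gcongr; linarith
  · obtain ⟨f, n⟩ := finite_ncard_abs_le (M := a * √X) (by positivity)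
    have := ncard_le_ncard_mul_of_fibers (S := S) (A := {k : ℤ | |(k : ℝ)| ≤ a * √X}) Prod.fst f
      (M := ((a ^ 2)⁻¹ + 1) * H)
      (fun m hm => abs_fst_le_of_quadForm_le ha hm.1) (by
        intro k _
        have hc : (2 * a ^ 2 * z.2 : ℝ) ≠ 0 := by positivity
        obtain ⟨f', n'⟩ := finite_ncard_int_abs_le hc (2 * z.1 / a ^ 2 * k + quadForm a z)
          (D := H) (by linarith)
        have hsub : {x ∈ S | x.1 = k} ⊆ (fun i : ℤ => (k, i)) '' {i : ℤ | |(2 * a ^ 2 * z.2 : ℝ) * i +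
            (2 * z.1 / a ^ 2 * k + quadForm a z)| ≤ H} := by
          rintro ⟨j, i⟩ ⟨hm, rfl⟩
          refine ⟨i, ?_, rfl⟩
          have := hm.2
          rw [quadForm_add_sub, add_left_comm] at this
          exact this
        refine ⟨(f'.image _).subset hsub, ?_⟩
        have h1' := (Set.ncard_le_ncard hsub (f'.image _)).trans (Set.ncard_image_le f')
        refine ((Nat.cast_le.mpr h1').trans n').trans ?_
        have h3 : 2 * H / |(2 * a ^ 2 * z.2 : ℝ)| ≤ (a ^ 2)⁻¹ * H := by
          rw [div_le_iff₀ (by positivity), abs_mul, abs_mul, abs_of_pos (by positivity : 0 < a ^ 2),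
            abs_two]
          have := hint _ h2
          calc 2 * H = 2 * H * 1 := by ring
            _ ≤ 2 * H * |(z.2 : ℝ)| := by gcongr
            _ = _ := by field_simp
        linarith)
    calc (S.ncard : ℝ) ≤ _ := this.2
      _ ≤ ((2 * a + 1) * √X) * (((a ^ 2)⁻¹ + 1) * H) := by
        gcongr
        exact n.trans (by nlinarith)
      _ = C₂ * (√X * H) := by simp only [C₂]; ring
      _ ≤ _ := by gcongr; linarith

/-- In windows shorter than the error term of the circle law there are at most as many lattice
points as that error term. -/
theorem exists_ncard_near_le_of_circleLaw {a θ : ℝ} (ha : 0 < a) (hθ : 0 ≤ θ) (h : CircleLaw a θ)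
    {δ : ℝ} (hδ : 0 < δ) :
    ∃ C : ℝ, 0 ≤ C ∧ ∀ X H t : ℝ, 1 ≤ X → 1 ≤ H → H ≤ X → H ≤ 2 * X ^ (θ + δ) → t ≤ X →
      ({m : ℤ × ℤ | |quadForm a m - t| ≤ H}.ncard : ℝ) ≤ C * X ^ (θ + δ) := by
  obtain ⟨C, hC⟩ := h δ hδ
  obtain ⟨C₂, hC2, hL⟩ := exists_ncard_quadForm_le ha
  refine ⟨C₂ * 8 + (5 * Real.pi + 2 * |C| * 2 ^ (θ + δ)), by positivity,
    fun X H t hX hH hHX hHθ ht => ?_⟩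
  have hX0 : 0 < X := by linarith
  have hb : ∀ T : ℝ, 1 ≤ T → T ≤ 2 * X →
      |({m : ℤ × ℤ | quadForm a m ≤ T}.ncard : ℝ) - Real.pi * T|
        ≤ |C| * 2 ^ (θ + δ) * X ^ (θ + δ) := by
    intro T hT hTX
    have := hC T hT
    simp only [norm_freq_sq] at this
    refine this.trans ?_
    calc C * T ^ (θ + δ) ≤ |C| * (2 * X) ^ (θ + δ) := by
          gcongr
          · exact le_abs_self C
      _ = _ := by rw [Real.mul_rpow (by norm_num) hX0.le]; ring
  have hpos : 0 ≤ (5 * Real.pi + 2 * |C| * 2 ^ (θ + δ)) * X ^ (θ + δ) := by positivity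
  have hpos2 : 0 ≤ C₂ * 8 * X ^ (θ + δ) := by positivity
  rcases lt_or_ge (t - H - 1) 1 with hlow | hlow
  · have hsub : {m : ℤ × ℤ | |quadForm a m - t| ≤ H} ⊆ {m : ℤ × ℤ | quadForm a m ≤ 4 * H} := by
      intro m hm
      have hm' : |quadForm a m - t| ≤ H := hm
      have := (abs_le.mp hm').2
      simp only [Set.mem_ofPred_eq]
      linarith
    calc ({m : ℤ × ℤ | |quadForm a m - t| ≤ H}.ncard : ℝ)
        ≤ ({m : ℤ × ℤ | quadForm a m ≤ 4 * H}.ncard : ℝ) := by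
          exact_mod_cast Set.ncard_le_ncard hsub (finite_quadForm_le ha _)
      _ ≤ C₂ * (4 * H) := hL _ (by linarith)
      _ ≤ C₂ * (4 * (2 * X ^ (θ + δ))) := by gcongr
      _ ≤ _ := by linarith
  · have hsub : {m : ℤ × ℤ | |quadForm a m - t| ≤ H} ⊆
        {m : ℤ × ℤ | quadForm a m ≤ t + H} \ {m : ℤ × ℤ | quadForm a m ≤ t - H - 1} := by
      intro m hm
      have hm' : |quadForm a m - t| ≤ H := hm
      have := abs_le.mp hm'
      simp only [Set.mem_sdiff, Set.mem_ofPred_eq, not_le]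
      constructor <;> linarith
    have hsub2 : {m : ℤ × ℤ | quadForm a m ≤ t - H - 1} ⊆ {m : ℤ × ℤ | quadForm a m ≤ t + H} := by
      intro m hm
      simp only [Set.mem_ofPred_eq] at hm ⊢
      linarith
    have h1 := Set.ncard_le_ncard hsub ((finite_quadForm_le ha _).subset Set.sdiff_subset)
    have h2 := Set.ncard_sdiff_add_ncard_of_subset hsub2 (finite_quadForm_le ha _)
    have h3 : ({m : ℤ × ℤ | |quadForm a m - t| ≤ H}.ncard : ℝ) +
      ({m : ℤ × ℤ | quadForm a m ≤ t - H - 1}.ncard : ℝ)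
        ≤ ({m : ℤ × ℤ | quadForm a m ≤ t + H}.ncard : ℝ) := by
      exact_mod_cast (by omega :
        {m : ℤ × ℤ | |quadForm a m - t| ≤ H}.ncard + {m : ℤ × ℤ | quadForm a m ≤ t - H - 1}.ncard
          ≤ {m : ℤ × ℤ | quadForm a m ≤ t + H}.ncard)
    have h4 := abs_le.mp (hb (t + H) (by linarith) (by linarith))
    have h5 := abs_le.mp (hb (t - H - 1) (by linarith) (by linarith))
    have h6 : Real.pi * (2 * H + 1) ≤ 5 * Real.pi * X ^ (θ + δ) := by
      calc Real.pi * (2 * H + 1) ≤ Real.pi * (5 * X ^ (θ + δ)) := by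
            have : 1 ≤ X ^ (θ + δ) := Real.one_le_rpow hX (by linarith)
            gcongr; linarith
        _ = _ := by ring
    nlinarith [h4.2, h5.1]

/-- The points `n` of the Laplace spectrum for which two lattice points that differ by a short
nonzero lattice vector lie within `2 n ^ l` of the circle `|ξ|² = n`. -/
def nearPairSet (a l δ : ℝ) : Set ℝ :=
  {n | n ∈ laplaceSpectrum a ∧ 1 ≤ n ∧ ∃ m z : ℤ × ℤ, z ≠ 0 ∧ quadForm a z ≤ n ^ (2 * δ) ∧
    |quadForm a m - n| ≤ 2 * n ^ l ∧ |quadForm a (m + z) - n| ≤ 2 * n ^ l}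

/-- There are `O(X ^ (1 / 2 + l + 2 δ))` near pairs up to `X`, and each is close to
`O(X ^ (θ + δ))` points of the spectrum. -/
theorem isPowerSparse_nearPairSet {a θ l δ : ℝ} (ha : 0 < a) (hθ : 0 ≤ θ) (h : CircleLaw a θ)
    (hl : 0 < l) (hδ : 0 < δ) (hlθ : l ≤ θ + δ)
    (hsum : 1 / 2 + l + θ + 3 * δ < 1) : IsPowerSparse (nearPairSet a l δ) := by
  obtain ⟨C₁, hC1, hS⟩ := exists_ncard_strip_le ha
  obtain ⟨C₂, hC2, hN⟩ := exists_ncard_near_le_of_circleLaw ha hθ h hδ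
  obtain ⟨C₃, hC3, hL⟩ := exists_ncard_quadForm_le ha
  refine ⟨1 - (1 / 2 + l + θ + 3 * δ), by linarith,
    (C₃ * (C₁ * (√3 * 4))) * (C₂ * 3 ^ (θ + δ)), by positivity, fun X hX => ?_⟩
  have hX0 : 0 < X := by linarith
  have hXl : 1 ≤ X ^ l := Real.one_le_rpow hX hl.le
  have hXl1 : X ^ l ≤ X := by
    calc X ^ l ≤ X ^ (1 : ℝ) := Real.rpow_le_rpow_of_exponent_le hX (by linarith)
      _ = X := Real.rpow_one X
  have hXδ : 1 ≤ X ^ (2 * δ) := Real.one_le_rpow hX (by positivity)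
  -- the near pairs `(m, m + z)`, recorded as `(m, z)`: for each `z` the points `m` lie in a strip
  set A := {p : (ℤ × ℤ) × (ℤ × ℤ) | (quadForm a p.1 ≤ 3 * X ∧
    |quadForm a (p.1 + p.2) - quadForm a p.1| ≤ 4 * X ^ l) ∧ p.2 ≠ 0 ∧
    quadForm a p.2 ≤ X ^ (2 * δ)} with hA
  have hzf := finite_quadForm_le ha (X ^ (2 * δ))
  have hAc := ncard_le_ncard_mul_of_fibers (S := A)
    (A := {z : ℤ × ℤ | z ≠ 0 ∧ quadForm a z ≤ X ^ (2 * δ)}) Prod.snd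
    (hzf.subset fun z hz => hz.2) (M := C₁ * (√(3 * X) * (4 * X ^ l))) (fun p hp => hp.2) (by
      intro z hz
      obtain ⟨f, n⟩ := hS (3 * X) (4 * X ^ l) (by linarith) (by linarith) z hz.1
      have hsub : {x ∈ A | x.2 = z} ⊆ (fun m => (m, z)) '' {m : ℤ × ℤ | quadForm a m ≤ 3 * X ∧
          |quadForm a (m + z) - quadForm a m| ≤ 4 * X ^ l} := by
        rintro ⟨m, z⟩ ⟨hm, rfl⟩
        exact ⟨m, hm.1, rfl⟩
      refine ⟨(f.image _).subset hsub, ?_⟩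
      have h1 := (Set.ncard_le_ncard hsub (f.image _)).trans (Set.ncard_image_le f)
      exact (Nat.cast_le.mpr h1).trans n)
  have hAcard : (A.ncard : ℝ) ≤ (C₃ * X ^ (2 * δ)) * (C₁ * (√(3 * X) * (4 * X ^ l))) := by
    refine hAc.2.trans ?_
    gcongr
    refine le_trans ?_ (hL _ hXδ)
    have hsub : {z : ℤ × ℤ | z ≠ 0 ∧ quadForm a z ≤ X ^ (2 * δ)} ⊆
      {z : ℤ × ℤ | quadForm a z ≤ X ^ (2 * δ)} := fun z hz => hz.2
    exact_mod_cast Set.ncard_le_ncard hsub hzf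
  -- the points of the spectrum close to a near pair: by the circle law few for each pair
  set R := {p : ℝ × ((ℤ × ℤ) × (ℤ × ℤ)) | p.2 ∈ A ∧ p.1 ∈ laplaceSpectrum a ∧
    |quadForm a p.2.1 - p.1| ≤ 2 * X ^ l} with hR
  have hRc := ncard_le_ncard_mul_of_fibers (S := R) (A := A) Prod.snd hAc.1
    (M := C₂ * (3 * X) ^ (θ + δ)) (fun p hp => hp.1) (by
      rintro ⟨m, z⟩ hp
      have hf := finite_near ha (quadForm a m) (2 * X ^ l)
      have hsub : {x ∈ R | x.2 = (m, z)} ⊆ (fun k => (quadForm a k, (m, z))) ''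
          {k : ℤ × ℤ | |quadForm a k - quadForm a m| ≤ 2 * X ^ l} := by
        rintro ⟨n, p⟩ ⟨hn, rfl⟩
        obtain ⟨k, hk⟩ := mem_laplaceSpectrum.mp hn.2.1
        refine ⟨k, ?_, by simp only [hk]⟩
        simp only [Set.mem_ofPred_eq]
        rw [hk, abs_sub_comm]
        exact hn.2.2
      refine ⟨(hf.image _).subset hsub, ?_⟩
      have h1 := (Set.ncard_le_ncard hsub (hf.image _)).trans (Set.ncard_image_le hf)
      refine (Nat.cast_le.mpr h1).trans ?_
      refine hN (3 * X) (2 * X ^ l) _ (by linarith) (by linarith) (by linarith) ?_ hp.1.1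
      have h2 : X ^ l ≤ (3 * X) ^ (θ + δ) :=
        (Real.rpow_le_rpow_of_exponent_le hX hlθ).trans (by gcongr; linarith)
      linarith)
  have hsub : nearPairSet a l δ ∩ Set.Iic X ⊆ Prod.fst '' R := by
    rintro n ⟨⟨hn, hn1, m, z, hz, hzn, h1, h2⟩, hnX⟩
    have hnX' : n ≤ X := hnX
    have hn0 : 0 < n := by linarith
    have hnl : n ^ l ≤ X ^ l := by gcongr
    have hnδ : n ^ (2 * δ) ≤ X ^ (2 * δ) := by gcongr
    have h1' := abs_le.mp h1
    have h2' := abs_le.mp h2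
    refine ⟨(n, (m, z)), ⟨⟨⟨?_, ?_⟩, hz, hzn.trans hnδ⟩, hn, h1.trans (by linarith)⟩, rfl⟩
    · simp only; linarith
    · simp only; rw [abs_le]; constructor <;> linarith
  have hfinal := (Set.ncard_le_ncard hsub (hRc.1.image _)).trans (Set.ncard_image_le hRc.1)
  calc ((nearPairSet a l δ ∩ Set.Iic X).ncard : ℝ) ≤ R.ncard := Nat.cast_le.mpr hfinal
    _ ≤ _ := hRc.2
    _ ≤ ((C₃ * X ^ (2 * δ)) * (C₁ * (√(3 * X) * (4 * X ^ l)))) * (C₂ * (3 * X) ^ (θ + δ)) := by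
      gcongr
    _ = (C₃ * (C₁ * (√3 * 4))) * (C₂ * 3 ^ (θ + δ)) *
        (X ^ (2 * δ) * (X ^ (1 / 2 : ℝ) * X ^ l) * X ^ (θ + δ)) := by
      rw [Real.sqrt_mul (by norm_num), Real.mul_rpow (by norm_num) hX0.le, Real.sqrt_eq_rpow X]
      ring
    _ = _ := by
      rw [← Real.rpow_add hX0, ← Real.rpow_add hX0, ← Real.rpow_add hX0]
      congr 2
      ring

/-! ### The exceptional set -/

/-- Outside a power sparse set of eigenvalues `n`, the lattice points near the circle `|ξ|² = n`
have no short differences, and the lattice points away from it contribute little to the sum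
`∑ (|ξ|² - lam)⁻²`, for any `lam` between `n` and the next eigenvalue. -/
theorem exists_powerSparse_exceptional_set {a θ ε : ℝ} (ha : 0 < a) (hθ : 1 / 4 ≤ θ)
    (hcirc : CircleLaw a θ) (hε : 0 < ε) (hεθ : 2 * ε < 1 - 3 * θ) :
    ∃ S ⊆ laplaceSpectrum a, IsPowerSparse S ∧
      ∀ n ∈ laplaceSpectrum a, n ∉ S → 1 ≤ n → ∀ lam : ℝ, n < lam →
        (∀ n' ∈ laplaceSpectrum a, n < n' → lam < n') →
        lam ≤ 2 * n ∧ ∃ A : Set (ℤ × ℤ),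
          (∀ m z : ℤ × ℤ, z ≠ 0 → quadForm a z ≤ n ^ (ε / 3) → m ∈ A → m + z ∉ A) ∧
          ∀ F : Finset (ℤ × ℤ), (∀ m ∈ F, m ∉ A) →
            ∑ m ∈ F, 1 / (quadForm a m - lam) ^ 2 ≤ 4 * n ^ (-(1 - 3 * θ) + 2 * ε) := by
  -- `1 / 2 + l + θ < 1` suffices for near pairs, and `l = 1 - 3 θ - ε` satisfies it as `θ ≥ 1 / 4`
  set l := 1 - 3 * θ - ε with hl
  have hl0 : 0 < l := by linarith
  have hl1 : l ≤ 1 := by linarith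
  refine ⟨largeGapSet a l ∪ (longTailSet a l ε ∪ nearPairSet a l (ε / 6)), ?_, ?_, ?_⟩
  · rintro n (h | h | h) <;> exact h.1
  · exact (isPowerSparse_largeGapSet ha hl0 hl1).union
      ((isPowerSparse_longTailSet ha hl0 hl1 hε (by linarith)).union
        (isPowerSparse_nearPairSet ha (by linarith) hcirc hl0 (by positivity) (by linarith)
          (by linarith)))
  intro n hn hnS hn1 lam hlam hnext
  simp only [Set.mem_union, not_or] at hnS
  obtain ⟨hS1, hS2, hS3⟩ := hnS
  have hn0 : 0 < n := by linarith
  have hgap : lam ≤ n + n ^ l := by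
    by_contra hcon
    push Not at hcon
    exact hS1 ⟨hn, hn1, fun n' hn' hlt => hcon.trans (hnext n' hn' hlt)⟩
  have hnl : n ^ l ≤ n := by
    calc n ^ l ≤ n ^ (1 : ℝ) := Real.rpow_le_rpow_of_exponent_le hn1 hl1
      _ = n := Real.rpow_one n
  refine ⟨by linarith, {m | |quadForm a m - n| ≤ 2 * n ^ l}, ?_, ?_⟩
  · intro m z hz hzn hm hmz
    refine hS3 ⟨hn, hn1, m, z, hz, ?_, hm, hmz⟩
    convert hzn using 2
    ring
  · intro F hF
    have htail : tailSum a n (2 * n ^ l) ≤ ENNReal.ofReal (n ^ (ε - l)) := by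
      by_contra hcon
      push Not at hcon
      exact hS2 ⟨hn, hn1, hcon⟩
    have h1 : ∀ m ∈ F, 2 * n ^ l < |quadForm a m - n| := fun m hm => not_le.mp (hF m hm)
    have h2 : ∀ m ∈ F, 1 / (quadForm a m - lam) ^ 2 ≤ 4 * (1 / (quadForm a m - n) ^ 2) := by
      intro m hm
      have hm1 := h1 m hm
      have hnl0 : 0 < n ^ l := by positivity
      have h3 : |quadForm a m - n| / 2 ≤ |quadForm a m - lam| := by
        have : |quadForm a m - n| ≤ |quadForm a m - lam| + |lam - n| := abs_sub_le _ _ _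
        have h4 : |lam - n| ≤ n ^ l := by rw [abs_of_pos (by linarith)]; linarith
        linarith
      have h5 : 0 < |quadForm a m - n| := by linarith
      rw [← sq_abs (quadForm a m - lam), ← sq_abs (quadForm a m - n)]
      calc 1 / |quadForm a m - lam| ^ 2 ≤ 1 / (|quadForm a m - n| / 2) ^ 2 := by gcongr
        _ = _ := by field_simp; norm_num
    have h3 : ENNReal.ofReal (∑ m ∈ F, 1 / (quadForm a m - n) ^ 2) ≤
        ENNReal.ofReal (n ^ (ε - l)) := by
      classical
      rw [ENNReal.ofReal_sum_of_nonneg (fun m _ => by positivity)]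
      refine le_trans ?_ htail
      refine le_trans (le_of_eq ?_) (ENNReal.sum_le_tsum F)
      exact Finset.sum_congr rfl fun m hm => (if_pos (h1 m hm)).symm
    rw [ENNReal.ofReal_le_ofReal_iff (by positivity)] at h3
    calc _ ≤ ∑ m ∈ F, 4 * (1 / (quadForm a m - n) ^ 2) := Finset.sum_le_sum h2
      _ = 4 * ∑ m ∈ F, 1 / (quadForm a m - n) ^ 2 := by rw [Finset.mul_sum]
      _ ≤ 4 * n ^ (ε - l) := by gcongr
      _ = _ := by congr 2; rw [hl]; ring

/-! ### Autocorrelations -/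

/-- If the sequence `u` has `ℓ²` norm at most one and is small in `ℓ²` off a set without the difference
`z`, then its autocorrelation at `z` is small: in each summand at least one factor is off the set. -/
theorem norm_autocorrelation_le {u : ℤ × ℤ → ℂ} {A : Set (ℤ × ℤ)} {z : ℤ × ℤ} {s : ℂ} {τ : ℝ}
    (hτ : 0 ≤ τ) (hu : ∀ F : Finset (ℤ × ℤ), ∑ m ∈ F, ‖u m‖ ^ 2 ≤ 1)
    (hA : ∀ m ∈ A, m + z ∉ A)
    (ht : ∀ F : Finset (ℤ × ℤ), (∀ m ∈ F, m ∉ A) → ∑ m ∈ F, ‖u m‖ ^ 2 ≤ τ ^ 2)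
    (hs : HasSum (fun m => conj (u m) * u (m + z)) s) : ‖s‖ ≤ 2 * τ := by
  classical
  refine le_of_tendsto (hs.norm) (Eventually.of_forall fun F => ?_)
  set x : ℤ × ℤ → ℝ := fun m => if m ∈ A then 0 else ‖u m‖ with hx
  have hx0 : ∀ m, 0 ≤ x m := fun m => by simp only [hx]; split_ifs <;> positivity
  have hxF : ∀ F : Finset (ℤ × ℤ), ∑ m ∈ F, x m ^ 2 ≤ τ ^ 2 := by
    intro F
    refine le_trans (le_of_eq ?_) (ht (F.filter (· ∉ A)) (fun m hm => (Finset.mem_filter.mp hm).2))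
    rw [Finset.sum_filter]
    refine Finset.sum_congr rfl fun m _ => ?_
    by_cases h : m ∈ A <;> simp [hx, h]
  have hshift : ∀ (y : ℤ × ℤ → ℝ) (c : ℝ), (∀ F : Finset (ℤ × ℤ), ∑ m ∈ F, y m ^ 2 ≤ c) →
      ∑ m ∈ F, y (m + z) ^ 2 ≤ c := by
    intro y c h
    have := h (F.map (Equiv.addRight z).toEmbedding)
    rwa [Finset.sum_map] at this
  have hle : ∀ m, ‖conj (u m) * u (m + z)‖ ≤ x m * ‖u (m + z)‖ + ‖u m‖ * x (m + z) := by
    intro m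
    rw [norm_mul, RCLike.norm_conj]
    by_cases h : m ∈ A
    · have h2 : x (m + z) = ‖u (m + z)‖ := by simp only [hx]; rw [if_neg (hA m h)]
      rw [h2]
      have := mul_nonneg (hx0 m) (norm_nonneg (u (m + z)))
      linarith
    · have h2 : x m = ‖u m‖ := by simp only [hx]; rw [if_neg h]
      rw [h2]
      have := mul_nonneg (norm_nonneg (u m)) (hx0 (m + z))
      linarith
  have hsq : ∀ v w : ℝ, v ≤ τ ^ 2 → w ≤ 1 → √v * √w ≤ τ := by
    intro v w hv hw
    have h1 : √v ≤ τ := by rw [← Real.sqrt_sq hτ]; exact Real.sqrt_le_sqrt hv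
    have h2 : √w ≤ 1 := by rw [← Real.sqrt_one]; exact Real.sqrt_le_sqrt hw
    calc √v * √w ≤ τ * 1 := mul_le_mul h1 h2 (Real.sqrt_nonneg _) hτ
      _ = τ := mul_one τ
  calc ‖∑ m ∈ F, conj (u m) * u (m + z)‖ ≤ ∑ m ∈ F, (x m * ‖u (m + z)‖ + ‖u m‖ * x (m + z)) :=
        norm_sum_le_of_le _ fun m _ => hle m
    _ = ∑ m ∈ F, x m * ‖u (m + z)‖ + ∑ m ∈ F, x (m + z) * ‖u m‖ := by
        rw [Finset.sum_add_distrib]; simp_rw [mul_comm]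
    _ ≤ τ + τ := by
        refine add_le_add ((Real.sum_mul_le_sqrt_mul_sqrt _ _ _).trans (hsq _ _ (hxF F) ?_))
          ((Real.sum_mul_le_sqrt_mul_sqrt _ _ _).trans (hsq _ _ ?_ (hu F)))
        · exact hshift (fun m => ‖u m‖) 1 hu
        · exact hshift x _ hxF
    _ = 2 * τ := by ring

/-! ### Fourier series on the torus -/

section TorusTransfer

/-- The Haar probability measure on `ℝ / ℤ`, the measure for which the multivariate Fourier series
are normalized. -/
noncomputable local instance haarUnitAddCircle : MeasureSpace UnitAddCircle :=
  ⟨AddCircle.haarAddCircle⟩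

local instance isAddHaarMeasure_haarUnitAddCircle :
    Measure.IsAddHaarMeasure (volume : Measure UnitAddCircle) :=
  inferInstanceAs (Measure.IsAddHaarMeasure AddCircle.haarAddCircle)

local instance isProbabilityMeasure_haarUnitAddCircle :
    IsProbabilityMeasure (volume : Measure UnitAddCircle) :=
  inferInstanceAs (IsProbabilityMeasure AddCircle.haarAddCircle)

/-- The side lengths `2πa` and `2π/a` of the fundamental rectangle. -/
noncomputable def side (a : ℝ) : Fin 2 → ℝ := ![2 * Real.pi * a, 2 * Real.pi / a]

theorem side_pos {a : ℝ} (ha : 0 < a) (i : Fin 2) : 0 < side a i := by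
  fin_cases i <;> simp [side] <;> positivity

/-- The projection of the plane onto the standard torus `(ℝ/ℤ)²`. -/
noncomputable def toTorus (a : ℝ) (x : Plane) : UnitAddTorus (Fin 2) :=
  fun i => ((x i / side a i : ℝ) : UnitAddCircle)

/-- The section of `toTorus a` with values in the rectangle `(0, 2πa] × (0, 2π/a]`. -/
noncomputable def torusSection (a : ℝ) (t : UnitAddTorus (Fin 2)) : Plane :=
  WithLp.toLp 2 fun i => side a i * (AddCircle.equivIoc 1 0 (t i) : ℝ)

theorem toTorus_torusSection {a : ℝ} (ha : 0 < a) (t : UnitAddTorus (Fin 2)) :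
    toTorus a (torusSection a t) = t := by
  funext i
  simp only [toTorus, torusSection]
  rw [mul_div_cancel_left₀ _ (side_pos ha i).ne']
  exact AddCircle.coe_equivIoc

theorem period_apply (a : ℝ) (m : ℤ × ℤ) (i : Fin 2) :
    period a m i = side a i * (![(m.1 : ℝ), (m.2 : ℝ)] i) := by
  fin_cases i <;> simp [period, side]

theorem exists_eq_add_period {a : ℝ} (ha : 0 < a) {x y : Plane} (h : toTorus a x = toTorus a y) :
    ∃ m, x = y + period a m := by
  have h1 : ∀ i, ∃ k : ℤ, x i = y i + side a i * k := by
    intro i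
    have hi := congrFun h i
    simp only [toTorus] at hi
    rw [← sub_eq_zero, ← AddCircle.coe_sub, AddCircle.coe_eq_zero_iff] at hi
    obtain ⟨k, hk⟩ := hi
    refine ⟨k, ?_⟩
    have hs := (side_pos ha i).ne'
    rw [zsmul_eq_mul, mul_one, ← sub_div, eq_div_iff hs] at hk
    linarith
  choose k hk using h1
  refine ⟨(k 0, k 1), ?_⟩
  ext i
  rw [PiLp.add_apply, period_apply, hk i]
  fin_cases i <;> simp

theorem toTorus_add (a : ℝ) (x y : Plane) : toTorus a (x + y) = toTorus a x + toTorus a y := by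
  funext i
  simp [toTorus, add_div]

theorem isOpenQuotientMap_toTorus {a : ℝ} (ha : 0 < a) : IsOpenQuotientMap (toTorus a) := by
  have h1 : IsOpenQuotientMap (fun (y : Fin 2 → ℝ) (i : Fin 2) => ((y i : ℝ) : UnitAddCircle)) :=
    IsOpenQuotientMap.piMap fun _ => QuotientAddGroup.isOpenQuotientMap_mk
  let e : Plane ≃ₜ (Fin 2 → ℝ) :=
    { toFun := fun x i => x i / side a i
      invFun := fun y => WithLp.toLp 2 fun i => side a i * y i
      left_inv := fun x => by ext i; simp [mul_div_cancel₀ _ (side_pos ha i).ne']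
      right_inv := fun y => by funext i; simp [(side_pos ha i).ne']
      continuous_toFun := by fun_prop
      continuous_invFun := by fun_prop }
  exact h1.comp e.isOpenQuotientMap

theorem det_side {a : ℝ} (ha : 0 < a) : (Matrix.diagonal (side a)).det = 4 * Real.pi ^ 2 := by
  rw [Matrix.det_diagonal, Fin.prod_univ_two]
  simp only [side, Matrix.cons_val_zero, Matrix.cons_val_one]
  field_simp
  ring

theorem measurableSet_cell (a : ℝ) : MeasurableSet (cell a) := by
  have h0 : Measurable fun x : Plane => x 0 := by fun_prop
  have h1 : Measurable fun x : Plane => x 1 := by fun_prop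
  exact (h0 measurableSet_Ico).inter (h1 measurableSet_Ico)

/-- The torus of the theorem is the standard torus `(ℝ/ℤ)²`, up to the total mass `4π²`. -/
theorem measurePreserving_torusSection {a : ℝ} (ha : 0 < a) :
    MeasurePreserving (torusSection a) volume
      ((ENNReal.ofReal (4 * Real.pi ^ 2))⁻¹ • torusMeasure a) := by
  set cube : Set (Fin 2 → ℝ) := {x | ∀ i, x i ∈ Set.Ioc ((0 : Fin 2 → ℝ) i) ((0 : Fin 2 → ℝ) i + 1)}
    with hcube
  have hcubem : MeasurableSet cube := MeasurableSet.univ_pi' fun i => measurableSet_Ioc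
  -- the section as a composition
  have h1 : MeasurePreserving (fun t : UnitAddTorus (Fin 2) =>
      (fun i => (AddCircle.equivIoc 1 0 (t i) : ℝ))) volume (volume.restrict cube) := by
    have hv : MeasurePreserving (Subtype.val : cube → (Fin 2 → ℝ))
        (Measure.comap Subtype.val volume) (volume.restrict cube) :=
      ⟨measurable_subtype_coe, map_comap_subtype_coe hcubem volume⟩
    exact hv.comp (UnitAddTorus.measurePreserving_equivPiIoc (0 : Fin 2 → ℝ))
  set D : (Fin 2 → ℝ) → (Fin 2 → ℝ) := fun y i => side a i * y i with hD
  have hDm : Measurable D := by fun_prop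
  have hdet : (Matrix.diagonal (side a)).det ≠ 0 := by rw [det_side ha]; positivity
  have hDmap : Measure.map D volume = (ENNReal.ofReal (4 * Real.pi ^ 2))⁻¹ • volume := by
    have h := Real.smul_map_diagonal_volume_pi hdet
    rw [det_side ha, abs_of_pos (by positivity)] at h
    have e : (Matrix.toLin' (Matrix.diagonal (side a)) : (Fin 2 → ℝ) → (Fin 2 → ℝ)) = D := by
      funext y i
      simp [hD, Matrix.toLin'_apply, Matrix.mulVec_diagonal]
    rw [e] at h
    have hpos : ENNReal.ofReal (4 * Real.pi ^ 2) ≠ 0 := by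
      rw [Ne, ENNReal.ofReal_eq_zero, not_le]; positivity
    calc Measure.map D volume = (ENNReal.ofReal (4 * Real.pi ^ 2))⁻¹ •
          (ENNReal.ofReal (4 * Real.pi ^ 2) • Measure.map D volume) := by
          rw [smul_smul, ENNReal.inv_mul_cancel hpos ENNReal.ofReal_ne_top, one_smul]
      _ = _ := by rw [h]
  set box : Set (Fin 2 → ℝ) := Set.pi Set.univ fun i => Set.Ioc (0 : ℝ) (side a i) with hbox
  set box' : Set (Fin 2 → ℝ) := Set.pi Set.univ fun i => Set.Ico (0 : ℝ) (side a i) with hbox'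
  have hboxm : MeasurableSet box := MeasurableSet.univ_pi fun i => measurableSet_Ioc
  have hpre : D ⁻¹' box = cube := by
    ext y
    simp only [hbox, hcube, hD, Set.mem_preimage, Set.mem_pi, Set.mem_univ, true_implies,
      Set.mem_Ioc, Set.mem_ofPred_eq, Pi.zero_apply, zero_add]
    refine forall_congr' fun i => ?_
    have hs := side_pos ha i
    constructor
    · rintro ⟨h1, h2⟩; exact ⟨by nlinarith [pos_of_mul_pos_right h1 hs.le], by nlinarith⟩
    · rintro ⟨h1, h2⟩; exact ⟨by positivity, by nlinarith⟩
  have h2 : MeasurePreserving D (volume.restrict cube)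
      ((ENNReal.ofReal (4 * Real.pi ^ 2))⁻¹ • volume.restrict box') := by
    refine ⟨hDm, ?_⟩
    rw [← hpre, ← Measure.restrict_map hDm hboxm, hDmap, Measure.restrict_smul]
    congr 1
    refine Measure.restrict_congr_set ?_
    exact (Measure.univ_pi_Ioc_ae_eq_Icc (μ := fun _ : Fin 2 => (volume : Measure ℝ))).trans
      (Measure.univ_pi_Ico_ae_eq_Icc (μ := fun _ : Fin 2 => (volume : Measure ℝ))).symm
  have h3 : MeasurePreserving (WithLp.toLp 2 : (Fin 2 → ℝ) → Plane) (volume.restrict box')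
      (torusMeasure a) := by
    have hc : (WithLp.toLp 2 : (Fin 2 → ℝ) → Plane) ⁻¹' cell a = box' := by
      ext y
      simp [cell, hbox', side, Fin.forall_fin_two]
    have hp := (PiLp.volume_preserving_toLp (Fin 2)).restrict_preimage (measurableSet_cell a)
    rwa [hc] at hp
  have h4 : MeasurePreserving (WithLp.toLp 2 : (Fin 2 → ℝ) → Plane)
      ((ENNReal.ofReal (4 * Real.pi ^ 2))⁻¹ • volume.restrict box')
      ((ENNReal.ofReal (4 * Real.pi ^ 2))⁻¹ • torusMeasure a) :=
    ⟨h3.measurable, by rw [Measure.map_smul, h3.map_eq]⟩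
  exact (h4.comp h2).comp h1

instance isFiniteMeasure_torusMeasure (a : ℝ) : IsFiniteMeasure (torusMeasure a) := by
  refine ⟨?_⟩
  rw [torusMeasure, Measure.restrict_apply_univ]
  have hsub : cell a ⊆ Metric.closedBall 0 (|2 * Real.pi * a| + |2 * Real.pi / a|) := by
    rintro x ⟨h0, h1⟩
    rw [mem_closedBall_zero_iff, EuclideanSpace.norm_eq]
    refine Real.sqrt_le_iff.mpr ⟨by positivity, ?_⟩
    rw [Fin.sum_univ_two, Real.norm_of_nonneg h0.1, Real.norm_of_nonneg h1.1]
    have e0 : x 0 ≤ |2 * Real.pi * a| := h0.2.le.trans (le_abs_self _)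
    have e1 : x 1 ≤ |2 * Real.pi / a| := h1.2.le.trans (le_abs_self _)
    have f0 := h0.1
    have f1 := h1.1
    nlinarith [mul_nonneg (f0.trans e0) (f1.trans e1)]
  exact (measure_mono hsub).trans_lt measure_closedBall_lt_top

/-- Integrals over the fundamental rectangle as integrals over `(ℝ/ℤ)²`. -/
theorem integral_torusMeasure {a : ℝ} (ha : 0 < a) {g : Plane → ℂ}
    (hg : AEStronglyMeasurable g (torusMeasure a)) :
    ∫ x, g x ∂(torusMeasure a) = (4 * Real.pi ^ 2 : ℝ) * ∫ t, g (torusSection a t) := by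
  have h := measurePreserving_torusSection ha
  have hpos : ENNReal.ofReal (4 * Real.pi ^ 2) ≠ 0 := by
    rw [Ne, ENNReal.ofReal_eq_zero, not_le]; positivity
  have h1 := integral_map (μ := volume) h.measurable.aemeasurable (f := g) (by
    rw [h.map_eq]; exact hg.smul_measure _)
  rw [h.map_eq, integral_smul_measure, ENNReal.toReal_inv,
    ENNReal.toReal_ofReal (by positivity)] at h1
  rw [← h1, Complex.real_smul, ← mul_assoc, ← Complex.ofReal_mul,
    mul_inv_cancel₀ (by positivity), Complex.ofReal_one, one_mul]

theorem mFourier_toTorus {a : ℝ} (ha : 0 < a) (k : Fin 2 → ℤ) (x : Plane) :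
    UnitAddTorus.mFourier k (toTorus a x) = (2 * Real.pi : ℝ) * expo a (k 0, k 1) x := by
  have hpi : (Real.pi : ℂ) ≠ 0 := by exact_mod_cast Real.pi_ne_zero
  have ha' : (a : ℂ) ≠ 0 := by exact_mod_cast ha.ne'
  simp only [UnitAddTorus.mFourier, ContinuousMap.coe_mk, Fin.prod_univ_two, toTorus,
    fourier_coe_apply, expo]
  rw [← Complex.exp_add, ← mul_assoc, ← Complex.ofReal_mul,
    mul_one_div_cancel (by positivity), Complex.ofReal_one, one_mul]
  congr 1
  simp only [side, freq, PiLp.inner_apply, Fin.sum_univ_two, Matrix.cons_val_zero,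
    Matrix.cons_val_one, RCLike.inner_apply, conj_trivial]
  push_cast
  field_simp

theorem continuous_expo (a : ℝ) (m : ℤ × ℤ) : Continuous (expo a m) := by
  unfold expo; fun_prop

theorem coeff_eq_mFourierCoeff {a : ℝ} (ha : 0 < a) {ψ : Plane → ℂ}
    (hψ : AEStronglyMeasurable ψ (torusMeasure a)) (k : Fin 2 → ℤ) :
    coeff a ψ (k 0, k 1)
      = (2 * Real.pi : ℝ) * UnitAddTorus.mFourierCoeff (fun t => ψ (torusSection a t)) k := by
  unfold coeff UnitAddTorus.mFourierCoeff
  rw [integral_torusMeasure ha (g := fun x => ψ x * conj (expo a (k 0, k 1) x)) (hψ.mul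
    (Complex.continuous_conj.comp (continuous_expo a _)).aestronglyMeasurable),
    ← integral_const_mul, ← integral_const_mul]
  refine integral_congr_ae (Eventually.of_forall fun t => ?_)
  simp only
  rw [UnitAddTorus.mFourier_neg, smul_eq_mul]
  nth_rw 3 [← toTorus_torusSection ha t]
  rw [mFourier_toTorus ha, map_mul, Complex.conj_ofReal]
  push_cast
  ring

/-- Parseval's identity. -/
theorem hasSum_conj_coeff_mul_coeff {a : ℝ} (ha : 0 < a) {ψ φ : Plane → ℂ}
    (hψ : MemLp ψ 2 (torusMeasure a)) (hφ : MemLp φ 2 (torusMeasure a)) :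
    HasSum (fun m => conj (coeff a ψ m) * coeff a φ m)
      (∫ x, conj (ψ x) * φ x ∂(torusMeasure a)) := by
  have h := measurePreserving_torusSection ha
  have hL : ∀ {g : Plane → ℂ}, MemLp g 2 (torusMeasure a) →
      MemLp (fun t => g (torusSection a t)) 2 volume := by
    intro g hg
    refine MemLp.comp_measurePreserving (hg.smul_measure ?_) h
    rw [ENNReal.inv_ne_top, Ne, ENNReal.ofReal_eq_zero, not_le]; positivity
  have h1 := UnitAddTorus.hasSum_prod_mFourierCoeff ((hL hψ).toLp _) ((hL hφ).toLp _)
  have hc : ∀ {g : Plane → ℂ} (hg : MemLp g 2 (torusMeasure a)) (k : Fin 2 → ℤ),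
      UnitAddTorus.mFourierCoeff ((hL hg).toLp _) k
        = UnitAddTorus.mFourierCoeff (fun t => g (torusSection a t)) k := fun hg k =>
    integral_congr_ae (((hL hg).coeFn_toLp).mono fun t ht => by simp only [ht])
  simp only [hc hψ, hc hφ] at h1
  have hi : ∫ t, conj ((hL hψ).toLp _ t) * (hL hφ).toLp _ t
      = ∫ t, conj (ψ (torusSection a t)) * φ (torusSection a t) :=
    integral_congr_ae (by
      filter_upwards [(hL hψ).coeFn_toLp, (hL hφ).coeFn_toLp] with t h1 h2
      rw [h1, h2])
  rw [hi] at h1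
  rw [integral_torusMeasure ha (g := fun x => conj (ψ x) * φ x)
      ((Complex.continuous_conj.comp_aestronglyMeasurable hψ.1).mul hφ.1),
    ← (finTwoArrowEquiv ℤ).hasSum_iff]
  refine (h1.mul_left ((4 * Real.pi ^ 2 : ℝ) : ℂ)).congr_fun fun k => ?_
  change conj (coeff a ψ (k 0, k 1)) * coeff a φ (k 0, k 1) = _
  rw [coeff_eq_mFourierCoeff ha hψ.1, coeff_eq_mFourierCoeff ha hφ.1, map_mul, Complex.conj_ofReal]
  push_cast
  ring

theorem comp_torusSection_toTorus {a : ℝ} (ha : 0 < a) {g : Plane → ℂ}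
    (hper : ∀ (m : ℤ × ℤ) (x : Plane), g (x + period a m) = g x) (x : Plane) :
    g (torusSection a (toTorus a x)) = g x := by
  obtain ⟨m, hm⟩ := exists_eq_add_period ha (toTorus_torusSection ha (toTorus a x))
  rw [hm, hper]

/-- Translation invariance of the integral of a periodic function over the fundamental rectangle, by
invariance of the Haar measure of the torus. -/
theorem integral_comp_add_torusMeasure {a : ℝ} (ha : 0 < a) {g : Plane → ℂ} (hg : Continuous g)
    (hper : ∀ (m : ℤ × ℤ) (x : Plane), g (x + period a m) = g x) (v : Plane) :
    ∫ x, g (x + v) ∂(torusMeasure a) = ∫ x, g x ∂(torusMeasure a) := by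
  rw [integral_torusMeasure ha (g := fun x => g (x + v))
    (hg.comp (continuous_add_const v)).aestronglyMeasurable,
    integral_torusMeasure ha hg.aestronglyMeasurable]
  congr 1
  rw [← integral_add_right_eq_self (fun t => g (torusSection a t)) (toTorus a v)]
  refine integral_congr_ae (Eventually.of_forall fun t => ?_)
  simp only
  rw [← comp_torusSection_toTorus ha hper (torusSection a t + v), toTorus_add,
    toTorus_torusSection ha]

/-- A continuous periodic function with absolutely summable Fourier coefficients is the sum of its
Fourier series. -/
theorem hasSum_coeff_mul_expo {a : ℝ} (ha : 0 < a) {f : Plane → ℂ} (hf : Continuous f)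
    (hper : ∀ (m : ℤ × ℤ) (x : Plane), f (x + period a m) = f x)
    (hsum : Summable (coeff a f)) (x : Plane) :
    HasSum (fun m => coeff a f m * expo a m x) (f x) := by
  have hpi : ((2 * Real.pi : ℝ) : ℂ) ≠ 0 := by
    exact_mod_cast (by positivity : (2 * Real.pi : ℝ) ≠ 0)
  let F : C(UnitAddTorus (Fin 2), ℂ) :=
    ⟨fun t => f (torusSection a t), by
      rw [← (isOpenQuotientMap_toTorus ha).continuous_comp_iff]
      have : (fun t => f (torusSection a t)) ∘ toTorus a = f :=
        funext fun x => comp_torusSection_toTorus ha hper x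
      rw [this]
      exact hf⟩
  have hc : ∀ k : Fin 2 → ℤ, coeff a f (k 0, k 1)
      = (2 * Real.pi : ℝ) * UnitAddTorus.mFourierCoeff F k :=
    fun k => coeff_eq_mFourierCoeff ha hf.aestronglyMeasurable k
  have hF : Summable (UnitAddTorus.mFourierCoeff F) := by
    have h1 : Summable fun k => coeff a f (finTwoArrowEquiv ℤ k) :=
      (finTwoArrowEquiv ℤ).summable_iff.mpr hsum
    refine (h1.mul_left ((2 * Real.pi : ℝ) : ℂ)⁻¹).congr fun k => ?_
    change ((2 * Real.pi : ℝ) : ℂ)⁻¹ * coeff a f (k 0, k 1) = _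
    rw [hc, inv_mul_cancel_left₀ hpi]
  have h2 := UnitAddTorus.hasSum_mFourier_series_apply_of_summable hF (toTorus a x)
  have h3 : F (toTorus a x) = f x := comp_torusSection_toTorus ha hper x
  rw [h3] at h2
  rw [← (finTwoArrowEquiv ℤ).hasSum_iff]
  refine h2.congr_fun fun k => ?_
  change coeff a f (k 0, k 1) * expo a (k 0, k 1) x = _
  rw [hc, mFourier_toTorus ha, smul_eq_mul]
  ring

end TorusTransfer

/-! ### Test functions -/

theorem exists_norm_le_of_periodic {a : ℝ} (ha : 0 < a) {g : Plane → ℂ} (hg : Continuous g)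
    (hper : ∀ (m : ℤ × ℤ) (x : Plane), g (x + period a m) = g x) : ∃ C : ℝ, ∀ x, ‖g x‖ ≤ C := by
  have hc : Continuous fun t => g (torusSection a t) := by
    rw [← (isOpenQuotientMap_toTorus ha).continuous_comp_iff]
    have : (fun t => g (torusSection a t)) ∘ toTorus a = g :=
      funext fun x => comp_torusSection_toTorus ha hper x
    rw [this]
    exact hg
  obtain ⟨C, hC⟩ := (isCompact_range hc).isBounded.exists_norm_le
  exact ⟨C, fun x => comp_torusSection_toTorus ha hper x ▸ hC _ ⟨toTorus a x, rfl⟩⟩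

theorem integrable_of_periodic {a : ℝ} (ha : 0 < a) {g : Plane → ℂ} (hg : Continuous g)
    (hper : ∀ (m : ℤ × ℤ) (x : Plane), g (x + period a m) = g x) :
    Integrable g (torusMeasure a) := by
  obtain ⟨C, hC⟩ := exists_norm_le_of_periodic ha hg hper
  exact Integrable.of_bound hg.aestronglyMeasurable C (Eventually.of_forall hC)

theorem inner_freq_period {a : ℝ} (ha : 0 < a) (m k : ℤ × ℤ) :
    inner ℝ (freq a m) (period a k) = 2 * Real.pi * ((m.1 * k.1 + m.2 * k.2 : ℤ) : ℝ) := by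
  simp only [freq, period, PiLp.inner_apply, Fin.sum_univ_two, Matrix.cons_val_zero,
    Matrix.cons_val_one, RCLike.inner_apply, conj_trivial]
  push_cast
  field_simp

theorem isTestFunction_expo {a : ℝ} (ha : 0 < a) (m : ℤ × ℤ) : IsTestFunction a (expo a m) := by
  refine ⟨?_, fun k x => ?_⟩
  · unfold expo
    have h1 : ContDiff ℝ ∞ fun x : Plane => inner ℝ (freq a m) x := contDiff_const.inner ℝ contDiff_id
    have h2 : ContDiff ℝ ∞ fun x : Plane => ((inner ℝ (freq a m) x : ℝ) : ℂ) :=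
      Complex.ofRealCLM.contDiff.comp h1
    exact contDiff_const.mul ((contDiff_const.mul h2).cexp)
  · unfold expo
    congr 1
    rw [inner_add_right, inner_freq_period ha, Complex.exp_eq_exp_iff_exists_int]
    exact ⟨m.1 * k.1 + m.2 * k.2, by push_cast; ring⟩

theorem expo_mul_conj_expo (a : ℝ) (m k : ℤ × ℤ) (x : Plane) :
    expo a m x * conj (expo a k x) = (1 / (2 * Real.pi) : ℝ) * expo a (m - k) x := by
  have hf : freq a (m - k) = freq a m - freq a k := by
    ext i
    fin_cases i <;> simp [freq, sub_div, mul_sub]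
  simp only [expo, map_mul, Complex.conj_ofReal, ← Complex.exp_conj, Complex.conj_I]
  rw [hf, inner_sub_left]
  push_cast
  rw [mul_sub, Complex.exp_sub, div_eq_mul_inv (Complex.exp _) (Complex.exp _), ← Complex.exp_neg,
    neg_mul]
  ring

theorem conj_expo (a : ℝ) (m : ℤ × ℤ) (x : Plane) : conj (expo a m x) = expo a (-m) x := by
  have hf : freq a (-m) = -freq a m := by
    ext i
    fin_cases i <;> simp [freq, neg_div]
  simp only [expo, map_mul, Complex.conj_ofReal, ← Complex.exp_conj, Complex.conj_I]
  rw [hf, inner_neg_left]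
  push_cast
  rw [neg_mul, mul_neg]

theorem norm_expo (a : ℝ) (m : ℤ × ℤ) (x : Plane) : ‖expo a m x‖ = 1 / (2 * Real.pi) := by
  rw [expo, norm_mul, mul_comm Complex.I, Complex.norm_exp_ofReal_mul_I, mul_one,
    Complex.norm_real, Real.norm_of_nonneg (by positivity)]

theorem isTestFunction_mul {a : ℝ} {f g : Plane → ℂ} (hf : IsTestFunction a f)
    (hg : IsTestFunction a g) : IsTestFunction a fun x => f x * g x :=
  ⟨hf.1.mul hg.1, fun m x => by simp only [hf.2 m x, hg.2 m x]⟩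

theorem isTestFunction_fderiv {a : ℝ} {f : Plane → ℂ} (hf : IsTestFunction a f) (v : Plane) :
    IsTestFunction a fun x => fderiv ℝ f x v := by
  refine ⟨(hf.1.fderiv_right (m := ∞) (by simp)).clm_apply contDiff_const, fun m x => ?_⟩
  have h : (fun y => f (y + period a m)) = f := funext fun y => hf.2 m y
  have h2 := fderiv_comp_add_right (𝕜 := ℝ) (f := f) (x := x) (period a m)
  rw [h] at h2
  change fderiv ℝ f (x + period a m) v = fderiv ℝ f x v
  rw [← h2]

/-- A derivative of a periodic function has mean zero: the integral of a translate does not depend on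
the translation, and may be differentiated under the integral sign. -/
theorem integral_fderiv_eq_zero {a : ℝ} (ha : 0 < a) {g : Plane → ℂ} (hg : IsTestFunction a g)
    (v : Plane) : ∫ x, fderiv ℝ g x v ∂(torusMeasure a) = 0 := by
  have hd := isTestFunction_fderiv hg v
  obtain ⟨C, hC⟩ := exists_norm_le_of_periodic ha hd.1.continuous hd.2
  have hgc := hg.1.continuous
  have hdiff : ∀ (x : Plane) (h : ℝ),
      HasDerivAt (fun h : ℝ => g (x + h • v)) (fderiv ℝ g (x + h • v) v) h := by
    intro x h
    have h1 : HasDerivAt (fun h : ℝ => x + h • v) v h := by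
      simpa using ((hasDerivAt_id h).smul_const v).const_add x
    exact ((hg.1.differentiable (by simp)) _).hasFDerivAt.comp_hasDerivAt h h1
  have key := (hasDerivAt_integral_of_dominated_loc_of_deriv_le (μ := torusMeasure a)
    (F := fun (h : ℝ) x => g (x + h • v)) (F' := fun (h : ℝ) x => fderiv ℝ g (x + h • v) v)
    (x₀ := (0 : ℝ)) (s := Set.univ) (bound := fun _ => C) univ_mem
    (Eventually.of_forall fun h => (hgc.comp (continuous_add_const _)).aestronglyMeasurable)
    (by simpa using integrable_of_periodic ha hgc hg.2)
    (hd.1.continuous.comp (continuous_add_const _)).aestronglyMeasurable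
    (Eventually.of_forall fun x h _ => hC _) (integrable_const C)
    (Eventually.of_forall fun x h _ => hdiff x h)).2
  have hconst : (fun h : ℝ => ∫ x, g (x + h • v) ∂(torusMeasure a))
      = fun _ => ∫ x, g x ∂(torusMeasure a) :=
    funext fun h => integral_comp_add_torusMeasure ha hgc hg.2 _
  rw [hconst] at key
  have := key.unique (hasDerivAt_const _ _)
  simpa using this

theorem fderiv_expo (a : ℝ) (m : ℤ × ℤ) (x v : Plane) :
    fderiv ℝ (expo a m) x v = Complex.I * ((inner ℝ (freq a m) v : ℝ) : ℂ) * expo a m x := by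
  have h1 : HasFDerivAt (fun x : Plane => (inner ℝ (freq a m) x : ℝ))
      (innerSL ℝ (freq a m)) x := (innerSL ℝ (freq a m)).hasFDerivAt
  have h2 := (((Complex.ofRealCLM.hasFDerivAt.comp x h1).const_mul Complex.I).cexp).const_mul
    ((1 / (2 * Real.pi) : ℝ) : ℂ)
  have h3 : HasFDerivAt (expo a m) _ x := h2
  rw [h3.fderiv]
  simp only [expo, smul_apply, ContinuousLinearMap.comp_apply,
    innerSL_apply_apply, Complex.ofRealCLM_apply, smul_eq_mul, Function.comp_apply]
  ring

theorem coeff_fderiv {a : ℝ} (ha : 0 < a) {f : Plane → ℂ} (hf : IsTestFunction a f) (v : Plane)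
    (m : ℤ × ℤ) :
    coeff a (fun x => fderiv ℝ f x v) m
      = Complex.I * ((inner ℝ (freq a m) v : ℝ) : ℂ) * coeff a f m := by
  have he := isTestFunction_expo ha (-m)
  have hfe := isTestFunction_mul hf he
  have hde := isTestFunction_mul (isTestFunction_fderiv hf v) he
  have h0 := integral_fderiv_eq_zero ha hfe v
  have hin : freq a (-m) = -freq a m := by
    ext i
    fin_cases i <;> simp [freq, neg_div]
  have h1 : ∀ x, fderiv ℝ (fun x => f x * expo a (-m) x) x v
      = fderiv ℝ f x v * expo a (-m) x
        - Complex.I * ((inner ℝ (freq a m) v : ℝ) : ℂ) * (f x * expo a (-m) x) := by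
    intro x
    rw [fderiv_fun_mul ((hf.1.differentiable (by simp)) x) ((he.1.differentiable (by simp)) x)]
    simp only [add_apply, smul_apply, smul_eq_mul,
      fderiv_expo, hin, inner_neg_left]
    push_cast
    ring
  simp only [h1] at h0
  rw [integral_sub (integrable_of_periodic ha hde.1.continuous hde.2)
    ((integrable_of_periodic ha hfe.1.continuous hfe.2).const_mul _),
    integral_const_mul, sub_eq_zero] at h0
  simp only [coeff, conj_expo]
  exact h0

/-- The operator `1 - Δ` on functions of the plane. -/
noncomputable def oneSubLaplacian (f : Plane → ℂ) (x : Plane) : ℂ :=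
  f x - ∑ i : Fin 2, fderiv ℝ (fun y => fderiv ℝ f y (EuclideanSpace.single i 1)) x
    (EuclideanSpace.single i 1)

theorem isTestFunction_oneSubLaplacian {a : ℝ} {f : Plane → ℂ} (hf : IsTestFunction a f) :
    IsTestFunction a (oneSubLaplacian f) := by
  have h := fun i : Fin 2 => isTestFunction_fderiv
    (isTestFunction_fderiv hf (EuclideanSpace.single i 1)) (EuclideanSpace.single i 1)
  refine ⟨hf.1.sub (ContDiff.sum fun i _ => (h i).1), fun m x => ?_⟩
  simp only [oneSubLaplacian]
  rw [hf.2 m x, Finset.sum_congr rfl fun i _ => (h i).2 m x]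

theorem coeff_oneSubLaplacian {a : ℝ} (ha : 0 < a) {f : Plane → ℂ} (hf : IsTestFunction a f)
    (m : ℤ × ℤ) : coeff a (oneSubLaplacian f) m = ((1 + quadForm a m : ℝ) : ℂ) * coeff a f m := by
  have h := fun i : Fin 2 => isTestFunction_fderiv
    (isTestFunction_fderiv hf (EuclideanSpace.single i 1)) (EuclideanSpace.single i 1)
  have he := isTestFunction_expo ha (-m)
  have hi : ∀ {g : Plane → ℂ}, IsTestFunction a g →
      Integrable (fun x => g x * expo a (-m) x) (torusMeasure a) := fun hg =>
    integrable_of_periodic ha (isTestFunction_mul hg he).1.continuous (isTestFunction_mul hg he).2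
  have hlin : coeff a (oneSubLaplacian f) m = coeff a f m - ∑ i : Fin 2,
      coeff a (fun x => fderiv ℝ (fun y => fderiv ℝ f y (EuclideanSpace.single i 1)) x
    (EuclideanSpace.single i 1)) m := by
    simp only [coeff, conj_expo, oneSubLaplacian, sub_mul, Finset.sum_mul]
    rw [integral_sub (hi hf) (integrable_finsetSum _ fun i _ => hi (h i)),
      integral_finsetSum _ fun i _ => hi (h i)]
  rw [hlin, Fin.sum_univ_two, coeff_fderiv ha (isTestFunction_fderiv hf _), coeff_fderiv ha hf,
    coeff_fderiv ha (isTestFunction_fderiv hf _), coeff_fderiv ha hf]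
  have e0 : inner ℝ (freq a m) (EuclideanSpace.single 0 1) = (m.1 : ℝ) / a := by
    rw [real_inner_comm, EuclideanSpace.inner_single_left]; simp [freq]
  have e1 : inner ℝ (freq a m) (EuclideanSpace.single 1 1) = a * (m.2 : ℝ) := by
    rw [real_inner_comm, EuclideanSpace.inner_single_left]; simp [freq]
  rw [e0, e1, quadForm]
  push_cast
  linear_combination (-(m.1 / a : ℂ) ^ 2 - (a * m.2 : ℂ) ^ 2) * coeff a f m * Complex.I_sq

/-- The Fourier coefficients of a test function decay faster than any power, as `1 - Δ` multiplies
them by `1 + |ξ|²`. -/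
theorem exists_norm_coeff_le {a : ℝ} (ha : 0 < a) {f : Plane → ℂ} (hf : IsTestFunction a f)
    (N : ℕ) : ∃ C : ℝ, 0 ≤ C ∧ ∀ m, ‖coeff a f m‖ * (1 + quadForm a m) ^ N ≤ C := by
  induction N generalizing f with
  | zero =>
    refine ⟨∫ x, ‖f x‖ * (1 / (2 * Real.pi)) ∂(torusMeasure a),
      integral_nonneg fun x => by positivity, fun m => ?_⟩
    rw [pow_zero, mul_one]
    refine (norm_integral_le_integral_norm _).trans (le_of_eq ?_)
    refine integral_congr_ae (Eventually.of_forall fun x => ?_)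
    simp only [norm_mul, RCLike.norm_conj, norm_expo]
  | succ N ih =>
    obtain ⟨C, hC, h⟩ := ih (isTestFunction_oneSubLaplacian hf)
    refine ⟨C, hC, fun m => ?_⟩
    have h0 : 0 ≤ 1 + quadForm a m := by linarith [quadForm_nonneg a m]
    have := h m
    rw [coeff_oneSubLaplacian ha hf, norm_mul, Complex.norm_real, Real.norm_of_nonneg h0] at this
    rw [pow_succ]
    linarith

theorem summable_one_add_quadForm {a : ℝ} (ha : 0 < a) :
    Summable fun m : ℤ × ℤ => ((1 + quadForm a m) ^ 2)⁻¹ := by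
  have h1 : ∀ c : ℝ, 0 < c → Summable fun k : ℤ => (1 + c * (k : ℝ) ^ 2)⁻¹ := by
    intro c hc
    have h2 : Summable fun k : ℤ => c⁻¹ * |(k : ℝ)| ^ (-2 : ℝ) :=
      (Real.summable_abs_int_rpow (by norm_num)).mul_left _
    refine (h2.of_norm_bounded_eventually ?_)
    rw [Filter.eventually_cofinite]
    refine (Set.finite_singleton (0 : ℤ)).subset fun k hk => ?_
    by_contra hk0
    refine hk ?_
    have hk1 : (k : ℝ) ≠ 0 := by exact_mod_cast hk0
    rw [Real.norm_of_nonneg (by positivity), Real.rpow_neg (abs_nonneg _),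
      show (2 : ℝ) = ((2 : ℕ) : ℝ) by norm_num, Real.rpow_natCast, sq_abs, ← mul_inv]
    have : 0 < (k : ℝ) ^ 2 := by positivity
    gcongr
    linarith
  have h2 := (h1 (1 / a ^ 2) (by positivity)).mul_of_nonneg (h1 (a ^ 2) (by positivity))
    (fun _ => by positivity) (fun _ => by positivity)
  refine Summable.of_nonneg_of_le (fun m => by positivity) (fun m => ?_) h2
  rw [← mul_inv]
  have e1 : 0 ≤ 1 / a ^ 2 * (m.1 : ℝ) ^ 2 := by positivity
  have e2 : 0 ≤ a ^ 2 * (m.2 : ℝ) ^ 2 := by positivity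
  have e3 : quadForm a m = 1 / a ^ 2 * (m.1 : ℝ) ^ 2 + a ^ 2 * (m.2 : ℝ) ^ 2 := by
    rw [quadForm]; ring
  gcongr
  rw [e3]
  nlinarith [mul_nonneg e1 e2]

theorem summable_norm_coeff {a : ℝ} (ha : 0 < a) {f : Plane → ℂ} (hf : IsTestFunction a f) :
    Summable fun m => ‖coeff a f m‖ := by
  obtain ⟨C, hC, h⟩ := exists_norm_coeff_le ha hf 2
  refine Summable.of_nonneg_of_le (fun m => norm_nonneg _) (fun m => ?_)
    ((summable_one_add_quadForm ha).mul_left C)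
  have h0 : 0 < 1 + quadForm a m := by linarith [quadForm_nonneg a m]
  rw [← div_eq_mul_inv, le_div_iff₀ (by positivity)]
  exact h m

/-- The Fourier series of a test function may be integrated term by term against an integrable
function. -/
theorem hasSum_coeff_mul_integral {a : ℝ} (ha : 0 < a) {f : Plane → ℂ} (hf : IsTestFunction a f)
    {ρ : Plane → ℂ} (hρ : Integrable ρ (torusMeasure a)) :
    HasSum (fun m => coeff a f m * ∫ x, expo a m x * ρ x ∂(torusMeasure a))
      (∫ x, f x * ρ x ∂(torusMeasure a)) := by
  have hs := summable_norm_coeff ha hf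
  have hi : ∀ m, Integrable (fun x => coeff a f m * (expo a m x * ρ x)) (torusMeasure a) := by
    intro m
    refine (hρ.bdd_mul (c := 1 / (2 * Real.pi)) (continuous_expo a m).aestronglyMeasurable
      (Eventually.of_forall fun x => (norm_expo a m x).le)).const_mul _
  have hn : ∀ m, ∫ x, ‖coeff a f m * (expo a m x * ρ x)‖ ∂(torusMeasure a)
      = ‖coeff a f m‖ * (1 / (2 * Real.pi) * ∫ x, ‖ρ x‖ ∂(torusMeasure a)) := by
    intro m
    rw [← integral_const_mul, ← integral_const_mul]
    simp only [norm_mul, norm_expo]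
  have key := hasSum_integral_of_summable_integral_norm hi (by
    simp only [hn]; exact hs.mul_right _)
  have e1 : ∀ x, ∑' m, coeff a f m * (expo a m x * ρ x) = f x * ρ x := by
    intro x
    have := (hasSum_coeff_mul_expo ha hf.1.continuous hf.2 hs.of_norm x).mul_right (ρ x)
    rw [← this.tsum_eq]
    exact tsum_congr fun m => by ring
  simp only [e1, integral_const_mul] at key
  exact key

/-! ### Equidistribution of concentrated functions -/

theorem quadForm_neg (a : ℝ) (m : ℤ × ℤ) : quadForm a (-m) = quadForm a m := by
  simp [quadForm]

theorem coeff_expo_mul (a : ℝ) (ψ : Plane → ℂ) (z m : ℤ × ℤ) :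
    coeff a (fun x => expo a z x * ψ x) m = (1 / (2 * Real.pi) : ℝ) * coeff a ψ (m - z) := by
  unfold coeff
  rw [← integral_const_mul]
  refine integral_congr_ae (Eventually.of_forall fun x => ?_)
  have h1 := expo_mul_conj_expo a z m x
  simp only
  rw [mul_right_comm, h1, conj_expo, neg_sub]
  ring

theorem memLp_expo_mul {a : ℝ} {ψ : Plane → ℂ} (hψ : MemLp ψ 2 (torusMeasure a)) (z : ℤ × ℤ) :
    MemLp (fun x => expo a z x * ψ x) 2 (torusMeasure a) := by
  have h : MemLp (expo a z) ⊤ (torusMeasure a) :=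
    memLp_top_of_bound (continuous_expo a z).aestronglyMeasurable (1 / (2 * Real.pi))
      (Eventually.of_forall fun x => (norm_expo a z x).le)
  exact MemLp.mul (p := ⊤) (q := 2) (r := 2) hψ h

theorem hasSum_norm_coeff_sq {a : ℝ} (ha : 0 < a) {ψ : Plane → ℂ}
    (hψ : MemLp ψ 2 (torusMeasure a)) :
    HasSum (fun m => ‖coeff a ψ m‖ ^ 2) (∫ x, ‖ψ x‖ ^ 2 ∂(torusMeasure a)) := by
  have h := hasSum_conj_coeff_mul_coeff ha hψ hψ
  simp only [Complex.conj_mul', ← Complex.ofReal_pow, integral_complex_ofReal] at h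
  exact_mod_cast h

/-- Equidistribution of a function `ψ` of unit norm whose Fourier coefficients are concentrated on a
set `A` without short differences, up to an `ℓ²` error `τ`: only the low frequencies of `f` see the
autocorrelations of `ψ̂`, and these are small. -/
theorem exists_equidistribution_bound {a ε : ℝ} (ha : 0 < a) (hε : 0 < ε) {f : Plane → ℂ}
    (hf : IsTestFunction a f) :
    ∃ C : ℝ, 0 ≤ C ∧ ∀ n τ : ℝ, 1 ≤ n → 0 ≤ τ → ∀ (A : Set (ℤ × ℤ)) (ψ : Plane → ℂ),
      MemLp ψ 2 (torusMeasure a) → ∫ x, ‖ψ x‖ ^ 2 ∂(torusMeasure a) = 1 →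
      (∀ m z : ℤ × ℤ, z ≠ 0 → quadForm a z ≤ n ^ ε → m ∈ A → m + z ∉ A) →
      (∀ F : Finset (ℤ × ℤ), (∀ m ∈ F, m ∉ A) → ∑ m ∈ F, ‖coeff a ψ m‖ ^ 2 ≤ τ ^ 2) →
      ‖(∫ x, f x * ((‖ψ x‖ ^ 2 : ℝ) : ℂ) ∂(torusMeasure a))
        - (1 / (4 * Real.pi ^ 2) : ℝ) * ∫ x, f x ∂(torusMeasure a)‖ ≤ C * (τ + n⁻¹) := by
  classical
  -- the power of `1 + |ξ|²` that beats `n` at the frequencies `|ξ|² > n ^ ε`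
  obtain ⟨N, hN⟩ := exists_nat_ge ε⁻¹
  have hNε : 1 ≤ ε * N := by
    calc 1 = ε * ε⁻¹ := (mul_inv_cancel₀ hε.ne').symm
      _ ≤ ε * N := by gcongr
  have hs1 := summable_norm_coeff ha hf
  have hs2 : Summable fun m => ‖coeff a f m‖ * (1 + quadForm a m) ^ N := by
    obtain ⟨C, hC, h⟩ := exists_norm_coeff_le ha hf (N + 2)
    have h0 : ∀ m, 0 < 1 + quadForm a m := fun m => by linarith [quadForm_nonneg a m]
    refine Summable.of_nonneg_of_le (fun m => by have := h0 m; positivity) (fun m => ?_)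
      ((summable_one_add_quadForm ha).mul_left C)
    have := h0 m
    rw [← div_eq_mul_inv, le_div_iff₀ (by positivity), mul_assoc, ← pow_add]
    exact h m
  have hS1 : 0 ≤ ∑' m, ‖coeff a f m‖ := tsum_nonneg fun m => norm_nonneg _
  have hS2 : 0 ≤ ∑' m, ‖coeff a f m‖ * (1 + quadForm a m) ^ N := tsum_nonneg fun m => by
    have : 0 < 1 + quadForm a m := by linarith [quadForm_nonneg a m]
    positivity
  refine ⟨2 * ∑' m, ‖coeff a f m‖ + ∑' m, ‖coeff a f m‖ * (1 + quadForm a m) ^ N, by positivity,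
    fun n τ hn hτ A ψ hψ hnorm hA ht => ?_⟩
  have hn0 : 0 < n := by linarith
  have hu := hasSum_norm_coeff_sq ha hψ
  rw [hnorm] at hu
  have hρ : Integrable (fun x => ((‖ψ x‖ ^ 2 : ℝ) : ℂ)) (torusMeasure a) :=
    (hψ.integrable_norm_pow (by norm_num)).ofReal
  set I : ℤ × ℤ → ℂ := fun z => ∫ x, expo a z x * ((‖ψ x‖ ^ 2 : ℝ) : ℂ) ∂(torusMeasure a) with hI
  have hpi : 1 / (2 * Real.pi) ≤ 1 := by
    rw [div_le_one (by positivity)]; linarith [Real.pi_gt_three]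
  -- `2π I (z)` is the autocorrelation of the Fourier coefficients of `ψ` at `-z`
  have hI1 : ∀ z, ‖I z‖ ≤ 1 := by
    intro z
    refine (norm_integral_le_integral_norm _).trans ?_
    simp only [norm_mul, norm_expo, Complex.norm_real, norm_pow, norm_norm]
    rw [integral_const_mul, hnorm, mul_one]
    exact hpi
  have hI2 : ∀ z, z ≠ 0 → quadForm a z ≤ n ^ ε → ‖I z‖ ≤ 2 * τ := by
    intro z hz hzn
    have h1 := hasSum_conj_coeff_mul_coeff ha hψ (memLp_expo_mul hψ z)
    have h2 : ∫ x, conj (ψ x) * (expo a z x * ψ x) ∂(torusMeasure a) = I z := by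
      refine integral_congr_ae (Eventually.of_forall fun x => ?_)
      simp only
      rw [mul_left_comm, Complex.conj_mul']
      push_cast
      rfl
    rw [h2] at h1
    simp only [coeff_expo_mul] at h1
    have h3 : HasSum (fun m => conj (coeff a ψ m) * coeff a ψ (m + -z))
        ((2 * Real.pi : ℝ) * I z) := by
      refine (h1.mul_left ((2 * Real.pi : ℝ) : ℂ)).congr_fun fun m => ?_
      rw [← sub_eq_add_neg, mul_left_comm (conj _), ← mul_assoc ((2 * Real.pi : ℝ) : ℂ),
        ← Complex.ofReal_mul, mul_one_div_cancel (by positivity), Complex.ofReal_one, one_mul]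
    have h4 := norm_autocorrelation_le hτ (fun F => sum_le_hasSum F (fun _ _ => by positivity) hu)
      (fun m hm => hA m (-z) (neg_ne_zero.mpr hz) (by rwa [quadForm_neg]) hm) ht h3
    rw [norm_mul, Complex.norm_real, Real.norm_of_nonneg (by positivity)] at h4
    have h5 : 1 * ‖I z‖ ≤ 2 * Real.pi * ‖I z‖ := by
      gcongr
      linarith [Real.pi_gt_three]
    linarith
  have hsum := hasSum_coeff_mul_integral ha hf hρ
  have h0 : coeff a f 0 * I 0 = (1 / (4 * Real.pi ^ 2) : ℝ) * ∫ x, f x ∂(torusMeasure a) := by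
    have he : ∀ x, expo a 0 x = (1 / (2 * Real.pi) : ℝ) := by
      intro x
      have : freq a 0 = 0 := by ext i; fin_cases i <;> simp [freq]
      simp [expo, this]
    have h1 : I 0 = (1 / (2 * Real.pi) : ℝ) := by
      simp only [hI, he]
      rw [integral_const_mul, integral_complex_ofReal, hnorm, Complex.ofReal_one, mul_one]
    have h2 : coeff a f 0 = (1 / (2 * Real.pi) : ℝ) * ∫ x, f x ∂(torusMeasure a) := by
      simp only [coeff, he, Complex.conj_ofReal]
      rw [integral_mul_const, mul_comm]
    rw [h1, h2]
    push_cast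
    field_simp
    ring
  rw [← h0]
  have hsub := hasSum_ite_sub_hasSum hsum 0
  rw [← hsub.tsum_eq]
  have hmaj := ((hs1.hasSum.mul_left (2 * τ)).add (hs2.hasSum.mul_left n⁻¹))
  refine (tsum_of_norm_bounded hmaj fun z => ?_).trans ?_
  · have hq := quadForm_nonneg a z
    have hp1 : 0 ≤ 2 * τ * ‖coeff a f z‖ := by positivity
    have hp2 : 0 ≤ n⁻¹ * (‖coeff a f z‖ * (1 + quadForm a z) ^ N) := by positivity
    split_ifs with hz
    · rw [norm_zero]; positivity
    rw [norm_mul]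
    rcases le_or_gt (quadForm a z) (n ^ ε) with hzn | hzn
    · have := mul_le_mul_of_nonneg_left (hI2 z hz hzn) (norm_nonneg (coeff a f z))
      linarith
    · have h1 : n ≤ (1 + quadForm a z) ^ N := by
        calc n = n ^ (1 : ℝ) := (Real.rpow_one n).symm
          _ ≤ n ^ (ε * N) := Real.rpow_le_rpow_of_exponent_le hn hNε
          _ = (n ^ ε) ^ N := by rw [Real.rpow_mul hn0.le, Real.rpow_natCast]
          _ ≤ _ := by gcongr; linarith
      have h2 : 1 ≤ n⁻¹ * (1 + quadForm a z) ^ N := by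
        rw [inv_mul_eq_div, le_div_iff₀ hn0]; linarith
      calc ‖coeff a f z‖ * ‖I z‖ ≤ ‖coeff a f z‖ * (n⁻¹ * (1 + quadForm a z) ^ N) := by
            gcongr
            exact (hI1 z).trans h2
        _ = n⁻¹ * (‖coeff a f z‖ * (1 + quadForm a z) ^ N) := by ring
        _ ≤ _ := by linarith
  · have hni : 0 ≤ n⁻¹ := by positivity
    nlinarith [mul_nonneg hS1 hni, mul_nonneg hS2 hτ]

/-! ### The potential and the Fourier coefficients of eigenfunctions -/

theorem period_neg (a : ℝ) (m : ℤ × ℤ) : period a (-m) = -period a m := by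
  ext i
  fin_cases i <;> simp [period]

theorem abs_apply_le_norm (x : Plane) (i : Fin 2) : |x i| ≤ ‖x‖ := by
  rw [← Real.norm_eq_abs]; exact PiLp.norm_apply_le x i

/-- A disc contains at most as many translates of a point as its area allows. -/
theorem exists_ncard_period_le {a : ℝ} (ha : 0 < a) :
    ∃ C : ℝ, 0 ≤ C ∧ ∀ (y : Plane) (ρ : ℝ),
      {m : ℤ × ℤ | ‖y + period a m‖ < ρ}.Finite ∧
      ({m : ℤ × ℤ | ‖y + period a m‖ < ρ}.ncard : ℝ) ≤ C * max 1 (ρ ^ 2) := by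
  have hs0 := side_pos ha 0
  have hs1 := side_pos ha 1
  refine ⟨(2 / side a 0 + 1) * (2 / side a 1 + 1), by positivity, fun y ρ => ?_⟩
  set D := max 1 ρ with hD
  have hD1 : 1 ≤ D := le_max_left _ _
  obtain ⟨f0, n0⟩ := finite_ncard_int_abs_le hs0.ne' (y 0) (D := D) (by linarith)
  obtain ⟨f1, n1⟩ := finite_ncard_int_abs_le hs1.ne' (y 1) (D := D) (by linarith)
  have hsub : {m : ℤ × ℤ | ‖y + period a m‖ < ρ} ⊆
      {k : ℤ | |side a 0 * k + y 0| ≤ D} ×ˢ {k : ℤ | |side a 1 * k + y 1| ≤ D} := by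
    intro m hm
    have hm' : ‖y + period a m‖ ≤ D := (show ‖y + period a m‖ < ρ from hm).le.trans (le_max_right _ _)
    have h0 := (abs_apply_le_norm (y + period a m) 0).trans hm'
    have h1 := (abs_apply_le_norm (y + period a m) 1).trans hm'
    rw [PiLp.add_apply, period_apply] at h0 h1
    simp only [Matrix.cons_val_zero, Matrix.cons_val_one] at h0 h1
    rw [add_comm] at h0 h1
    exact ⟨h0, h1⟩
  refine ⟨(f0.prod f1).subset hsub, ?_⟩
  have h1 := (Nat.cast_le (α := ℝ)).mpr (Set.ncard_le_ncard hsub (f0.prod f1))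
  rw [Set.ncard_prod, Nat.cast_mul] at h1
  have hb : ∀ s : ℝ, 0 < s → 2 * D / |s| + 1 ≤ (2 / s + 1) * D := by
    intro s hs
    rw [abs_of_pos hs]
    have : (2 / s + 1) * D = 2 * D / s + D := by ring
    linarith
  have hDD : D * D ≤ max 1 (ρ ^ 2) := by
    rcases le_total 1 ρ with h | h
    · rw [hD, max_eq_right h, ← sq]; exact le_max_right _ _
    · rw [hD, max_eq_left h, one_mul]; exact le_max_left _ _
  calc _ ≤ _ := h1
    _ ≤ ((2 / side a 0 + 1) * D) * ((2 / side a 1 + 1) * D) := by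
      gcongr
      · exact n0.trans (hb _ hs0)
      · exact n1.trans (hb _ hs1)
    _ = (2 / side a 0 + 1) * (2 / side a 1 + 1) * (D * D) := by ring
    _ ≤ _ := by gcongr

/-- Under weak disorder the scatterers that reach a given point, counted with their translates, are
`O(max 1 (r₁ + r₂)²)`. -/
theorem exists_ncard_overlap_le {a : ℝ} (ha : 0 < a) (K : ℝ) :
    ∃ C : ℝ, 0 ≤ C ∧ ∀ (r₁ r₂ : ℝ) (N : ℕ) (w : Fin N → Plane) (ξ : ℕ → Plane), 0 < r₁ → 0 < r₂ →
      0 < N → WeakDisorder a K N w → (∀ j, ‖ξ j‖ < r₁) → ∀ x : Plane,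
      {p : Fin N × (ℤ × ℤ) | ‖√(N : ℝ) • (x - displaced N w ξ p.1 - period a p.2)‖ < r₂}.Finite ∧
      ({p : Fin N × (ℤ × ℤ) |
        ‖√(N : ℝ) • (x - displaced N w ξ p.1 - period a p.2)‖ < r₂}.ncard : ℝ)
        ≤ C * max 1 ((r₁ + r₂) ^ 2) := by
  obtain ⟨C, hC, hper⟩ := exists_ncard_period_le ha
  refine ⟨C * (|K| + 1), by positivity, fun r₁ r₂ N w ξ hr₁ hr₂ hN hw hξ x => ?_⟩
  set r := r₁ + r₂ with hr
  have hN' : (0 : ℝ) < N := by exact_mod_cast hN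
  set s := √(N : ℝ) with hs
  have hs0 : 0 < s := Real.sqrt_pos.mpr hN'
  have hss : s ^ 2 = N := Real.sq_sqrt hN'.le
  set S := {p : Fin N × (ℤ × ℤ) | ‖s • (x - displaced N w ξ p.1 - period a p.2)‖ < r₂} with hS
  have hmem : ∀ p ∈ S, ‖(w p.1 - x) + period a p.2‖ < r / s := by
    rintro ⟨j, m⟩ hp
    have hp' : ‖s • (x - displaced N w ξ j - period a m)‖ < r₂ := hp
    rw [norm_smul, Real.norm_of_nonneg hs0.le] at hp'
    have h1 : ‖x - displaced N w ξ j - period a m‖ < r₂ / s := by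
      rw [lt_div_iff₀ hs0]; linarith
    have h2 : ‖s⁻¹ • ξ j‖ < r₁ / s := by
      rw [norm_smul, Real.norm_of_nonneg (by positivity), inv_mul_eq_div]
      exact div_lt_div_of_pos_right (hξ j) hs0
    have e : (w j - x) + period a m
        = -(x - displaced N w ξ j - period a m) - s⁻¹ • ξ j := by
      simp only [displaced]; abel
    simp only
    rw [e, hr, add_div]
    calc _ ≤ ‖-(x - displaced N w ξ j - period a m)‖ + ‖s⁻¹ • ξ j‖ := norm_sub_le _ _
      _ < _ := by rw [norm_neg]; linarith
  have hfib : ∀ j : Fin N, {p ∈ S | p.1 = j}.Finite ∧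
      ({p ∈ S | p.1 = j}.ncard : ℝ) ≤ C * max 1 ((r / s) ^ 2) := by
    intro j
    obtain ⟨f, n⟩ := hper (w j - x) (r / s)
    have hsub : {p ∈ S | p.1 = j} ⊆ (fun m => (j, m)) ''
        {m : ℤ × ℤ | ‖(w j - x) + period a m‖ < r / s} := by
      rintro ⟨i, m⟩ ⟨hp, rfl⟩
      exact ⟨m, hmem _ hp, rfl⟩
    refine ⟨(f.image _).subset hsub, ?_⟩
    have h1 := (Set.ncard_le_ncard hsub (f.image _)).trans (Set.ncard_image_le f)
    exact (Nat.cast_le.mpr h1).trans n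
  have hr0 : 0 < r := by positivity
  rcases le_or_gt r s with hrs | hrs
  -- the weak disorder condition is available only for radii up to `√N`; there each scatterer has a
  -- bounded number of translates in the disc
  · have h1 := ncard_le_ncard_mul_of_fibers (S := S)
      (A := {j : Fin N | ∃ m : ℤ × ℤ, dist (w j) (x + period a m) < r / s}) Prod.fst (Set.toFinite _)
      (by
        intro p hp
        have h := hmem p hp
        change ∃ m : ℤ × ℤ, dist (w p.1) (x + period a m) < r / s
        refine ⟨-p.2, ?_⟩
        have e : w p.1 - (x + -period a p.2) = (w p.1 - x) + period a p.2 := by abel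
        rw [dist_eq_norm, period_neg, e]
        exact h) (fun j _ => hfib j)
    refine ⟨h1.1, h1.2.trans ?_⟩
    have h2 := hw x r hr0 hrs
    have h3 : max 1 ((r / s) ^ 2) = 1 := by
      refine max_eq_left ?_
      rw [div_pow, div_le_one (by positivity)]
      gcongr
    rw [h3, mul_one]
    calc _ ≤ (K * max 1 (r ^ 2)) * C := by gcongr
      _ ≤ ((|K| + 1) * max 1 (r ^ 2)) * C := by
        have := le_abs_self K
        gcongr
        linarith
      _ = _ := by ring
  -- for larger radii, count the translates of all `N` scatterers by area
  · have h1 := ncard_le_ncard_mul_of_fibers (S := S) (A := (Set.univ : Set (Fin N))) Prod.fst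
      (Set.toFinite _) (fun _ _ => Set.mem_univ _) (fun j _ => hfib j)
    refine ⟨h1.1, h1.2.trans ?_⟩
    rw [Set.ncard_univ, Nat.card_eq_fintype_card, Fintype.card_fin]
    have h3 : max 1 ((r / s) ^ 2) = (r / s) ^ 2 := by
      refine max_eq_right ?_
      rw [div_pow, one_le_div (by positivity)]
      gcongr
    rw [h3, div_pow, hss]
    calc (N : ℝ) * (C * (r ^ 2 / N)) = C * 1 * r ^ 2 := by field_simp
      _ ≤ C * (|K| + 1) * max 1 (r ^ 2) := by
        gcongr
        · linarith [abs_nonneg K]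
        · exact le_max_right _ _

theorem eq_of_add_period_mem_cell {a : ℝ} (ha : 0 < a) {x : Plane} {m k : ℤ × ℤ}
    (hm : x + period a m ∈ cell a) (hk : x + period a k ∈ cell a) : m = k := by
  have hmem : ∀ {m : ℤ × ℤ}, x + period a m ∈ cell a →
      ∀ i, x i + side a i * (![(m.1 : ℝ), (m.2 : ℝ)] i) ∈ Set.Ico 0 (side a i) := by
    intro m h i
    have h0 := h.1
    have h1 := h.2
    rw [PiLp.add_apply, period_apply] at h0 h1
    fin_cases i
    · exact h0
    · exact h1
  have hint : ∀ (s y : ℝ) (p q : ℤ), 0 < s → y + s * p ∈ Set.Ico 0 s → y + s * q ∈ Set.Ico 0 s →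
      p = q := by
    intro s y p q hs hp hq
    have h1 : s * ((p : ℝ) - q) < s * 1 := by linarith [hp.2, hq.1]
    have h2 : s * ((q : ℝ) - p) < s * 1 := by linarith [hp.1, hq.2]
    have h3 := lt_of_mul_lt_mul_left h1 hs.le
    have h4 := lt_of_mul_lt_mul_left h2 hs.le
    have h5 : p - q < 1 := by exact_mod_cast h3
    have h6 : q - p < 1 := by exact_mod_cast h4
    omega
  exact Prod.ext (hint _ _ _ _ (side_pos ha 0) (hmem hm 0) (hmem hk 0))
    (hint _ _ _ _ (side_pos ha 1) (hmem hm 1) (hmem hk 1))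

/-- The translates of the fundamental rectangle are disjoint, so periodizing does not increase the
integral. -/
theorem tsum_lintegral_sub_period_le {a : ℝ} (ha : 0 < a) (h : Plane → ℝ≥0∞) :
    ∑' m : ℤ × ℤ, ∫⁻ x, h (x - period a m) ∂(torusMeasure a) ≤ ∫⁻ x, h x := by
  have h1 : ∀ m : ℤ × ℤ, ∫⁻ x, h (x - period a m) ∂(torusMeasure a)
      = ∫⁻ x in (fun y => y + period a m) ⁻¹' cell a, h x := by
    intro m
    rw [← (measurePreserving_sub_right volume (period a m)).setLIntegral_comp_preimage_emb
      (measurableEmbedding_subRight (period a m))]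
    have : (fun x => x - period a m) ⁻¹' ((fun y => y + period a m) ⁻¹' cell a) = cell a := by
      ext x; simp
    rw [this, torusMeasure]
  simp_rw [h1]
  rw [← lintegral_iUnion (fun m => (measurable_add_const _) (measurableSet_cell a))]
  · exact setLIntegral_le_lintegral _ _
  · intro m k hmk
    refine Set.disjoint_left.mpr fun x hx hx' => hmk ?_
    exact eq_of_add_period_mem_cell ha hx hx'

/-- The scaling by `√N` in the plane has Jacobian `N`. -/
theorem lintegral_comp_sqrt_smul_sub {N : ℕ} (hN : 0 < N) (h : Plane → ℝ≥0∞) (c : Plane) :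
    ∫⁻ x, h (√(N : ℝ) • (x - c)) = (N : ℝ≥0∞)⁻¹ * ∫⁻ x, h x := by
  have hN' : (0 : ℝ) < N := by exact_mod_cast hN
  have hs : √(N : ℝ) ≠ 0 := (Real.sqrt_pos.mpr hN').ne'
  rw [lintegral_sub_right_eq_self (fun x => h (√(N : ℝ) • x)) c,
    ← (measurableEmbedding_const_smul₀ hs).lintegral_map, Measure.map_addHaar_smul _ hs,
    lintegral_smul_measure, finrank_euclideanSpace_fin, Real.sq_sqrt hN'.le,
    abs_of_pos (by positivity), ENNReal.ofReal_inv_of_pos hN', ENNReal.ofReal_natCast, smul_eq_mul]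

/-- The pointwise majorant of the potential, with the absolute values of the summands. -/
noncomputable def potentialMajorant (a : ℝ) (V : Plane → ℝ) (N : ℕ) (w : Fin N → Plane)
    (x : Plane) : ℝ≥0∞ :=
  ∑ j : Fin N, ∑' m : ℤ × ℤ, ‖V (√(N : ℝ) • (x - w j - period a m))‖ₑ

theorem enorm_scattererPotential_le (a : ℝ) (V : Plane → ℝ) (N : ℕ) (w : Fin N → Plane)
    (x : Plane) : ‖scattererPotential a V N w x‖ₑ ≤ potentialMajorant a V N w x :=
  (enorm_sum_le _ _).trans (Finset.sum_le_sum fun _ _ => enorm_tsum_le_tsum_enorm)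

theorem aemeasurable_potential_summand {a : ℝ} {V : Plane → ℝ} (hV : AEStronglyMeasurable V volume)
    {N : ℕ} (hN : 0 < N) (c : Plane) (m : ℤ × ℤ) :
    AEMeasurable (fun x => ‖V (√(N : ℝ) • (x - c - period a m))‖ₑ) (torusMeasure a) := by
  have hN' : (0 : ℝ) < N := by exact_mod_cast hN
  have hs : √(N : ℝ) ≠ 0 := (Real.sqrt_pos.mpr hN').ne'
  have h1 := (Measure.quasiMeasurePreserving_smul (volume : Measure Plane) hs).comp
    (measurePreserving_sub_right volume (c + period a m)).quasiMeasurePreserving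
  have h2 := (hV.comp_quasiMeasurePreserving h1).enorm
  simp only [Function.comp_def, ← sub_sub] at h2
  exact h2.mono_measure Measure.restrict_le_self

/-- The `L²` norm of the potential is controlled by that of a single scatterer, uniformly in the
number of scatterers. -/
theorem exists_lintegral_potentialMajorant_sq_le {a : ℝ} (ha : 0 < a) (K : ℝ) :
    ∃ C : ℝ, 0 ≤ C ∧ ∀ (r₁ r₂ : ℝ) (V : Plane → ℝ) (N : ℕ) (w : Fin N → Plane) (ξ : ℕ → Plane),
      0 < r₁ → 0 < r₂ → 0 < N → AEStronglyMeasurable V volume →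
      Function.support V ⊆ Metric.ball 0 r₂ → WeakDisorder a K N w → (∀ j, ‖ξ j‖ < r₁) →
      ∫⁻ x, potentialMajorant a V N (displaced N w ξ) x ^ (2 : ℝ) ∂(torusMeasure a)
        ≤ ENNReal.ofReal (C * max 1 ((r₁ + r₂) ^ 2)) * ∫⁻ x, ‖V x‖ₑ ^ (2 : ℝ) := by
  classical
  obtain ⟨C, hC, hov⟩ := exists_ncard_overlap_le ha K
  refine ⟨C, hC, fun r₁ r₂ V N w ξ hr₁ hr₂ hN hV hsupp hw hξ => ?_⟩
  set M := C * max 1 ((r₁ + r₂) ^ 2) with hM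
  set F : Fin N → ℤ × ℤ → Plane → ℝ≥0∞ :=
    fun j m x => ‖V (√(N : ℝ) • (x - displaced N w ξ j - period a m))‖ₑ with hF
  have hpt : ∀ x, potentialMajorant a V N (displaced N w ξ) x ^ (2 : ℝ)
      ≤ ENNReal.ofReal M * ∑ j : Fin N, ∑' m : ℤ × ℤ, F j m x ^ (2 : ℝ) := by
    intro x
    obtain ⟨hfin, hcard⟩ := hov r₁ r₂ N w ξ hr₁ hr₂ hN hw hξ x
    have hzero : ∀ p : Fin N × (ℤ × ℤ), p ∉ hfin.toFinset → F p.1 p.2 x = 0 := by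
      intro p hp
      rw [Set.Finite.mem_toFinset] at hp
      simp only [hF, enorm_eq_zero]
      by_contra hne
      exact hp (mem_ball_zero_iff.mp (hsupp hne))
    have h1 : potentialMajorant a V N (displaced N w ξ) x = ∑ p ∈ hfin.toFinset, F p.1 p.2 x := by
      have e : ∑' p : Fin N × (ℤ × ℤ), F p.1 p.2 x = ∑ p ∈ hfin.toFinset, F p.1 p.2 x :=
        tsum_eq_sum hzero
      rw [← e, ENNReal.tsum_prod (f := fun j m => F j m x), tsum_fintype]
      rfl
    have h2 : ∑ j : Fin N, ∑' m : ℤ × ℤ, F j m x ^ (2 : ℝ)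
        = ∑ p ∈ hfin.toFinset, F p.1 p.2 x ^ (2 : ℝ) := by
      have e : ∑' p : Fin N × (ℤ × ℤ), F p.1 p.2 x ^ (2 : ℝ)
          = ∑ p ∈ hfin.toFinset, F p.1 p.2 x ^ (2 : ℝ) :=
        tsum_eq_sum fun p hp => by rw [hzero p hp]; simp
      rw [← e, ENNReal.tsum_prod (f := fun j m => F j m x ^ (2 : ℝ)), tsum_fintype]
    rw [h1, h2]
    -- Cauchy–Schwarz for the sum of the overlapping scatterers
    refine (ENNReal.rpow_sum_le_const_mul_sum_rpow _ _ (by norm_num)).trans ?_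
    gcongr
    rw [show (2 : ℝ) - 1 = 1 by norm_num, ENNReal.rpow_one, ← ENNReal.ofReal_natCast]
    refine ENNReal.ofReal_le_ofReal ?_
    rw [← Set.ncard_eq_toFinset_card _ hfin]
    exact hcard
  have hmeas : ∀ j m, AEMeasurable (fun x => F j m x ^ (2 : ℝ)) (torusMeasure a) := fun j m =>
    (aemeasurable_potential_summand hV hN _ m).pow_const _
  calc _ ≤ ∫⁻ x, ENNReal.ofReal M * ∑ j : Fin N, ∑' m : ℤ × ℤ, F j m x ^ (2 : ℝ)
          ∂(torusMeasure a) := lintegral_mono hpt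
    _ = ENNReal.ofReal M * ∑ j : Fin N, ∑' m : ℤ × ℤ, ∫⁻ x, F j m x ^ (2 : ℝ)
          ∂(torusMeasure a) := by
        rw [lintegral_const_mul' _ _ ENNReal.ofReal_ne_top, lintegral_finsetSum' _
          (fun j _ => AEMeasurable.tsum (hmeas j))]
        congr 1
        exact Finset.sum_congr rfl fun j _ => lintegral_tsum (hmeas j)
    _ ≤ ENNReal.ofReal M * ∑ j : Fin N, (N : ℝ≥0∞)⁻¹ * ∫⁻ x, ‖V x‖ₑ ^ (2 : ℝ) := by
        gcongr with j
        refine (le_of_eq ?_).trans ((tsum_lintegral_sub_period_le ha (fun x =>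
          ‖V (√(N : ℝ) • (x - displaced N w ξ j))‖ₑ ^ (2 : ℝ))).trans (le_of_eq
            (lintegral_comp_sqrt_smul_sub hN (fun x => ‖V x‖ₑ ^ (2 : ℝ)) _)))
        simp only [hF, sub_right_comm]
    _ = _ := by
        rw [Finset.sum_const, Finset.card_univ, Fintype.card_fin, nsmul_eq_mul, ← mul_assoc
          (N : ℝ≥0∞), ENNReal.mul_inv_cancel (by exact_mod_cast hN.ne')
          (ENNReal.natCast_ne_top N), one_mul]

/-- A solution of the eigenvalue equation has Fourier coefficients `O((|ξ|² - lam)⁻¹)`, since the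
Fourier coefficients of `W ψ` are bounded by the `L²` norm of the potential. -/
theorem exists_norm_coeff_mul_le {a : ℝ} (ha : 0 < a) (K : ℝ) :
    ∃ C : ℝ, 0 ≤ C ∧ ∀ (r₁ r₂ : ℝ) (V : Plane → ℝ) (N : ℕ) (w : Fin N → Plane) (ξ : ℕ → Plane),
      0 < r₁ → 0 < r₂ → 0 < N → MemLp V 2 volume →
      Function.support V ⊆ Metric.ball 0 r₂ → WeakDisorder a K N w → (∀ j, ‖ξ j‖ < r₁) →
      ∀ (lam : ℝ) (ψ : L2Torus a), ‖ψ‖ = 1 →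
      SolvesEigenEq a (scattererPotential a V N (displaced N w ξ)) lam ψ →
      ∀ m, ‖coeff a ψ m‖ * |quadForm a m - lam| ≤ C * max 1 (r₁ + r₂) * l2norm V := by
  obtain ⟨C, hC, hpot⟩ := exists_lintegral_potentialMajorant_sq_le ha K
  refine ⟨√C, by positivity,
    fun r₁ r₂ V N w ξ hr₁ hr₂ hN hV hsupp hw hξ lam ψ hψ ⟨g, hg, heq⟩ m => ?_⟩
  set W := scattererPotential a V N (displaced N w ξ) with hW
  set G := potentialMajorant a V N (displaced N w ξ) with hG
  have hGm : AEMeasurable G (torusMeasure a) :=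
    Finset.aemeasurable_fun_sum _ fun j _ => AEMeasurable.tsum
      fun m => aemeasurable_potential_summand hV.1 hN _ m
  have hψL := Lp.memLp ψ
  have hgL := Lp.memLp g
  have he : ∀ {φ : Plane → ℂ}, MemLp φ 2 (torusMeasure a) →
      Integrable (fun x => φ x * conj (expo a m x)) (torusMeasure a) := by
    intro φ hφ
    simp only [conj_expo]
    exact (hφ.integrable (by norm_num)).mul_bdd (c := 1 / (2 * Real.pi))
      (continuous_expo a _).aestronglyMeasurable
      (Eventually.of_forall fun x => (norm_expo a _ x).le)
  -- the Fourier coefficient of `W ψ`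
  have h1 : ∫ x, (W x : ℂ) * ψ x * conj (expo a m x) ∂(torusMeasure a)
      = ((lam - quadForm a m : ℝ) : ℂ) * coeff a ψ m := by
    have e1 : ∫ x, (W x : ℂ) * ψ x * conj (expo a m x) ∂(torusMeasure a)
        = ∫ x, ((lam : ℂ) * (ψ x * conj (expo a m x)) + g x * conj (expo a m x))
          ∂(torusMeasure a) := by
      refine integral_congr_ae (heq.mono fun x hx => ?_)
      simp only
      have : (W x : ℂ) * ψ x = lam * ψ x + g x := by rw [← hx]; ring
      rw [this]; ring
    rw [e1, integral_add ((he hψL).const_mul _) (he hgL), integral_const_mul]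
    have e2 : coeff a g m = -((‖freq a m‖ ^ 2 : ℝ) : ℂ) * coeff a ψ m := hg m
    rw [norm_freq_sq] at e2
    change (lam : ℂ) * coeff a ψ m + coeff a g m = _
    rw [e2]
    push_cast
    ring
  have h2 : ‖coeff a ψ m‖ * |quadForm a m - lam|
      = ‖∫ x, (W x : ℂ) * ψ x * conj (expo a m x) ∂(torusMeasure a)‖ := by
    rw [h1, norm_mul, Complex.norm_real, Real.norm_eq_abs, abs_sub_comm, mul_comm]
  have hVtop : eLpNorm V 2 volume ≠ ⊤ := hV.2.ne
  have hl2 : eLpNorm V 2 volume = ENNReal.ofReal (l2norm V) := by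
    rw [l2norm, ENNReal.ofReal_toReal hVtop]
  have hl0 : 0 ≤ l2norm V := ENNReal.toReal_nonneg
  have hψ2 : ∫⁻ x, ‖ψ x‖ₑ ^ (2 : ℝ) ∂(torusMeasure a) = 1 := by
    have h := eLpNorm_nnreal_pow_eq_lintegral (f := (ψ : Plane → ℂ)) (μ := torusMeasure a)
      (p := 2) (by norm_num)
    have h' : eLpNorm (ψ : Plane → ℂ) 2 (torusMeasure a) = 1 := by
      rw [Lp.norm_def] at hψ
      rw [← ENNReal.ofReal_toReal (Lp.eLpNorm_ne_top ψ), hψ, ENNReal.ofReal_one]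
    simp only [NNReal.coe_ofNat, ENNReal.coe_ofNat] at h
    rw [← h, h', ENNReal.one_rpow]
  have hV2 : ∫⁻ x, ‖V x‖ₑ ^ (2 : ℝ) = ENNReal.ofReal (l2norm V ^ 2) := by
    have h := eLpNorm_nnreal_pow_eq_lintegral (f := V) (μ := (volume : Measure Plane))
      (p := 2) (by norm_num)
    simp only [NNReal.coe_ofNat, ENNReal.coe_ofNat] at h
    rw [← h, hl2, ENNReal.ofReal_rpow_of_nonneg hl0 (by norm_num), Real.rpow_two]
  have hB : max 1 ((r₁ + r₂) ^ 2) = (max 1 (r₁ + r₂)) ^ 2 := by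
    rcases le_total 1 (r₁ + r₂) with h | h
    · rw [max_eq_right h, max_eq_right (one_le_pow₀ h)]
    · rw [max_eq_left h, max_eq_left (pow_le_one₀ (by positivity) h), one_pow]
  have hB0 : 0 ≤ max 1 (r₁ + r₂) := le_trans zero_le_one (le_max_left _ _)
  have key : ∫⁻ x, G x * ‖ψ x‖ₑ ∂(torusMeasure a)
      ≤ ENNReal.ofReal (√C * max 1 (r₁ + r₂) * l2norm V) := by
    have hcs := ENNReal.lintegral_mul_le_Lp_mul_Lq (torusMeasure a) (p := 2) (q := 2)
      Real.HolderConjugate.two_two hGm hψL.1.enorm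
    refine hcs.trans ?_
    rw [hψ2, ENNReal.one_rpow, mul_one]
    calc _ ≤ (ENNReal.ofReal ((√C * max 1 (r₁ + r₂) * l2norm V) ^ 2)) ^ (1 / 2 : ℝ) := by
          gcongr
          refine (hpot r₁ r₂ V N w ξ hr₁ hr₂ hN hV.1 hsupp hw hξ).trans (le_of_eq ?_)
          rw [hV2, ← ENNReal.ofReal_mul (by positivity), hB]
          congr 1
          rw [mul_pow, mul_pow, Real.sq_sqrt hC]
      _ = _ := by
          rw [ENNReal.ofReal_rpow_of_nonneg (by positivity) (by norm_num), ← Real.sqrt_eq_rpow,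
            Real.sqrt_sq (by positivity)]
  rw [h2]
  have h3 : ‖∫ x, (W x : ℂ) * ψ x * conj (expo a m x) ∂(torusMeasure a)‖ₑ
      ≤ ENNReal.ofReal (√C * max 1 (r₁ + r₂) * l2norm V) := by
    refine (enorm_integral_le_lintegral_enorm _).trans (le_trans (lintegral_mono fun x => ?_) key)
    rw [enorm_mul, enorm_mul]
    have e1 : ‖conj (expo a m x)‖ₑ ≤ 1 := by
      rw [← ofReal_norm, RCLike.norm_conj, norm_expo, ENNReal.ofReal_le_one,
        div_le_one (by positivity)]
      linarith [Real.pi_gt_three]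
    have e2 : ‖(W x : ℂ)‖ₑ ≤ G x := by
      have : ‖(W x : ℂ)‖ₑ = ‖W x‖ₑ := by rw [← ofReal_norm, ← ofReal_norm, Complex.norm_real]
      rw [this]
      exact enorm_scattererPotential_le a V N _ x
    calc _ ≤ G x * ‖ψ x‖ₑ * 1 := by gcongr
      _ = _ := mul_one _
  rw [← ofReal_norm, ENNReal.ofReal_le_ofReal_iff (by positivity)] at h3
  exact h3

/-! ### Uniformity in the loss and the final estimate -/

theorem integral_norm_sq_eq_one {a : ℝ} {ψ : L2Torus a} (hψ : ‖ψ‖ = 1) :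
    ∫ x, ‖ψ x‖ ^ 2 ∂(torusMeasure a) = 1 := by
  have h := inner_self_eq_norm_sq_to_K (𝕜 := ℂ) ψ
  rw [L2.inner_def, hψ] at h
  simp only [inner_self_eq_norm_sq_to_K] at h
  have h2 : ∫ x, (((‖ψ x‖ ^ 2 : ℝ)) : ℂ) ∂(torusMeasure a) = 1 := by
    simpa using h
  rw [integral_complex_ofReal] at h2
  exact_mod_cast h2

theorem ae_forall_norm_lt {p : Plane → ENNReal} {r : ℝ} (hp : Measurable p)
    (hsupp : Function.support p ⊆ Metric.ball 0 r) [IsProbabilityMeasure (volume.withDensity p)] :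
    ∀ᵐ ξ ∂(Measure.infinitePi fun _ : ℕ => volume.withDensity p), ∀ j, ‖ξ j‖ < r := by
  rw [ae_all_iff]
  intro j
  have h1 : ∀ᵐ x ∂(volume.withDensity p), ‖x‖ < r := by
    rw [ae_withDensity_iff hp]
    exact Eventually.of_forall fun x hx => mem_ball_zero_iff.mp (hsupp hx)
  rw [← Measure.infinitePi_map_eval (fun _ : ℕ => volume.withDensity p) j] at h1
  exact ae_of_ae_map (measurable_pi_apply j).aemeasurable h1

/-- For `E` in a bounded range, a power of `E` with exponent of either sign is bounded below. -/
theorem rpow_neg_abs_le {E Z e : ℝ} (hE : 1 / 2 ≤ E) (hZ : 2 ≤ Z) (hEZ : E ≤ Z) :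
    Z ^ (-|e|) ≤ E ^ e := by
  have hE0 : 0 < E := by linarith
  rcases le_total 0 e with h | h
  · rw [abs_of_nonneg h, Real.rpow_neg (by linarith), ← Real.inv_rpow (by linarith)]
    refine Real.rpow_le_rpow (by positivity) ?_ h
    rw [inv_eq_one_div]
    exact (one_div_le_one_div_of_le (by norm_num) hZ).trans hE
  · rw [abs_of_nonpos h, neg_neg]
    exact Real.rpow_le_rpow_of_nonpos hE0 hEZ h

/-- For `ψ` of unit norm, the left-hand side is bounded in terms of the supremum of `f`. -/
theorem exists_trivial_bound {a : ℝ} (ha : 0 < a) {f : Plane → ℂ} (hf : IsTestFunction a f) :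
    ∃ C : ℝ, 0 ≤ C ∧ ∀ ψ : Plane → ℂ, ∫ x, ‖ψ x‖ ^ 2 ∂(torusMeasure a) = 1 →
      ‖(∫ x, f x * ((‖ψ x‖ ^ 2 : ℝ) : ℂ) ∂(torusMeasure a))
        - (1 / (4 * Real.pi ^ 2) : ℝ) * ∫ x, f x ∂(torusMeasure a)‖ ≤ C := by
  obtain ⟨B, hB⟩ := exists_norm_le_of_periodic ha hf.1.continuous hf.2
  have hB0 : 0 ≤ B := (norm_nonneg _).trans (hB 0)
  refine ⟨B + ‖((1 / (4 * Real.pi ^ 2) : ℝ) : ℂ) * ∫ x, f x ∂(torusMeasure a)‖, by positivity,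
    fun ψ hψ => (norm_sub_le _ _).trans ?_⟩
  gcongr
  have hint : Integrable (fun x => ‖ψ x‖ ^ 2) (torusMeasure a) := by
    by_contra h
    rw [integral_undef h] at hψ
    exact zero_ne_one hψ
  calc _ ≤ ∫ x, B * ‖ψ x‖ ^ 2 ∂(torusMeasure a) := by
        refine norm_integral_le_of_norm_le (hint.const_mul B) (Eventually.of_forall fun x => ?_)
        rw [norm_mul, Complex.norm_real, Real.norm_of_nonneg (by positivity)]
        gcongr
        exact hB x
    _ = B := by rw [integral_const_mul, hψ, mul_one]

/-- For a fixed loss `ε`, the equidistribution estimate outside a set of density zero, for functions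
whose Fourier coefficients decay away from the circle `|ξ|² = lam`. -/
theorem exists_exceptional_set {a θ ε : ℝ} (ha : 0 < a) (hθ : 1 / 4 ≤ θ)
    (hcirc : CircleLaw a θ) (hε : 0 < ε) :
    ∃ S ⊆ laplaceSpectrum a, Tendsto (relCount a S) atTop (𝓝 0) ∧
      ∀ f : Plane → ℂ, IsTestFunction a f → ∃ C : ℝ, 0 ≤ C ∧
        ∀ n ∈ laplaceSpectrum a, n ∉ S → 1 ≤ n → ∀ lam : ℝ, n < lam →
        (∀ n' ∈ laplaceSpectrum a, n < n' → lam < n') →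
        ∀ E : ℝ, lam ∈ Set.Icc E (2 * E) → ∀ (b : ℝ) (ψ : Plane → ℂ), 0 ≤ b →
        MemLp ψ 2 (torusMeasure a) → ∫ x, ‖ψ x‖ ^ 2 ∂(torusMeasure a) = 1 →
        (∀ m, ‖coeff a ψ m‖ * |quadForm a m - lam| ≤ b) →
        ‖(∫ x, f x * ((‖ψ x‖ ^ 2 : ℝ) : ℂ) ∂(torusMeasure a))
          - (1 / (4 * Real.pi ^ 2) : ℝ) * ∫ x, f x ∂(torusMeasure a)‖
          ≤ C * (b + 1) * E ^ (-(1 - 3 * θ) / 2 + ε) := by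
  set e := -(1 - 3 * θ) / 2 + ε with he
  rcases le_or_gt 0 e with he0 | he0
  -- for a nonnegative exponent the estimate is trivial, as `E ≥ 1/2`
  · refine ⟨∅, Set.empty_subset _, ?_, fun f hf => ?_⟩
    · have : relCount a ∅ = fun _ => 0 := by funext X; simp [relCount]
      rw [this]; exact tendsto_const_nhds
    · obtain ⟨C₀, hC₀, htriv⟩ := exists_trivial_bound ha hf
      refine ⟨C₀ * 2 ^ e, by positivity, ?_⟩
      intro n hn _ hn1 lam hlam hnext E hE b ψ hb hψ hnorm hco
      have hE2 : 1 / 2 ≤ E := by linarith [hE.2]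
      have h1 : (1 / 2 : ℝ) ^ e ≤ E ^ e := Real.rpow_le_rpow (by norm_num) hE2 he0
      have h2 : (2 : ℝ) ^ e * (1 / 2 : ℝ) ^ e = 1 := by
        rw [← Real.mul_rpow (by norm_num) (by norm_num)]; norm_num
      calc _ ≤ C₀ := htriv ψ hnorm
        _ = C₀ * ((2 : ℝ) ^ e * (1 / 2 : ℝ) ^ e) := by rw [h2, mul_one]
        _ = C₀ * 2 ^ e * 1 * (1 / 2 : ℝ) ^ e := by ring
        _ ≤ C₀ * 2 ^ e * (b + 1) * E ^ e := by
          gcongr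
          linarith
  · obtain ⟨S, hS, hsparse, hgood⟩ := exists_powerSparse_exceptional_set ha hθ hcirc hε
      (by linarith)
    refine ⟨S, hS, hsparse.tendsto_relCount ha, fun f hf => ?_⟩
    obtain ⟨C, hC, hequi⟩ := exists_equidistribution_bound ha (ε := ε / 3) (by positivity) hf
    refine ⟨C * 2 * (1 / 2) ^ e, by positivity, ?_⟩
    intro n hn hnS hn1 lam hlam hnext E hE b ψ hb hψ hnorm hco
    obtain ⟨hlam2, A, hA, htail⟩ := hgood n hn hnS hn1 lam hlam hnext
    have hn0 : 0 < n := by linarith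
    have hE0 : 0 < E := by linarith [hE.2]
    have hne : n ^ e ≤ (1 / 2) ^ e * E ^ e := by
      rw [← Real.mul_rpow (by norm_num) hE0.le]
      refine Real.rpow_le_rpow_of_nonpos (by positivity) ?_ he0.le
      linarith [hE.1]
    have hninv : n⁻¹ ≤ n ^ e := by
      rw [← Real.rpow_neg_one]
      exact Real.rpow_le_rpow_of_exponent_le hn1 (by linarith)
    have h1 := hequi n (b * (2 * n ^ e)) hn1 (by positivity) A ψ hψ hnorm hA (by
      intro F hF
      have hterm : ∀ m ∈ F, ‖coeff a ψ m‖ ^ 2 ≤ b ^ 2 * (1 / (quadForm a m - lam) ^ 2) := by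
        intro m _
        have hne : quadForm a m - lam ≠ 0 := by
          intro h0
          have h2 : quadForm a m = lam := by linarith
          exact lt_irrefl _ (hnext lam (mem_laplaceSpectrum.mpr ⟨m, h2⟩) hlam)
        have h3 := pow_le_pow_left₀ (by positivity) (hco m) 2
        rw [mul_pow, sq_abs] at h3
        rw [mul_one_div, le_div_iff₀ (by positivity)]
        exact h3
      calc _ ≤ ∑ m ∈ F, b ^ 2 * (1 / (quadForm a m - lam) ^ 2) := Finset.sum_le_sum hterm
        _ = b ^ 2 * ∑ m ∈ F, 1 / (quadForm a m - lam) ^ 2 := by rw [Finset.mul_sum]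
        _ ≤ b ^ 2 * (4 * n ^ (-(1 - 3 * θ) + 2 * ε)) := by gcongr; exact htail F hF
        _ = _ := by
          have : n ^ (-(1 - 3 * θ) + 2 * ε) = (n ^ e) ^ 2 := by
            rw [← Real.rpow_natCast (n ^ e) 2, ← Real.rpow_mul hn0.le]
            congr 1
            rw [he]; push_cast; ring
          rw [this]; ring)
    calc _ ≤ C * (b * (2 * n ^ e) + n⁻¹) := h1
      _ ≤ C * (b * (2 * n ^ e) + 2 * n ^ e) := by
        have : 0 ≤ n ^ e := by positivity
        gcongr
        linarith
      _ = C * 2 * (b + 1) * n ^ e := by ring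
      _ ≤ C * 2 * (b + 1) * ((1 / 2) ^ e * E ^ e) := by gcongr
      _ = _ := by ring

theorem exists_mem_laplaceSpectrum_gt {a : ℝ} (ha : 0 < a) (Y : ℝ) :
    ∃ n ∈ laplaceSpectrum a, Y < n := by
  obtain ⟨k, hk⟩ := exists_nat_gt (Y * a ^ 2)
  refine ⟨quadForm a (k, 0), mem_laplaceSpectrum.mpr ⟨_, rfl⟩, ?_⟩
  have h1 : quadForm a (k, 0) = (k : ℝ) ^ 2 / a ^ 2 := by simp [quadForm]
  rw [h1, lt_div_iff₀ (by positivity)]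
  refine hk.trans_le ?_
  exact_mod_cast Nat.le_self_pow (by norm_num) k

/-- The complement of a set of density zero has full density, also after discarding the eigenvalues
below `1`. -/
theorem isFullDensity_of_tendsto_relCount {a : ℝ} (ha : 0 < a) {B : Set ℝ}
    (hBsub : B ⊆ laplaceSpectrum a) (hB : Tendsto (relCount a B) atTop (𝓝 0)) :
    IsFullDensity a {n | n ∈ laplaceSpectrum a ∧ 1 ≤ n ∧ n ∉ B} := by
  refine ⟨fun n hn => hn.1, ?_⟩
  set Q' := {n | n ∈ laplaceSpectrum a ∧ 1 ≤ n ∧ n ∉ B} with hQ'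
  set L := laplaceSpectrum a ∩ Set.Iic 1 with hL
  have hL0 : Tendsto (relCount a L) atTop (𝓝 0) := by
    refine IsPowerSparse.tendsto_relCount ha ⟨1, one_pos, L.ncard, by positivity, fun X _ => ?_⟩
    rw [sub_self, Real.rpow_zero, mul_one]
    exact_mod_cast Set.ncard_le_ncard Set.inter_subset_left (finite_laplaceSpectrum_inter_Iic ha 1)
  have hlim : Tendsto (fun X => 1 - (relCount a B X + relCount a L X)) atTop (𝓝 1) := by
    simpa using (hB.add hL0).const_sub 1
  refine tendsto_of_tendsto_of_tendsto_of_le_of_le' hlim tendsto_const_nhds ?_ ?_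
  · filter_upwards [eventually_ge_atTop 0] with X hX
    have hfin := finite_laplaceSpectrum_inter_Iic ha X
    have hpos : 0 < (laplaceSpectrum a ∩ Set.Iic X).ncard := by
      rw [Set.ncard_pos hfin]
      exact ⟨0, mem_laplaceSpectrum.mpr ⟨0, by simp [quadForm]⟩, hX⟩
    have hpos' : (0 : ℝ) < (laplaceSpectrum a ∩ Set.Iic X).ncard := by exact_mod_cast hpos
    have hcover : laplaceSpectrum a ∩ Set.Iic X ⊆
        (Q' ∩ Set.Iic X) ∪ ((B ∩ Set.Iic X) ∪ (L ∩ Set.Iic X)) := by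
      rintro n ⟨hn, hnX⟩
      by_cases h1 : 1 ≤ n
      · by_cases h2 : n ∈ B
        · exact Or.inr (Or.inl ⟨h2, hnX⟩)
        · exact Or.inl ⟨⟨hn, h1, h2⟩, hnX⟩
      · exact Or.inr (Or.inr ⟨⟨hn, (not_le.mp h1).le⟩, hnX⟩)
    have hB' : (B ∩ Set.Iic X).Finite := hfin.subset (Set.inter_subset_inter_left _ hBsub)
    have hQ'' : (Q' ∩ Set.Iic X).Finite :=
      hfin.subset (Set.inter_subset_inter_left _ fun n hn => hn.1)
    have hL' : (L ∩ Set.Iic X).Finite :=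
      (finite_laplaceSpectrum_inter_Iic ha 1).subset Set.inter_subset_left
    have hc : (laplaceSpectrum a ∩ Set.Iic X).ncard ≤ _ :=
      (Set.ncard_le_ncard hcover (hQ''.union (hB'.union hL'))).trans
      ((Set.ncard_union_le _ _).trans (Nat.add_le_add_left (Set.ncard_union_le _ _) _))
    have hc' := (Nat.cast_le (α := ℝ)).mpr hc
    push_cast at hc'
    unfold relCount
    rw [← add_div, le_div_iff₀ hpos', sub_mul, div_mul_cancel₀ _ hpos'.ne']
    linarith
  · filter_upwards with X
    refine div_le_one_of_le₀ ?_ (by positivity)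
    have hsub : Q' ∩ Set.Iic X ⊆ laplaceSpectrum a ∩ Set.Iic X :=
      Set.inter_subset_inter_left _ fun n hn => hn.1
    exact_mod_cast Set.ncard_le_ncard hsub (finite_laplaceSpectrum_inter_Iic ha X)

theorem corollary1p3 (a : ℝ) (ha : 0 < a) (θ : ℝ) (hθ : 1 / 4 ≤ θ) (hcirc : CircleLaw a θ) :
    ∃ Q' : Set ℝ, IsFullDensity a Q' ∧
      ∀ K η : ℝ, 0 < η →
        ∃ C : ℝ → (Plane → ℂ) → ℝ,
          ∀ (r₁ r₂ : ℝ) (V : Plane → ℝ) (p : Plane → ENNReal) (w : (N : ℕ) → Fin N → Plane),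
            0 < r₁ → 0 < r₂ → η ≤ r₁ + r₂ →
            MemLp V 2 volume → Function.support V ⊆ Metric.ball 0 r₂ →
            (l2norm V = 0 ∨ η ≤ l2norm V) →
            Measurable p → Function.support p ⊆ Metric.ball 0 r₁ →
            ∀ [IsProbabilityMeasure (volume.withDensity p)],
            (∀ N : ℕ, 0 < N → WeakDisorder a K N (w N)) →
            ∀ᵐ ξ ∂(Measure.infinitePi fun _ : ℕ => volume.withDensity p),
              ∀ N : ℕ, 0 < N → ∀ E : ℝ, 0 < E →
              ∀ (ψ : HilbertBasis ℕ ℂ (L2Torus a)) (lam : ℕ → ℝ),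
                (∀ k, SolvesEigenEq a (scattererPotential a V N (displaced N (w N) ξ))
                  (lam k) (ψ k)) →
                ∀ ε : ℝ, 0 < ε → ∀ f : Plane → ℂ, IsTestFunction a f →
                ∀ k : ℕ, lam k ∈ sigmaSet a Q' ∩ Set.Icc E (2 * E) →
                  ‖(∫ x, f x * ((‖ψ k x‖ ^ 2 : ℝ) : ℂ) ∂(torusMeasure a))
                      - (1 / (4 * Real.pi ^ 2) : ℝ) * ∫ x, f x ∂(torusMeasure a)‖
                    ≤ C ε f * ((r₁ + r₂) ^ 2 * l2norm V * E ^ (-(1 - 3 * θ) / 2 + ε)) := by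
  -- a single exceptional set that serves all losses `1 / (j + 1)`
  have hSex := fun j : ℕ => exists_exceptional_set (ε := 1 / ((j : ℝ) + 1)) ha hθ hcirc
    (by positivity)
  choose S hSsub hSdens hSbound using hSex
  obtain ⟨B, hBsub, hBdens, hBabs⟩ := exists_absorbing_density_zero ha S hSsub hSdens
  refine ⟨_, isFullDensity_of_tendsto_relCount ha hBsub hBdens, fun K η hη => ?_⟩
  obtain ⟨C₁, hC₁, hco⟩ := exists_norm_coeff_mul_le ha K
  -- the estimate with a scale `v ≥ 1`, later `(r₁ + r₂) ^ 2 * ‖V‖₂ / η ^ 3`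
  have hconst : ∀ (ε : ℝ) (f : Plane → ℂ), ∃ C : ℝ, 0 < ε → IsTestFunction a f →
      ∀ (n lam E b v : ℝ) (ψ : Plane → ℂ), n ∈ laplaceSpectrum a → 1 ≤ n → n ∉ B → n < lam →
      (∀ n' ∈ laplaceSpectrum a, n < n' → lam < n') → lam ∈ Set.Icc E (2 * E) → 0 ≤ b → 1 ≤ v →
      b ≤ C₁ * (1 + η) * η * v → MemLp ψ 2 (torusMeasure a) →
      ∫ x, ‖ψ x‖ ^ 2 ∂(torusMeasure a) = 1 →
      (∀ m, ‖coeff a ψ m‖ * |quadForm a m - lam| ≤ b) →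
      ‖(∫ x, f x * ((‖ψ x‖ ^ 2 : ℝ) : ℂ) ∂(torusMeasure a))
        - (1 / (4 * Real.pi ^ 2) : ℝ) * ∫ x, f x ∂(torusMeasure a)‖
        ≤ C * (v * E ^ (-(1 - 3 * θ) / 2 + ε)) := by
    intro ε f
    by_cases hεf : 0 < ε ∧ IsTestFunction a f
    swap
    · exact ⟨0, fun h1 h2 => absurd ⟨h1, h2⟩ hεf⟩
    obtain ⟨hε, hf⟩ := hεf
    obtain ⟨j, hj⟩ := exists_nat_one_div_lt hε
    obtain ⟨C₂, hC₂, hb2⟩ := hSbound j f hf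
    obtain ⟨C₃, hC₃, htriv⟩ := exists_trivial_bound ha hf
    obtain ⟨Y, hY⟩ := hBabs j
    obtain ⟨n₀, hn₀, hYn₀⟩ := exists_mem_laplaceSpectrum_gt ha Y
    set e := -(1 - 3 * θ) / 2 + ε with he
    set d := ε - 1 / ((j : ℝ) + 1) with hd
    have hd0 : 0 ≤ d := by linarith
    set Z := max 2 n₀ with hZ
    have hZ2 : 2 ≤ Z := le_max_left _ _
    set D := C₂ * (C₁ * (1 + η) * η + 1) * 2 ^ d with hD
    have hD0 : 0 ≤ D := by positivity
    refine ⟨D + C₃ * Z ^ |e|, fun _ _ n lam E b v ψ hn hn1 hnB hlam hnext hE hb hv hbv hψ hnorm hco =>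
      ?_⟩
    have hE2 : 1 / 2 ≤ E := by linarith [hE.2]
    have hE0 : 0 < E := by linarith
    by_cases hnS : n ∈ S j
    -- exceptional eigenvalues outside `B` are bounded, so the trivial estimate suffices
    · have hnY : n < Y := by
        by_contra hcon
        exact hnB (hY n hnS (not_lt.mp hcon))
      have hEZ : E ≤ Z := by
        have := hnext n₀ hn₀ (by linarith)
        linarith [hE.1, le_max_right 2 n₀]
      have h1 := rpow_neg_abs_le (e := e) hE2 hZ2 hEZ
      have h2 : Z ^ |e| * Z ^ (-|e|) = 1 := by
        rw [← Real.rpow_add (by linarith), add_neg_cancel, Real.rpow_zero]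
      calc _ ≤ C₃ := htriv ψ hnorm
        _ = C₃ * (Z ^ |e| * Z ^ (-|e|)) := by rw [h2, mul_one]
        _ = C₃ * Z ^ |e| * (1 * Z ^ (-|e|)) := by ring
        _ ≤ C₃ * Z ^ |e| * (v * E ^ e) := by gcongr
        _ ≤ _ := by
          gcongr
          linarith
    · have h1 := hb2 n hn hnS hn1 lam hlam hnext E hE b ψ hb hψ hnorm hco
      have h2 : E ^ (-(1 - 3 * θ) / 2 + 1 / ((j : ℝ) + 1)) ≤ 2 ^ d * E ^ e := by
        have h3 : 1 ≤ (2 * E) ^ d := Real.one_le_rpow (by linarith) hd0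
        rw [Real.mul_rpow (by norm_num) hE0.le] at h3
        have h4 : E ^ e = E ^ (-(1 - 3 * θ) / 2 + 1 / ((j : ℝ) + 1)) * E ^ d := by
          rw [← Real.rpow_add hE0]
          congr 1
          rw [he, hd]; ring
        rw [h4]
        calc _ = E ^ (-(1 - 3 * θ) / 2 + 1 / ((j : ℝ) + 1)) * 1 := (mul_one _).symm
          _ ≤ E ^ (-(1 - 3 * θ) / 2 + 1 / ((j : ℝ) + 1)) * (2 ^ d * E ^ d) := by gcongr
          _ = _ := by ring
      calc _ ≤ C₂ * (b + 1) * E ^ (-(1 - 3 * θ) / 2 + 1 / ((j : ℝ) + 1)) := h1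
        _ ≤ C₂ * (C₁ * (1 + η) * η * v + 1 * v) * (2 ^ d * E ^ e) := by
          gcongr
          linarith
        _ = D * (v * E ^ e) := by rw [hD]; ring
        _ ≤ _ := by
          gcongr
          have : 0 ≤ C₃ * Z ^ |e| := by positivity
          linarith
  choose C hC using hconst
  refine ⟨fun ε f => C ε f / η ^ 3, ?_⟩
  intro r₁ r₂ V p w hr₁ hr₂ hηr hV hVsupp hVnorm hp hpsupp _ hw
  filter_upwards [ae_forall_norm_lt hp hpsupp] with ξ hξ
  intro N hN E hE ψ lam hsolve ε hε f hf k hk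
  obtain ⟨⟨n, ⟨hn, hn1, hnB⟩, hnlam, hnext⟩, hkE⟩ := hk
  have hψ1 : ‖ψ k‖ = 1 := ψ.orthonormal.1 k
  have hψL := Lp.memLp (ψ k)
  have hnorm := integral_norm_sq_eq_one hψ1
  have hco' := hco r₁ r₂ V N (w N) ξ hr₁ hr₂ hN hV hVsupp (hw N hN) hξ (lam k) (ψ k) hψ1 (hsolve k)
  rcases hVnorm with hV0 | hVη
  -- without a potential, `lam k` would be an eigenvalue of the Laplacian
  · exfalso
    have hzero : ∀ m, coeff a (ψ k) m = 0 := by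
      intro m
      have h1 := hco' m
      rw [hV0, mul_zero] at h1
      have hne : quadForm a m - lam k ≠ 0 := by
        intro h0
        have h2 : quadForm a m = lam k := by linarith
        exact lt_irrefl _ (hnext _ (mem_laplaceSpectrum.mpr ⟨m, h2⟩) hnlam)
      have h3 : ‖coeff a (ψ k) m‖ * |quadForm a m - lam k| = 0 := le_antisymm h1 (by positivity)
      rcases mul_eq_zero.mp h3 with h | h
      · exact norm_eq_zero.mp h
      · exact absurd (abs_eq_zero.mp h) hne
    have h4 := hasSum_norm_coeff_sq ha hψL
    simp only [hzero, norm_zero] at h4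
    rw [hnorm] at h4
    have h5 : HasSum (fun _ : ℤ × ℤ => (0 : ℝ) ^ 2) 0 := by
      simp
    exact one_ne_zero (h4.unique h5)
  · set r := r₁ + r₂ with hr
    have hr0 : 0 < r := by positivity
    have hl0 : 0 < l2norm V := hη.trans_le hVη
    have hv1 : η ^ 3 ≤ r ^ 2 * l2norm V := by
      calc η ^ 3 = η ^ 2 * η := by ring
        _ ≤ r ^ 2 * l2norm V := by gcongr
    have hmax : max 1 r * η ^ 2 ≤ (1 + η) * r ^ 2 := by
      have h1 : 1 * η ^ 2 ≤ (1 + η) * r ^ 2 := by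
        have : η ^ 2 ≤ r ^ 2 := by gcongr
        nlinarith
      have h2 : r * η ^ 2 ≤ (1 + η) * r ^ 2 := by nlinarith [mul_pos hr0 hη]
      rw [max_mul_of_nonneg _ _ (by positivity)]
      exact max_le h1 h2
    have h := hC ε f hε hf n (lam k) E (C₁ * max 1 r * l2norm V) (r ^ 2 * l2norm V / η ^ 3) (ψ k)
      hn hn1 hnB hnlam hnext hkE (by positivity) ((one_le_div (by positivity)).mpr hv1) (by
        have : C₁ * (1 + η) * η * (r ^ 2 * l2norm V / η ^ 3)
            = C₁ * ((1 + η) * r ^ 2) * l2norm V / η ^ 2 := by field_simp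
        rw [this, le_div_iff₀ (by positivity)]
        calc C₁ * max 1 r * l2norm V * η ^ 2 = C₁ * (max 1 r * η ^ 2) * l2norm V := by ring
          _ ≤ C₁ * ((1 + η) * r ^ 2) * l2norm V := by gcongr) hψL hnorm hco'
    refine h.trans (le_of_eq ?_)
    ring
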